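/- Let $n \ge 3$ be an odd integer and $m = 2^{(n-1)/2}$. Let $\hat\rho : \mathrm{Cl}(n,\mathbb{C}) \to \mathrm{End}(\Delta)$ be the spin representation, i.e. a surjective algebra homomorphism (with the convention $E_aE_b+E_bE_a=-2\delta_{ab}$ for the standard basis $E_1,\dots,E_n$ of $\mathbb{R}^n$), where $\Delta$ is a Hermitian vector space of complex dimension $m$, each $\hat\rho(E_a)$ is skew-adjoint, and $i^{(n+1)/2}\hat\rho(E_1)\cdots\hat\rho(E_n)=\mathrm{id}$. Fix an orthonormal basis $\hat s_1,\dots,\hat s_m$ of $\Delta$ and put $\omega_{a\alpha\beta}=\langle\hat\rho(E_a)\hat s_\alpha,\hat s_\beta\rangle$, where $\langle\cdot,\cdot\rangle$ is linear in the first slot. Let $\Omega\subset\mathbb{R}^n$ be a compact domain with smooth boundary $\Sigma=\partial\Omega$, let $g$ be a smooth Riemannian metric on an open set $U \supset \Omega$, with scalar curvature $R$, let $\nu$ be the outward-pointing $g$-unit normal along $\Sigma$, and let $H$ be the mean curvature of $\Sigma$ with respect to $g$, i.e. the trace of $\xi\mapsto\nabla_\xi\nu$ on $T\Sigma$. Let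 $e_1,\dots,e_n$ be a smooth positively oriented $g$-orthonormal frame on $U$, and use it to identify the spinor bundle of $g$ over $\Omega$ with $\Omega\times\Delta$: Clifford multiplication is $\xi\cdot s=\sum_k g(\xi,e_k)\,\hat\rho(E_k)s$, the spin connection is $\nabla_\xi s=\xi(s)+\frac14\sum_{k,l}g(\nabla_\xi e_k,e_l)\,e_k\cdot e_l\cdot s$, with $\nabla_\xi e_k$ the Levi-Civita derivative, and the Dirac operator is $\mathcal{D}s=\sum_k e_k\cdot\nabla_{e_k}s$. A harmonic spinor on $\Omega$ is a spinor $s$, smooth up to the boundary, with $\mathcal{D}s=0$ in $\Omega$; a spinor is parallel if $\nabla s=0$ in $\Omega$. Let $N:\Sigma\to S^{n-1}$ be a smooth map. For $x \in \Sigma$ let $\|dN\|_{\mathrm{tr}}=\sup_Q\mathrm{tr}(Q\circ dN)$ be the trace norm of $dN:T_x\Sigma\to T_{N(x)}S^{n-1}$, where $Q$ ranges over the linear isometries $T_{N(x)}S^{n-1}\to T_x\Sigma$, $T_x\Sigma$ carries the inner product $g$, and $T_{N(x)}S^{n-1}$ the standard one. For an $m$-tuple $s=(s_1,\dots,s_m)$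 of spinors define on $\Sigma$ $$(\chi s)_\alpha=-\sum_{a=1}^n\sum_{\beta=1}^m\langle N,E_a\rangle\,\omega_{a\alpha\beta}\,\nu\cdot s_\beta .$$ Assume that $R\ge 0$ at each point of $\Omega$ and $H\ge\|dN\|_{\mathrm{tr}}$ at each point of $\Sigma$. Then: 1. every $m$-tuple $s=(s_1,\dots,s_m)$ of harmonic spinors on $\Omega$ with $\chi s=s$ on $\Sigma$ is parallel, i.e. each $s_\alpha$ is parallel; 2. every $m$-tuple $s=(s_1,\dots,s_m)$ of harmonic spinors on $\Omega$ with $\chi s=-s$ on $\Sigma$ is parallel. -/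

import Mathlib

open scoped ContDiff InnerProductSpace BigOperators

namespace SpinBVP

noncomputable section

/-- Euclidean space `ℝⁿ`. -/
abbrev Eucl (n : ℕ) : Type := EuclideanSpace ℝ (Fin n)

/-- The standard basis vector `E_a` of `ℝⁿ`. -/
def stdVec {n : ℕ} (a : Fin n) : Eucl n := EuclideanSpace.single a (1 : ℝ)

/-! ### The spin representation -/

/-- The quadratic form `z ↦ -∑ z_a²` on `ℂⁿ`; its Clifford algebra is `Cl(n, ℂ)`, with the
convention `E_a E_b + E_b E_a = -2 δ_{ab}`. -/
def cliffordForm (n : ℕ) : QuadraticForm ℂ (Fin n → ℂ) :=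
  QuadraticMap.weightedSumSquares ℂ (fun _ : Fin n => (-1 : ℂ))

/-- The generator `E_a` of `Cl(n, ℂ)`. -/
def cliffordGen (n : ℕ) (a : Fin n) : CliffordAlgebra (cliffordForm n) :=
  CliffordAlgebra.ι (cliffordForm n) (Pi.single a (1 : ℂ))

/-- A spin representation of `Cl(n, ℂ)` (`n` odd) on the Hermitian space `Δ`: a surjective algebra
homomorphism `Cl(n, ℂ) → End(Δ)` for which the generators act by skew-adjoint maps, normalized
by `i^((n+1)/2) E_1 ⋯ E_n = id`. -/
structure SpinRep (n : ℕ) (Δ : Type*) [NormedAddCommGroup Δ] [InnerProductSpace ℂ Δ] where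
  toHom : CliffordAlgebra (cliffordForm n) →ₐ[ℂ] Module.End ℂ Δ
  surjective : Function.Surjective toHom
  skew : ∀ (a : Fin n) (x y : Δ),
    ⟪toHom (cliffordGen n a) x, y⟫_ℂ = - ⟪x, toHom (cliffordGen n a) y⟫_ℂ
  volume : Complex.I ^ ((n + 1) / 2) • toHom ((List.ofFn (cliffordGen n)).prod) = 1

/-- The endomorphism of `Δ` by which `E_a` acts. -/
def SpinRep.gamma {n : ℕ} {Δ : Type*} [NormedAddCommGroup Δ] [InnerProductSpace ℂ Δ]
    (ρ : SpinRep n Δ) (a : Fin n) : Module.End ℂ Δ :=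
  ρ.toHom (cliffordGen n a)

/-- The coefficients `ω_{aαβ} = ⟨E_a ŝ_α, ŝ_β⟩` with respect to an orthonormal basis `ŝ` of `Δ`.
(The Hermitian product `⟨·,·⟩` is linear in its first slot, Mathlib's `inner` in its second.) -/
def omegaCoeff {n m : ℕ} {Δ : Type*} [NormedAddCommGroup Δ] [InnerProductSpace ℂ Δ]
    (ρ : SpinRep n Δ) (b : OrthonormalBasis (Fin m) ℂ Δ) (a : Fin n) (α β : Fin m) : ℂ :=
  ⟪b β, ρ.gamma a (b α)⟫_ℂ

/-! ### Riemannian metrics on open subsets of `ℝⁿ` -/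

/-- `g` is a smooth Riemannian metric on the set `U` (which is open in all applications). -/
structure IsRiemannianMetricOn {n : ℕ} (g : Eucl n → Eucl n →L[ℝ] Eucl n →L[ℝ] ℝ)
    (U : Set (Eucl n)) : Prop where
  smooth : ContDiffOn ℝ ∞ g U
  symm : ∀ p ∈ U, ∀ X Y, g p X Y = g p Y X
  pos : ∀ p ∈ U, ∀ X, X ≠ 0 → 0 < g p X X

/-- The covector `Z ↦ ½ ((D_X g)(Y, Z) + (D_Y g)(X, Z) - (D_Z g)(X, Y))` of the Koszul formula for
constant vector fields `X`, `Y`, `Z`. -/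
def koszul {n : ℕ} (g : Eucl n → Eucl n →L[ℝ] Eucl n →L[ℝ] ℝ) (p X Y : Eucl n) :
    Eucl n →L[ℝ] ℝ :=
  (1 / 2 : ℝ) • (fderiv ℝ g p X Y + fderiv ℝ g p Y X - ((fderiv ℝ g p).flip X).flip Y)

/-- The Christoffel map: `Γ_p(X, Y) = ∇_X Y` at `p` for constant vector fields `X`, `Y` and the
Levi-Civita connection of `g`, i.e. `g(Γ(X, Y), Z)` is the Koszul expression. -/
def christoffel {n : ℕ} (g : Eucl n → Eucl n →L[ℝ] Eucl n →L[ℝ] ℝ) (p X Y : Eucl n) : Eucl n :=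
  (g p).inverse (koszul g p X Y)

/-- The Riemann curvature tensor `Rm(X, Y) Z = ∇_X ∇_Y Z - ∇_Y ∇_X Z` (`X`, `Y`, `Z` constant). -/
def riemann {n : ℕ} (g : Eucl n → Eucl n →L[ℝ] Eucl n →L[ℝ] ℝ) (p X Y Z : Eucl n) : Eucl n :=
  fderiv ℝ (fun q => christoffel g q Y Z) p X - fderiv ℝ (fun q => christoffel g q X Z) p Y
    + christoffel g p X (christoffel g p Y Z) - christoffel g p Y (christoffel g p X Z)

/-- The Ricci tensor `Ric(Y, Z) = tr (X ↦ Rm(X, Y) Z)`. -/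
def ricci {n : ℕ} (g : Eucl n → Eucl n →L[ℝ] Eucl n →L[ℝ] ℝ) (p Y Z : Eucl n) : ℝ :=
  ∑ i : Fin n, riemann g p (stdVec i) Y Z i

/-- The scalar curvature `R = ∑_{j,l} g^{jl} Ric(E_j, E_l)`; note that the `g`-gradient of the
`j`-th coordinate function is `∑_l g^{jl} E_l`. -/
def scalarCurvature {n : ℕ} (g : Eucl n → Eucl n →L[ℝ] Eucl n →L[ℝ] ℝ) (p : Eucl n) : ℝ :=
  ∑ j : Fin n, ricci g p (stdVec j) ((g p).inverse (EuclideanSpace.proj j))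

/-- `e = (e_1, …, e_n)` is a smooth, positively oriented, `g`-orthonormal frame on `U`. -/
structure IsOrientedOrthonormalFrameOn {n : ℕ} (g : Eucl n → Eucl n →L[ℝ] Eucl n →L[ℝ] ℝ)
    (e : Fin n → Eucl n → Eucl n) (U : Set (Eucl n)) : Prop where
  smooth : ∀ k, ContDiffOn ℝ ∞ (e k) U
  orthonormal : ∀ p ∈ U, ∀ k l, g p (e k p) (e l p) = if k = l then 1 else 0
  oriented : ∀ p ∈ U, 0 < (Matrix.of fun k j : Fin n => e k p j).det

/-! ### Domains with smooth boundary -/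

/-- `f` is a smooth defining function of `Ω` on the open neighbourhood `V` of the boundary
point `p`: `Ω ∩ V = {f ≤ 0} ∩ V`, `f p = 0` and `df_p ≠ 0`. -/
structure IsLocalDefiningFunction {n : ℕ} (Ω : Set (Eucl n)) (p : Eucl n) (f : Eucl n → ℝ)
    (V : Set (Eucl n)) : Prop where
  isOpen : IsOpen V
  mem : p ∈ V
  smooth : ContDiffOn ℝ ∞ f V
  zero : f p = 0
  regular : fderiv ℝ f p ≠ 0
  mem_iff : ∀ x ∈ V, x ∈ Ω ↔ f x ≤ 0

/-- `Ω` has smooth boundary. -/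
def HasSmoothBoundary {n : ℕ} (Ω : Set (Eucl n)) : Prop :=
  ∀ p ∈ frontier Ω, ∃ f V, IsLocalDefiningFunction Ω p f V

/-- `v` is the outward-pointing unit normal vector to `∂Ω` at `p` with respect to `g`: it is a unit
vector and a positive multiple of the `g`-gradient of a local defining function. -/
def IsOutwardUnitNormal {n : ℕ} (g : Eucl n → Eucl n →L[ℝ] Eucl n →L[ℝ] ℝ) (Ω : Set (Eucl n))
    (p v : Eucl n) : Prop :=
  g p v v = 1 ∧ ∃ f V, IsLocalDefiningFunction Ω p f V ∧
    ∃ c : ℝ, 0 < c ∧ ∀ ξ, g p v ξ = c * fderiv ℝ f p ξ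

/-- The tangent space `T_p Σ` of the boundary at `p`: the `g`-orthogonal complement of `ν`. -/
def bdryTangent {n : ℕ} (g : Eucl n → Eucl n →L[ℝ] Eucl n →L[ℝ] ℝ) (ν : Eucl n → Eucl n)
    (p : Eucl n) : Submodule ℝ (Eucl n) :=
  LinearMap.ker (g p (ν p)).toLinearMap

/-- The `g`-orthogonal projection of `ξ` to `T_p Σ`. -/
def tangentialPart {n : ℕ} (g : Eucl n → Eucl n →L[ℝ] Eucl n →L[ℝ] ℝ) (ν : Eucl n → Eucl n)
    (p ξ : Eucl n) : Eucl n :=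
  ξ - (g p (ν p) ξ) • ν p

/-- The mean curvature `H` of `Σ = ∂Ω` at `p` with respect to the normal `ν`: the trace over
`T_p Σ` of `ξ ↦ ∇_ξ ν`. Precomposing with the projection to `T_p Σ` turns it into a trace
over `ℝⁿ`. All derivatives along `Σ` are taken in tangential directions only, where the
derivative within `Σ` is unambiguous and is the usual differential of a map on `Σ`. -/
def meanCurvature {n : ℕ} (g : Eucl n → Eucl n →L[ℝ] Eucl n →L[ℝ] ℝ) (Ω : Set (Eucl n))
    (ν : Eucl n → Eucl n) (p : Eucl n) : ℝ :=
  ∑ i : Fin n, (fderivWithin ℝ ν (frontier Ω) p (tangentialPart g ν p (stdVec i))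
    + christoffel g p (tangentialPart g ν p (stdVec i)) (ν p)) i

/-- The trace norm `sup_Q tr(Q L)` of a linear map `L : V → W`, the supremum being taken over all
linear isometries `Q : W → V`; the inner products are given as bilinear forms. -/
def traceNorm {V W : Type*} [AddCommGroup V] [Module ℝ V] [AddCommGroup W] [Module ℝ W]
    (gV : V → V → ℝ) (gW : W → W → ℝ) (L : V →ₗ[ℝ] W) : ℝ :=
  sSup {t : ℝ | ∃ Q : W →ₗ[ℝ] V, (∀ w w', gV (Q w) (Q w') = gW w w') ∧
    t = LinearMap.trace ℝ V (Q ∘ₗ L)}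

/-- The differential `dN : T_p Σ → T_{N(p)} S^{n-1} = N(p)^⊥` of a map `N : Σ → S^{n-1}`. (It takes
values in `N(p)^⊥`, so that the projection only adjusts the codomain.) -/
def sphereDifferential {n : ℕ} (g : Eucl n → Eucl n →L[ℝ] Eucl n →L[ℝ] ℝ) (Ω : Set (Eucl n))
    (ν N : Eucl n → Eucl n) (p : Eucl n) :
    bdryTangent g ν p →ₗ[ℝ] ((ℝ ∙ N p)ᗮ : Submodule ℝ (Eucl n)) :=
  ((ℝ ∙ N p)ᗮ.orthogonalProjectionOnto.toLinearMap ∘ₗ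
    (fderivWithin ℝ N (frontier Ω) p).toLinearMap) ∘ₗ (bdryTangent g ν p).subtype

/-- The trace norm `‖dN‖_tr` at `p`, where `T_p Σ` carries `g` and `T_{N(p)} S^{n-1}` the standard
inner product. -/
def traceNormDifferential {n : ℕ} (g : Eucl n → Eucl n →L[ℝ] Eucl n →L[ℝ] ℝ) (Ω : Set (Eucl n))
    (ν N : Eucl n → Eucl n) (p : Eucl n) : ℝ :=
  traceNorm (fun v v' : bdryTangent g ν p => g p (v : Eucl n) (v' : Eucl n))
    (fun w w' : ((ℝ ∙ N p)ᗮ : Submodule ℝ (Eucl n)) => ⟪(w : Eucl n), (w' : Eucl n)⟫_ℝ)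
    (sphereDifferential g Ω ν N p)

/-! ### Spinors

The oriented orthonormal frame `e` identifies the spinor bundle of `g` with the trivial bundle with
fibre `Δ`, in such a way that `e_k` acts on it by the constant matrix of `E_k`. A spinor is
a `Δ`-valued function in this trivialization. -/

section Spinors

variable {n : ℕ} {Δ : Type*} [NormedAddCommGroup Δ] [InnerProductSpace ℂ Δ]

/-- Clifford multiplication by the tangent vector `ξ` at `p`. -/
def cliffordMul (ρ : SpinRep n Δ) (g : Eucl n → Eucl n →L[ℝ] Eucl n →L[ℝ] ℝ)
    (e : Fin n → Eucl n → Eucl n) (p ξ : Eucl n) : Module.End ℂ Δ :=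
  ∑ k : Fin n, ((g p ξ (e k p) : ℝ) : ℂ) • ρ.gamma k

/-- The connection coefficients `g(∇_ξ e_k, e_l)` of the Levi-Civita connection. -/
def connectionForm (g : Eucl n → Eucl n →L[ℝ] Eucl n →L[ℝ] ℝ) (e : Fin n → Eucl n → Eucl n)
    (p ξ : Eucl n) (k l : Fin n) : ℝ :=
  g p (fderiv ℝ (e k) p ξ + christoffel g p ξ (e k p)) (e l p)

/-- The spin connection `∇_ξ s = ξ(s) + ¼ ∑_{k,l} g(∇_ξ e_k, e_l) e_k · e_l · s` on spinors
over `Ω`. -/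
def spinConnection (ρ : SpinRep n Δ) (g : Eucl n → Eucl n →L[ℝ] Eucl n →L[ℝ] ℝ)
    (e : Fin n → Eucl n → Eucl n) (Ω : Set (Eucl n)) (s : Eucl n → Δ) (p ξ : Eucl n) : Δ :=
  fderivWithin ℝ s Ω p ξ
    + (1 / 4 : ℂ) • ∑ k : Fin n, ∑ l : Fin n,
        ((connectionForm g e p ξ k l : ℝ) : ℂ) •
          cliffordMul ρ g e p (e k p) (cliffordMul ρ g e p (e l p) (s p))

/-- The Dirac operator `𝒟 s = ∑_k e_k · ∇_{e_k} s`. -/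
def dirac (ρ : SpinRep n Δ) (g : Eucl n → Eucl n →L[ℝ] Eucl n →L[ℝ] ℝ)
    (e : Fin n → Eucl n → Eucl n) (Ω : Set (Eucl n)) (s : Eucl n → Δ) (p : Eucl n) : Δ :=
  ∑ k : Fin n, cliffordMul ρ g e p (e k p) (spinConnection ρ g e Ω s p (e k p))

/-- The boundary map `(χ t)_α = -∑_a ∑_β ⟨N, E_a⟩ ω_{aαβ} ν · t_β` at the point `p`. -/
def chi {m : ℕ} (ρ : SpinRep n Δ) (b : OrthonormalBasis (Fin m) ℂ Δ)
    (g : Eucl n → Eucl n →L[ℝ] Eucl n →L[ℝ] ℝ) (e : Fin n → Eucl n → Eucl n)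
    (ν N : Eucl n → Eucl n) (p : Eucl n) (t : Fin m → Δ) : Fin m → Δ := fun α =>
  -∑ a : Fin n, ∑ β : Fin m,
    (((⟪N p, stdVec a⟫_ℝ : ℝ) : ℂ) * omegaCoeff ρ b a α β) • cliffordMul ρ g e p (ν p) (t β)

/-- `s` is a (smooth, up to the boundary) harmonic spinor on `Ω`. -/
def IsHarmonicSpinor (ρ : SpinRep n Δ) (g : Eucl n → Eucl n →L[ℝ] Eucl n →L[ℝ] ℝ)
    (e : Fin n → Eucl n → Eucl n) (Ω : Set (Eucl n)) (s : Eucl n → Δ) : Prop :=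
  ContDiffOn ℝ ∞ s Ω ∧ ∀ p ∈ Ω, dirac ρ g e Ω s p = 0

/-- `s` is a parallel spinor on `Ω`. -/
def IsParallelSpinor (ρ : SpinRep n Δ) (g : Eucl n → Eucl n →L[ℝ] Eucl n →L[ℝ] ℝ)
    (e : Fin n → Eucl n → Eucl n) (Ω : Set (Eucl n)) (s : Eucl n → Δ) : Prop :=
  ∀ p ∈ Ω, ∀ ξ, spinConnection ρ g e Ω s p ξ = 0

end Spinors

end

end SpinBVP

open SpinBVP

/-!
This is an integration of the Lichnerowicz formula, in which the hypothesis on the mean curvature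
controls the boundary term.

An `m`-tuple of spinors is one function with values in the Hermitian space `K = Δᵐ`, seen as a real
inner product space. It carries two commuting Clifford families: `γ_k`, the action of `E_k` on each
entry, and `W_a`, the action of the matrix `(ω_{aαβ})` on the index of the tuple. Only the Clifford
relations and skew-adjointness enter (`IsCliffordFamily`). With `c = ∑ ν_k γ_k` and
`w = ∑ N_a W_a` the boundary condition reads `-w c s = s`; the condition `χ s = -s` is the same one
for the family `-W`.

For a harmonic `s` the vector field `Y = ∑_k ⟨s, ∇_{e_k} s⟩ e_k`, multiplied by the volume density
of `g`, has Euclidean divergence equal to the density times `|∇s|² + ¼ R |s|²`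
(`divergence_bochnerField`). This rests on the structure equation of the connection forms and on
`CliffordRelations.curvature_contraction`: by the first Bianchi identity the Clifford contraction of
the curvature tensor only sees its Ricci contraction. At the boundary, `⟨s, ∇_ν s⟩ ≤ 0`
(`inner_spinDerivWithin_normal_nonpos`): the Dirac equation writes `∇_ν s` as a tangential Dirac
operator, which anticommutes with `χ` up to the derivatives of `ν` and of `N`, so that
`2 ⟨s, ∇_ν s⟩ = -H |s|² - ∑_k ⟨s, W(dN(e_k^T)) γ_k s⟩` (`IsCliffordFamily.boundary_identity`), and
by a singular value decomposition of `dN` the last term is at most `‖dN‖_tr |s|²`.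
Hence `Y` points inward.

In place of the divergence theorem only an inequality is needed: a `C¹` field on `Ω` that points
inward along the boundary has nonpositive integrated divergence
(`integral_divergenceWithin_nonpos`). It is proved with cutoff functions of a local defining
function, without surface measure. So the nonnegative function `|∇s|² + ¼ R |s|²` has nonpositive
integral, and `∇s = 0`.
-/

open scoped ContDiff InnerProductSpace BigOperators
open SpinBVP
-- The instances on triple spaces of continuous linear maps are found only with this depth.
set_option maxSynthPendingDepth 3

namespace SpinBVP

/-! ### Clifford algebra -/

section CliffordRelations

variable {ι 𝒜 : Type*} [DecidableEq ι] [Ring 𝒜] [Algebra ℝ 𝒜]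

/-- The Clifford relations `γ_i γ_j + γ_j γ_i = -2 δ_{ij}` in a real algebra. -/
def CliffordRelations (γ : ι → 𝒜) : Prop :=
  ∀ i j, γ i * γ j + γ j * γ i = if i = j then (-2 : ℝ) • (1 : 𝒜) else 0

theorem CliffordRelations.swap {γ : ι → 𝒜} (h : CliffordRelations γ) (i j : ι) :
    γ i * γ j = -(γ j * γ i) + (if i = j then (-2 : ℝ) else 0) • (1 : 𝒜) := by
  have := h i j
  rw [ite_smul, zero_smul, ← this]; abel

variable [Fintype ι]

/-- The element `¼ ∑_{k,l} θ_{kl} γ_k γ_l` by which a matrix `θ` acts on spinors. -/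
noncomputable def spinElement (γ : ι → 𝒜) (θ : ι → ι → ℝ) : 𝒜 :=
  (1 / 4 : ℝ) • ∑ k, ∑ l, θ k l • (γ k * γ l)

theorem CliffordRelations.mul_sum_smul {γ : ι → 𝒜} (h : CliffordRelations γ) (v w : ι → ℝ) :
    (∑ i, v i • γ i) * (∑ j, w j • γ j) + (∑ j, w j • γ j) * (∑ i, v i • γ i)
      = (-2 * ∑ i, v i * w i) • (1 : 𝒜) := by
  simp only [Finset.sum_mul_sum, smul_mul_smul_comm]
  rw [Finset.sum_comm (f := fun i j => (w i * v j) • (γ i * γ j)), ← Finset.sum_add_distrib]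
  simp only [← Finset.sum_add_distrib]
  have : ∀ i j, (v i * w j) • (γ i * γ j) + (w j * v i) • (γ j * γ i)
      = if i = j then (-2 * (v i * w i)) • (1 : 𝒜) else 0 := by
    intro i j
    rw [mul_comm (w j), ← smul_add, h i j]
    split_ifs with hij
    · subst hij; rw [smul_smul]; congr 1; ring
    · simp
  simp only [this, Finset.sum_ite_eq, Finset.mem_univ, if_true, ← Finset.sum_smul,
    ← Finset.mul_sum]

/-- The commutator of a spin element with a generator: the derivative of the covering
`Spin(n) → SO(n)`. -/
theorem CliffordRelations.spinElement_commutator {γ : ι → 𝒜} (h : CliffordRelations γ)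
    {θ : ι → ι → ℝ} (hθ : ∀ k l, θ k l = -θ l k) (j : ι) :
    spinElement γ θ * γ j - γ j * spinElement γ θ = ∑ l, θ j l • γ l := by
  have key : ∀ k l, γ k * γ l * γ j - γ j * (γ k * γ l)
      = (if k = j then (2 : ℝ) else 0) • γ l - (if l = j then (2 : ℝ) else 0) • γ k := by
    intro k l
    rw [mul_assoc, h.swap l j, ← mul_assoc (γ j), h.swap j k]
    simp only [mul_add, add_mul, mul_neg, neg_mul, mul_smul_comm, smul_mul_assoc, mul_one, one_mul,
      eq_comm (a := j)]
    rw [mul_assoc]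
    split_ifs <;> module
  simp only [spinElement, smul_mul_assoc, mul_smul_comm, Finset.sum_mul, Finset.mul_sum]
  rw [← smul_sub, ← Finset.sum_sub_distrib]
  simp only [← Finset.sum_sub_distrib, ← smul_sub, key]
  simp only [smul_sub, Finset.sum_sub_distrib, ite_smul, zero_smul, smul_ite, smul_zero,
    Finset.sum_ite_eq', Finset.mem_univ, if_true]
  rw [Finset.sum_comm]
  simp only [Finset.sum_ite_eq', Finset.mem_univ, if_true, ← Finset.sum_sub_distrib,
    Finset.smul_sum]
  refine Finset.sum_congr rfl fun l _ => ?_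
  rw [hθ l j]; module

/-- Spin elements bracket like the corresponding antisymmetric matrices. -/
theorem CliffordRelations.spinElement_bracket {γ : ι → 𝒜} (h : CliffordRelations γ)
    {θ η : ι → ι → ℝ} (hθ : ∀ k l, θ k l = -θ l k) :
    spinElement γ θ * spinElement γ η - spinElement γ η * spinElement γ θ
      = spinElement γ (fun k l => ∑ m, (η m l * θ m k + η k m * θ m l)) := by
  have key : ∀ j l, spinElement γ θ * (γ j * γ l) - γ j * γ l * spinElement γ θ
      = ∑ m, θ j m • (γ m * γ l) + ∑ m, θ l m • (γ j * γ m) := by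
    intro j l
    have h1 := h.spinElement_commutator hθ j
    have h2 := h.spinElement_commutator hθ l
    have : spinElement γ θ * (γ j * γ l) - γ j * γ l * spinElement γ θ
      = (spinElement γ θ * γ j - γ j * spinElement γ θ) * γ l
        + γ j * (spinElement γ θ * γ l - γ l * spinElement γ θ) := by noncomm_ring
    rw [this, h1, h2]
    simp only [Finset.sum_mul, Finset.mul_sum, smul_mul_assoc, mul_smul_comm]
  have : spinElement γ θ * spinElement γ η - spinElement γ η * spinElement γ θ
      = (1 / 4 : ℝ) • ∑ j, ∑ l, η j l •
        (spinElement γ θ * (γ j * γ l) - γ j * γ l * spinElement γ θ) := by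
    conv_lhs => rw [spinElement.eq_def γ η]
    simp only [smul_mul_assoc, mul_smul_comm, Finset.sum_mul, Finset.mul_sum, smul_sub,
      Finset.sum_sub_distrib]
  rw [this]
  simp only [key]
  rw [spinElement]
  congr 1
  simp only [ smul_add, Finset.sum_add_distrib, Finset.smul_sum, Finset.sum_smul, add_smul,
    smul_smul]
  congr 1
  · calc ∑ x, ∑ x_1, ∑ x_2, (η x x_1 * θ x x_2) • (γ x_2 * γ x_1)
        = ∑ x, ∑ x_2, ∑ x_1, (η x x_1 * θ x x_2) • (γ x_2 * γ x_1) :=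
          Finset.sum_congr rfl fun _ _ => Finset.sum_comm
      _ = ∑ x_2, ∑ x, ∑ x_1, (η x x_1 * θ x x_2) • (γ x_2 * γ x_1) := Finset.sum_comm
      _ = _ := Finset.sum_congr rfl fun _ _ => Finset.sum_comm
  · exact Finset.sum_congr rfl fun _ _ => Finset.sum_comm

/-- The Clifford contraction of a curvature tensor only sees its Ricci contraction: by the Bianchi
identity, the totally antisymmetric part of `γ_i γ_j γ_k` does not contribute. -/
theorem CliffordRelations.curvature_contraction {γ : ι → 𝒜} (h : CliffordRelations γ)
    {R : ι → ι → ι → ι → ℝ} (hanti : ∀ i j k l, R i j k l = -R j i k l)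
    (hbianchi : ∀ i j k l, R i j k l + R j k i l + R k i j l = 0) :
    ∑ i, ∑ j, ∑ k, ∑ l, R i j k l • (γ i * γ j * γ k * γ l)
      = (-2 : ℝ) • ∑ i, ∑ l, (∑ j, R i j j l) • (γ i * γ l) := by
  set δ : ι → ι → ℝ := fun i j => if i = j then 1 else 0 with hδ
  have hsw : ∀ i j, γ i * γ j = -(γ j * γ i) + (-2 * δ i j) • (1 : 𝒜) := by
    intro i j
    rw [h.swap i j, hδ]; simp
  have hδs : ∀ i j, δ i j = δ j i := fun i j => by simp [hδ, eq_comm]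
  -- The two cyclic permutations of a product of three generators.
  have c1 : ∀ i j k, γ j * γ k * γ i
      = γ i * γ j * γ k + (2 * δ i j) • γ k - (2 * δ i k) • γ j := by
    intro i j k
    rw [mul_assoc, hsw k i, mul_add, mul_neg, ← mul_assoc, hsw j i, hδs j i, hδs k i]
    simp only [add_mul, neg_mul, smul_mul_assoc, mul_smul_comm, mul_one, one_mul]
    module
  have c2 : ∀ i j k, γ k * γ i * γ j
      = γ i * γ j * γ k + (2 * δ j k) • γ i - (2 * δ i k) • γ j := by
    intro i j k
    rw [hsw k i, add_mul, neg_mul, mul_assoc, hsw k j, hδs k j, hδs k i]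
    simp only [mul_add, mul_neg, smul_mul_assoc, mul_smul_comm, mul_one, one_mul, ← mul_assoc]
    module
  have rot : ∀ f : ι → ι → ι → 𝒜, ∑ i, ∑ j, ∑ k, f i j k = ∑ i, ∑ j, ∑ k, f j k i := by
    intro f
    calc ∑ i, ∑ j, ∑ k, f i j k = ∑ i, ∑ k, ∑ j, f i j k :=
          Finset.sum_congr rfl fun _ _ => Finset.sum_comm
      _ = ∑ k, ∑ i, ∑ j, f i j k := Finset.sum_comm
  have T : ∀ l, ∑ i, ∑ j, ∑ k, R i j k l • (γ i * γ j * γ k)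
      = (-2 : ℝ) • ∑ i, (∑ j, R i j j l) • γ i := by
    intro l
    set T := ∑ i, ∑ j, ∑ k, R i j k l • (γ i * γ j * γ k) with hT
    have e1 : ∑ i, ∑ j, ∑ k, R i j k l • (γ j * γ k * γ i)
        = ∑ i, ∑ j, ∑ k, R k i j l • (γ i * γ j * γ k) := by
      rw [rot fun i j k => R k i j l • (γ i * γ j * γ k)]
    have e2 : ∑ i, ∑ j, ∑ k, R i j k l • (γ k * γ i * γ j)
        = ∑ i, ∑ j, ∑ k, R j k i l • (γ i * γ j * γ k) := by
      rw [rot fun i j k => R i j k l • (γ k * γ i * γ j)]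
    have zero : T + ∑ i, ∑ j, ∑ k, R i j k l • (γ k * γ i * γ j)
        + ∑ i, ∑ j, ∑ k, R i j k l • (γ j * γ k * γ i) = 0 := by
      rw [e1, e2, hT]
      simp only [← Finset.sum_add_distrib, ← add_smul, hbianchi, zero_smul, Finset.sum_const_zero]
    have s1 : ∑ i, ∑ j, ∑ k, R i j k l • ((2 * δ j k) • γ i)
        = (2 : ℝ) • ∑ i, (∑ j, R i j j l) • γ i := by
      simp [hδ, smul_smul, Finset.smul_sum, Finset.sum_smul, mul_comm]
    have s2 : ∑ i, ∑ j, ∑ k, R i j k l • ((2 * δ i k) • γ j)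
        = (-2 : ℝ) • ∑ i, (∑ j, R i j j l) • γ i := by
      rw [Finset.sum_comm]
      simp only [hδ, smul_smul, Finset.smul_sum, Finset.sum_smul, mul_ite, mul_one, mul_zero,
        ite_smul, zero_smul, smul_ite, smul_zero, Finset.sum_ite_eq, Finset.mem_univ, if_true]
      refine Finset.sum_congr rfl fun i _ => Finset.sum_congr rfl fun j _ => ?_
      rw [hanti j i j l]; congr 1; ring
    have s3 : ∑ i, ∑ j, ∑ k, R i j k l • ((2 * δ i j) • γ k) = 0 := by
      have : ∀ i k, R i i k l = 0 := fun i k => by linarith [hanti i i k l]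
      refine Finset.sum_eq_zero fun i _ => Finset.sum_eq_zero fun j _ =>
        Finset.sum_eq_zero fun k _ => ?_
      by_cases hij : i = j
      · subst hij; rw [this, zero_smul]
      · simp [hδ, hij]
    have t1 : ∑ i, ∑ j, ∑ k, R i j k l • (γ j * γ k * γ i)
        = ∑ i, ∑ j, ∑ k, R i j k l • (γ i * γ j * γ k + (2 * δ i j) • γ k - (2 * δ i k) • γ j) :=
      Finset.sum_congr rfl fun i _ => Finset.sum_congr rfl fun j _ =>
        Finset.sum_congr rfl fun k _ => by rw [c1 i j k]
    have t2 : ∑ i, ∑ j, ∑ k, R i j k l • (γ k * γ i * γ j)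
        = ∑ i, ∑ j, ∑ k, R i j k l • (γ i * γ j * γ k + (2 * δ j k) • γ i - (2 * δ i k) • γ j) :=
      Finset.sum_congr rfl fun i _ => Finset.sum_congr rfl fun j _ =>
        Finset.sum_congr rfl fun k _ => by rw [c2 i j k]
    simp only [t1, t2, smul_add, smul_sub, Finset.sum_add_distrib, Finset.sum_sub_distrib, s1, s2,
      s3] at zero
    rw [← hT] at zero
    have h3 : (3 : ℝ) • T = (3 : ℝ) • ((-2 : ℝ) • ∑ i, (∑ j, R i j j l) • γ i) := by
      rw [← sub_eq_zero, ← zero]; module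
    exact smul_right_injective 𝒜 (by norm_num : (3 : ℝ) ≠ 0) h3
  have : ∑ i, ∑ j, ∑ k, ∑ l, R i j k l • (γ i * γ j * γ k * γ l)
      = ∑ l, (∑ i, ∑ j, ∑ k, R i j k l • (γ i * γ j * γ k)) * γ l := by
    simp only [Finset.sum_mul, smul_mul_assoc]
    calc _ = ∑ i, ∑ j, ∑ l, ∑ k, R i j k l • (γ i * γ j * γ k * γ l) :=
          Finset.sum_congr rfl fun _ _ => Finset.sum_congr rfl fun _ _ => Finset.sum_comm
      _ = ∑ i, ∑ l, ∑ j, ∑ k, R i j k l • (γ i * γ j * γ k * γ l) :=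
          Finset.sum_congr rfl fun _ _ => Finset.sum_comm
      _ = _ := Finset.sum_comm
  rw [this]
  simp only [T, smul_mul_assoc, Finset.sum_mul]
  rw [← Finset.smul_sum, Finset.sum_comm]

end CliffordRelations

section CliffordModule

variable {ι K : Type*} [DecidableEq ι] [NormedAddCommGroup K] [InnerProductSpace ℝ K]

/-- A family of skew-adjoint operators satisfying the Clifford relations, i.e. a real module over
the Clifford algebra in which the generators act orthogonally. -/
structure IsCliffordFamily (γ : ι → K →L[ℝ] K) : Prop where
  relations : CliffordRelations γ
  skew : ∀ i x y, ⟪γ i x, y⟫_ℝ = -⟪x, γ i y⟫_ℝ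

theorem IsCliffordFamily.inner_mul_self {γ : ι → K →L[ℝ] K} (h : IsCliffordFamily γ) (i j : ι)
    (x : K) : ⟪x, (γ i * γ j) x⟫_ℝ = if i = j then -‖x‖ ^ 2 else 0 := by
  have h1 := congrArg (fun T : K →L[ℝ] K => ⟪x, T x⟫_ℝ) (h.relations i j)
  have h2 : ⟪x, (γ i * γ j) x⟫_ℝ = ⟪x, (γ j * γ i) x⟫_ℝ := by
    simp only [mul_apply_eq_comp]
    rw [← neg_eq_iff_eq_neg.mpr (h.skew i x (γ j x)), ← neg_eq_iff_eq_neg.mpr (h.skew j x (γ i x)),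
      real_inner_comm]
  simp only [_root_.add_apply, inner_add_right] at h1
  rw [← h2] at h1
  simp only [mul_apply_eq_comp] at h1 ⊢
  split_ifs at h1 ⊢ with hij
  · simp only [_root_.smul_apply, one_apply_eq_self, inner_smul_right,
      real_inner_self_eq_norm_sq] at h1
    linarith
  · simp only [_root_.zero_apply, inner_zero_right] at h1
    linarith

variable [Fintype ι]

theorem IsCliffordFamily.skew_sum {γ : ι → K →L[ℝ] K} (h : IsCliffordFamily γ) (v : ι → ℝ)
    (x y : K) : ⟪(∑ i, v i • γ i) x, y⟫_ℝ = -⟪x, (∑ i, v i • γ i) y⟫_ℝ := by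
  simp only [_root_.sum_apply, _root_.smul_apply, sum_inner, inner_sum,
    inner_smul_left, inner_smul_right, h.skew, ← Finset.sum_neg_distrib]
  simp

theorem IsCliffordFamily.sq_sum {γ : ι → K →L[ℝ] K} (h : IsCliffordFamily γ) (v : ι → ℝ)
    (x : K) : (∑ i, v i • γ i) ((∑ i, v i • γ i) x) = -(∑ i, v i ^ 2) • x := by
  have h1 := congrArg (fun T : K →L[ℝ] K => T x) (h.relations.mul_sum_smul v v)
  simp only [_root_.add_apply, mul_apply_eq_comp,
    _root_.smul_apply, one_apply_eq_self] at h1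
  rw [← two_smul ℝ] at h1
  have h2 : (2 : ℝ) • ((∑ i, v i • γ i) ((∑ i, v i • γ i) x)) = (2 : ℝ) • (-(∑ i, v i ^ 2) • x) := by
    rw [h1, smul_smul]; congr 1; simp only [pow_two]; ring
  exact smul_right_injective K (by norm_num : (2 : ℝ) ≠ 0) h2

theorem IsCliffordFamily.norm_sum_apply {γ : ι → K →L[ℝ] K} (h : IsCliffordFamily γ) (v : ι → ℝ)
    (x : K) : ‖(∑ i, v i • γ i) x‖ ^ 2 = (∑ i, v i ^ 2) * ‖x‖ ^ 2 := by
  rw [← real_inner_self_eq_norm_sq, h.skew_sum, h.sq_sum, inner_smul_right,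
    real_inner_self_eq_norm_sq]
  ring

theorem IsCliffordFamily.inner_ricci {γ : ι → K →L[ℝ] K} (h : IsCliffordFamily γ)
    (r : ι → ι → ℝ) (x : K) :
    ⟪x, (∑ i, ∑ l, r i l • (γ i * γ l)) x⟫_ℝ = -(∑ i, r i i) * ‖x‖ ^ 2 := by
  simp only [_root_.sum_apply, _root_.smul_apply, inner_sum,
    inner_smul_right, h.inner_mul_self]
  simp [Finset.sum_mul]

/-- Spin elements of antisymmetric matrices act by skew-adjoint operators. -/
theorem IsCliffordFamily.spinElement_skew {γ : ι → K →L[ℝ] K} (h : IsCliffordFamily γ)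
    {θ : ι → ι → ℝ} (hθ : ∀ k l, θ k l = -θ l k) (x y : K) :
    ⟪spinElement γ θ x, y⟫_ℝ = -⟪x, spinElement γ θ y⟫_ℝ := by
  simp only [spinElement, _root_.sum_apply, _root_.smul_apply, sum_inner,
    inner_sum, inner_smul_left, inner_smul_right, mul_apply_eq_comp, h.skew, neg_neg]
  simp only [conj_trivial]
  rw [Finset.sum_comm, ← mul_neg, ← Finset.sum_neg_distrib]
  congr 1
  refine Finset.sum_congr rfl fun k _ => ?_
  rw [← Finset.sum_neg_distrib]
  refine Finset.sum_congr rfl fun l _ => ?_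
  rw [hθ k l]; ring

end CliffordModule

/-! ### The Levi-Civita connection in an orthonormal frame -/

section Frame

variable {n : ℕ} {g : Eucl n → Eucl n →L[ℝ] Eucl n →L[ℝ] ℝ} {e : Fin n → Eucl n → Eucl n}
  {U : Set (Eucl n)} {p : Eucl n}

theorem IsOrientedOrthonormalFrameOn.linearIndependent (he : IsOrientedOrthonormalFrameOn g e U)
    (hp : p ∈ U) : LinearIndependent ℝ fun k => e k p := by
  rw [Fintype.linearIndependent_iff]
  intro c hc l
  have := congrArg (fun v => g p v (e l p)) hc
  simpa [he.orthonormal p hp] using this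

/-- The frame at a point, as a basis. -/
noncomputable def IsOrientedOrthonormalFrameOn.basis (he : IsOrientedOrthonormalFrameOn g e U)
    (hp : p ∈ U) : Module.Basis (Fin n) ℝ (Eucl n) :=
  Module.Basis.mk (he.linearIndependent hp)
    (((he.linearIndependent hp).span_eq_top_of_card_eq_finrank' (by simp)).ge)

theorem IsOrientedOrthonormalFrameOn.basis_apply (he : IsOrientedOrthonormalFrameOn g e U)
    (hp : p ∈ U) (k : Fin n) : he.basis hp k = e k p := by
  simp [IsOrientedOrthonormalFrameOn.basis]

theorem IsOrientedOrthonormalFrameOn.basis_repr (he : IsOrientedOrthonormalFrameOn g e U)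
    (hp : p ∈ U) (ξ : Eucl n) (k : Fin n) : (he.basis hp).repr ξ k = g p ξ (e k p) := by
  conv_rhs => rw [← (he.basis hp).sum_repr ξ]
  simp [he.basis_apply, he.orthonormal p hp]

theorem IsOrientedOrthonormalFrameOn.expansion (he : IsOrientedOrthonormalFrameOn g e U)
    (hp : p ∈ U) (ξ : Eucl n) : ∑ k, g p ξ (e k p) • e k p = ξ := by
  conv_rhs => rw [← (he.basis hp).sum_repr ξ]
  simp [he.basis_apply, he.basis_repr]

theorem IsOrientedOrthonormalFrameOn.metric_eq (he : IsOrientedOrthonormalFrameOn g e U)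
    (hp : p ∈ U) (ξ η : Eucl n) : g p ξ η = ∑ k, g p ξ (e k p) * g p η (e k p) := by
  conv_lhs => rw [← he.expansion hp η]
  simp [mul_comm]

/-- Two vectors with the same inner products against the frame agree. -/
theorem IsOrientedOrthonormalFrameOn.ext (he : IsOrientedOrthonormalFrameOn g e U)
    (hp : p ∈ U) {ξ η : Eucl n} (h : ∀ k, g p ξ (e k p) = g p η (e k p)) : ξ = η := by
  rw [← he.expansion hp ξ, ← he.expansion hp η]
  simp [h]

theorem metric_inverse_apply (hg : IsRiemannianMetricOn g U)
    (he : IsOrientedOrthonormalFrameOn g e U) (hp : p ∈ U) (φ : Eucl n →L[ℝ] ℝ) :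
    (g p).inverse φ = ∑ k, φ (e k p) • e k p := by
  set A : (Eucl n →L[ℝ] ℝ) →L[ℝ] Eucl n := LinearMap.toContinuousLinearMap
    { toFun := fun φ => ∑ k, φ (e k p) • e k p
      map_add' := fun φ ψ => by simp [add_smul, Finset.sum_add_distrib]
      map_smul' := fun c φ => by simp [Finset.smul_sum, smul_smul] } with hA
  have hA' : ∀ φ, A φ = ∑ k, φ (e k p) • e k p := fun φ => rfl
  have h1 : Function.LeftInverse A (g p) := fun ξ => by rw [hA', he.expansion hp]
  have h2 : Function.RightInverse A (g p) := fun φ => by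
    ext ξ
    rw [hA', hg.symm p hp, map_sum]
    conv_rhs => rw [← he.expansion hp ξ]
    simp [mul_comm]
  have : g p = (ContinuousLinearEquiv.equivOfInverse (g p) A h1 h2 : Eucl n →L[ℝ] _) := rfl
  rw [this, ContinuousLinearMap.inverse_equiv]
  exact hA' φ

theorem christoffel_eq_sum (hg : IsRiemannianMetricOn g U)
    (he : IsOrientedOrthonormalFrameOn g e U) (hp : p ∈ U) (X Y : Eucl n) :
    christoffel g p X Y = ∑ k, koszul g p X Y (e k p) • e k p :=
  metric_inverse_apply hg he hp _

theorem koszul_apply (p X Y Z : Eucl n) :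
    koszul g p X Y Z = 1 / 2 * (fderiv ℝ g p X Y Z + fderiv ℝ g p Y X Z - fderiv ℝ g p Z X Y) := by
  simp [koszul]

theorem metric_christoffel (hg : IsRiemannianMetricOn g U)
    (he : IsOrientedOrthonormalFrameOn g e U) (hp : p ∈ U) (X Y Z : Eucl n) :
    g p (christoffel g p X Y) Z = koszul g p X Y Z := by
  rw [christoffel_eq_sum hg he hp, hg.symm p hp, map_sum]
  conv_rhs => rw [← he.expansion hp Z]
  simp [mul_comm]

theorem IsRiemannianMetricOn.contDiffAt (hg : IsRiemannianMetricOn g U) (hU : IsOpen U)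
    (hp : p ∈ U) : ContDiffAt ℝ ∞ g p :=
  hg.smooth.contDiffAt (hU.mem_nhds hp)

theorem IsRiemannianMetricOn.differentiableAt (hg : IsRiemannianMetricOn g U) (hU : IsOpen U)
    (hp : p ∈ U) : DifferentiableAt ℝ g p :=
  (hg.contDiffAt hU hp).differentiableAt (by simp)

theorem IsOrientedOrthonormalFrameOn.contDiffAt (he : IsOrientedOrthonormalFrameOn g e U)
    (hU : IsOpen U) (hp : p ∈ U) (k : Fin n) : ContDiffAt ℝ ∞ (e k) p :=
  (he.smooth k).contDiffAt (hU.mem_nhds hp)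

theorem IsOrientedOrthonormalFrameOn.differentiableAt (he : IsOrientedOrthonormalFrameOn g e U)
    (hU : IsOpen U) (hp : p ∈ U) (k : Fin n) : DifferentiableAt ℝ (e k) p :=
  (he.contDiffAt hU hp k).differentiableAt (by simp)

theorem fderiv_metric_apply {Y Z : Eucl n → Eucl n} (hg : DifferentiableAt ℝ g p)
    (hY : DifferentiableAt ℝ Y p) (hZ : DifferentiableAt ℝ Z p) (ξ : Eucl n) :
    fderiv ℝ (fun q => g q (Y q) (Z q)) p ξ
      = fderiv ℝ g p ξ (Y p) (Z p) + g p (fderiv ℝ Y p ξ) (Z p) + g p (Y p) (fderiv ℝ Z p ξ) := by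
  have h := ((hg.hasFDerivAt.clm_apply hY.hasFDerivAt).clm_apply hZ.hasFDerivAt).fderiv
  rw [h]
  simp
  ring

theorem fderiv_metric_symm (hg : IsRiemannianMetricOn g U) (hU : IsOpen U) (hp : p ∈ U)
    (ξ Y Z : Eucl n) : fderiv ℝ g p ξ Y Z = fderiv ℝ g p ξ Z Y := by
  have hd := hg.differentiableAt hU hp
  have h1 := fderiv_metric_apply hd (differentiableAt_const Y) (differentiableAt_const Z) ξ
  have h2 := fderiv_metric_apply hd (differentiableAt_const Z) (differentiableAt_const Y) ξ
  have h3 : (fun q => g q Y Z) =ᶠ[nhds p] fun q => g q Z Y := by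
    filter_upwards [hU.mem_nhds hp] with q hq using hg.symm q hq Y Z
  simp only [fderiv_const_apply, _root_.zero_apply, map_zero, add_zero] at h1 h2
  rw [← h1, ← h2, h3.fderiv_eq]

theorem christoffel_symm (hg : IsRiemannianMetricOn g U) (hU : IsOpen U) (hp : p ∈ U)
    (X Y : Eucl n) : christoffel g p X Y = christoffel g p Y X := by
  have : koszul g p X Y = koszul g p Y X := by
    ext Z
    rw [koszul_apply, koszul_apply, fderiv_metric_symm hg hU hp Z X Y]; ring
  rw [christoffel, christoffel, this]

/-- The Christoffel map as a linear map in its second argument. -/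
noncomputable def christoffelCLM (g : Eucl n → Eucl n →L[ℝ] Eucl n →L[ℝ] ℝ) (p X : Eucl n) :
    Eucl n →L[ℝ] Eucl n :=
  LinearMap.toContinuousLinearMap
    { toFun := fun Y => christoffel g p X Y
      map_add' := fun Y Z => by
        simp only [christoffel]
        rw [← map_add]; congr 1; ext W; simp [koszul]; ring
      map_smul' := fun c Y => by
        simp only [christoffel, RingHom.id_apply]
        rw [← map_smul]; congr 1; ext W; simp [koszul]; ring }

theorem christoffelCLM_apply (p X Y : Eucl n) : christoffelCLM g p X Y = christoffel g p X Y := rfl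

theorem christoffel_add_left (hg : IsRiemannianMetricOn g U) (hU : IsOpen U) (hp : p ∈ U)
    (X X' Y : Eucl n) :
    christoffel g p (X + X') Y = christoffel g p X Y + christoffel g p X' Y := by
  simp only [christoffel_symm hg hU hp _ Y, ← christoffelCLM_apply, map_add]

theorem christoffel_smul_left (hg : IsRiemannianMetricOn g U) (hU : IsOpen U) (hp : p ∈ U)
    (c : ℝ) (X Y : Eucl n) : christoffel g p (c • X) Y = c • christoffel g p X Y := by
  simp only [christoffel_symm hg hU hp _ Y, ← christoffelCLM_apply, map_smul]

theorem contDiffAt_christoffel (hg : IsRiemannianMetricOn g U) (hU : IsOpen U)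
    (he : IsOrientedOrthonormalFrameOn g e U) (hp : p ∈ U) (X Y : Eucl n) :
    ContDiffAt ℝ ∞ (fun q => christoffel g q X Y) p := by
  have h : (fun q => christoffel g q X Y)
      =ᶠ[nhds p] fun q => ∑ k, koszul g q X Y (e k q) • e k q := by
    filter_upwards [hU.mem_nhds hp] with q hq using christoffel_eq_sum hg he hq X Y
  refine ContDiffAt.congr_of_eventuallyEq ?_ h
  have hdg : ContDiffAt ℝ ∞ (fderiv ℝ g) p := (hg.contDiffAt hU hp).fderiv_right (by simp)
  refine ContDiffAt.sum fun k _ => ?_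
  have hek := he.contDiffAt hU hp k
  refine ContDiffAt.fun_smul ?_ hek
  simp only [koszul_apply]
  fun_prop

theorem contDiffAt_christoffelCLM (hg : IsRiemannianMetricOn g U) (hU : IsOpen U)
    (he : IsOrientedOrthonormalFrameOn g e U) (hp : p ∈ U) (X : Eucl n) :
    ContDiffAt ℝ ∞ (fun q => christoffelCLM g q X) p := by
  have : ContDiffOn ℝ ∞ (fun q => christoffelCLM g q X) U :=
    contDiffOn_clm_apply.mpr fun Y q hq =>
      (contDiffAt_christoffel hg hU he hq X Y).contDiffWithinAt
  exact this.contDiffAt (hU.mem_nhds hp)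

/-- The Levi-Civita derivative `∇_ξ Y` of a vector field. -/
noncomputable def covDeriv (g : Eucl n → Eucl n →L[ℝ] Eucl n →L[ℝ] ℝ) (Y : Eucl n → Eucl n)
    (p ξ : Eucl n) : Eucl n :=
  fderiv ℝ Y p ξ + christoffel g p ξ (Y p)

theorem covDeriv_add_right (hg : IsRiemannianMetricOn g U) (hU : IsOpen U) (hp : p ∈ U)
    (Y : Eucl n → Eucl n) (ξ η : Eucl n) :
    covDeriv g Y p (ξ + η) = covDeriv g Y p ξ + covDeriv g Y p η := by
  simp only [covDeriv, map_add, christoffel_add_left hg hU hp]; abel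

theorem covDeriv_smul_right (hg : IsRiemannianMetricOn g U) (hU : IsOpen U) (hp : p ∈ U)
    (Y : Eucl n → Eucl n) (c : ℝ) (ξ : Eucl n) :
    covDeriv g Y p (c • ξ) = c • covDeriv g Y p ξ := by
  simp only [covDeriv, map_smul, christoffel_smul_left hg hU hp, smul_add]

theorem ContDiffAt.covDeriv {Y : Eucl n → Eucl n} (hg : IsRiemannianMetricOn g U) (hU : IsOpen U)
    (he : IsOrientedOrthonormalFrameOn g e U) (hp : p ∈ U) (hY : ContDiffAt ℝ ∞ Y p)
    (ξ : Eucl n) : ContDiffAt ℝ ∞ (fun q => covDeriv g Y q ξ) p := by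
  have h1 : ContDiffAt ℝ ∞ (fderiv ℝ Y) p := hY.fderiv_right (by simp)
  have h2 := contDiffAt_christoffelCLM hg hU he hp ξ
  have : (fun q => SpinBVP.covDeriv g Y q ξ)
      = fun q => fderiv ℝ Y q ξ + christoffelCLM g q ξ (Y q) := rfl
  rw [this]
  fun_prop

/-- The Levi-Civita connection is compatible with the metric. -/
theorem fderiv_metric_covDeriv {Y Z : Eucl n → Eucl n} (hg : IsRiemannianMetricOn g U)
    (hU : IsOpen U) (he : IsOrientedOrthonormalFrameOn g e U) (hp : p ∈ U)
    (hY : DifferentiableAt ℝ Y p) (hZ : DifferentiableAt ℝ Z p) (ξ : Eucl n) :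
    fderiv ℝ (fun q => g q (Y q) (Z q)) p ξ
      = g p (covDeriv g Y p ξ) (Z p) + g p (Y p) (covDeriv g Z p ξ) := by
  rw [fderiv_metric_apply (hg.differentiableAt hU hp) hY hZ]
  simp only [covDeriv, map_add, _root_.add_apply, metric_christoffel hg he hp]
  rw [hg.symm p hp (Y p) (christoffel g p ξ (Z p)), metric_christoffel hg he hp, koszul_apply,
    koszul_apply, fderiv_metric_symm hg hU hp ξ (Z p) (Y p),
    fderiv_metric_symm hg hU hp (Z p) ξ (Y p), fderiv_metric_symm hg hU hp (Y p) ξ (Z p)]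
  ring

/-- The commutator of covariant derivatives in coordinate directions is the Riemann tensor. -/
theorem covDeriv_commutator {Y : Eucl n → Eucl n} (hg : IsRiemannianMetricOn g U)
    (hU : IsOpen U) (he : IsOrientedOrthonormalFrameOn g e U) (hp : p ∈ U)
    (hY : ContDiffAt ℝ ∞ Y p) (ξ η : Eucl n) :
    covDeriv g (fun q => covDeriv g Y q η) p ξ - covDeriv g (fun q => covDeriv g Y q ξ) p η
      = riemann g p ξ η (Y p) := by
  have hdY : DifferentiableAt ℝ (fderiv ℝ Y) p :=
    (hY.fderiv_right (m := ∞) (by simp)).differentiableAt (by simp)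
  have key : ∀ ζ τ, fderiv ℝ (fun q => covDeriv g Y q τ) p ζ
      = fderiv ℝ (fderiv ℝ Y) p ζ τ + (fderiv ℝ (fun q => christoffel g q τ (Y p)) p ζ
        + christoffel g p τ (fderiv ℝ Y p ζ)) := by
    intro ζ τ
    have hC : DifferentiableAt ℝ (fun q => christoffelCLM g q τ) p :=
      (contDiffAt_christoffelCLM hg hU he hp τ).differentiableAt (by simp)
    have hYd : DifferentiableAt ℝ Y p := hY.differentiableAt (by simp)
    have e1 := (hdY.hasFDerivAt.clm_apply (hasFDerivAt_const τ p)).add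
      (hC.hasFDerivAt.clm_apply hYd.hasFDerivAt)
    have e2 := (hC.hasFDerivAt.clm_apply (hasFDerivAt_const (Y p) p)).fderiv
    have e1' : fderiv ℝ (fun q => covDeriv g Y q τ) p = _ := e1.fderiv
    have e2' : fderiv ℝ (fun q => christoffel g q τ (Y p)) p = _ := e2
    rw [e1', e2']
    simp [christoffelCLM_apply]
    abel
  have hsymm : IsSymmSndFDerivAt ℝ Y p :=
    hY.isSymmSndFDerivAt (by
      rw [minSmoothness_of_isRCLikeNormedField]; exact WithTop.coe_le_coe.mpr (le_top (a := (2 : ℕ∞))))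
  have key' : ∀ ζ τ, covDeriv g (fun q => covDeriv g Y q τ) p ζ
      = fderiv ℝ (fun q => covDeriv g Y q τ) p ζ + christoffel g p ζ (covDeriv g Y p τ) :=
    fun _ _ => rfl
  rw [key', key', key, key, hsymm.eq ξ η, covDeriv, covDeriv, riemann]
  simp only [← christoffelCLM_apply, map_add]
  abel

end Frame

/-! ### Connection forms, curvature and volume density of the frame -/

section FrameCurvature

variable {n : ℕ} {g : Eucl n → Eucl n →L[ℝ] Eucl n →L[ℝ] ℝ} {e : Fin n → Eucl n → Eucl n}
  {U : Set (Eucl n)} {p : Eucl n}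

theorem sum_smul_stdVec (v : Eucl n) : ∑ i, v i • stdVec i = v := by
  have := (EuclideanSpace.basisFun (Fin n) ℝ).sum_repr v
  simpa [stdVec] using this

/-- The trace of an endomorphism of `ℝⁿ`, computed in an orthonormal frame. -/
theorem IsOrientedOrthonormalFrameOn.sum_apply_stdVec (he : IsOrientedOrthonormalFrameOn g e U)
    (hp : p ∈ U) (T : Eucl n →ₗ[ℝ] Eucl n) :
    ∑ i, T (stdVec i) i = ∑ k, g p (T (e k p)) (e k p) := by
  calc ∑ i, T (stdVec i) i = ∑ i, ∑ k, g p (stdVec i) (e k p) * T (e k p) i := by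
        refine Finset.sum_congr rfl fun i _ => ?_
        conv_lhs => rw [← he.expansion hp (stdVec i)]
        simp
    _ = ∑ k, g p (∑ i, T (e k p) i • stdVec i) (e k p) := by
        rw [Finset.sum_comm]
        refine Finset.sum_congr rfl fun k _ => ?_
        simp [mul_comm]
    _ = _ := by simp only [sum_smul_stdVec]

theorem connectionForm_eq (p ξ : Eucl n) (k l : Fin n) :
    connectionForm g e p ξ k l = g p (covDeriv g (e k) p ξ) (e l p) := rfl

theorem covDeriv_frame (he : IsOrientedOrthonormalFrameOn g e U) (hp : p ∈ U) (ξ : Eucl n)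
    (k : Fin n) : covDeriv g (e k) p ξ = ∑ l, connectionForm g e p ξ k l • e l p :=
  (he.expansion hp _).symm

theorem connectionForm_antisymm (hg : IsRiemannianMetricOn g U) (hU : IsOpen U)
    (he : IsOrientedOrthonormalFrameOn g e U) (hp : p ∈ U) (ξ : Eucl n) (k l : Fin n) :
    connectionForm g e p ξ k l = -connectionForm g e p ξ l k := by
  have h := fderiv_metric_covDeriv hg hU he hp (he.differentiableAt hU hp k)
    (he.differentiableAt hU hp l) ξ
  have h0 : (fun q => g q (e k q) (e l q)) =ᶠ[nhds p] fun _ => if k = l then (1 : ℝ) else 0 := by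
    filter_upwards [hU.mem_nhds hp] with q hq using he.orthonormal q hq k l
  rw [h0.fderiv_eq, fderiv_const_apply, hg.symm p hp (e k p)] at h
  simp only [connectionForm_eq]
  simp only [_root_.zero_apply] at h
  linarith

theorem connectionForm_add (hg : IsRiemannianMetricOn g U) (hU : IsOpen U) (hp : p ∈ U)
    (ξ η : Eucl n) (k l : Fin n) : connectionForm g e p (ξ + η) k l
      = connectionForm g e p ξ k l + connectionForm g e p η k l := by
  simp [connectionForm_eq, covDeriv_add_right hg hU hp]

theorem connectionForm_smul (hg : IsRiemannianMetricOn g U) (hU : IsOpen U) (hp : p ∈ U)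
    (c : ℝ) (ξ : Eucl n) (k l : Fin n) : connectionForm g e p (c • ξ) k l
      = c * connectionForm g e p ξ k l := by
  simp [connectionForm_eq, covDeriv_smul_right hg hU hp]

theorem contDiffAt_connectionForm (hg : IsRiemannianMetricOn g U) (hU : IsOpen U)
    (he : IsOrientedOrthonormalFrameOn g e U) (hp : p ∈ U) (ξ : Eucl n) (k l : Fin n) :
    ContDiffAt ℝ ∞ (fun q => connectionForm g e q ξ k l) p := by
  have h1 := hg.contDiffAt hU hp
  have h2 := ContDiffAt.covDeriv hg hU he hp (he.contDiffAt hU hp k) ξ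
  have h3 := he.contDiffAt hU hp l
  simp only [connectionForm_eq]
  exact (h1.clm_apply h2).clm_apply h3

/-- The Levi-Civita connection is torsion-free. -/
theorem frame_bracket (hg : IsRiemannianMetricOn g U) (hU : IsOpen U)
    (he : IsOrientedOrthonormalFrameOn g e U) (hp : p ∈ U) (j k : Fin n) :
    fderiv ℝ (e k) p (e j p) - fderiv ℝ (e j) p (e k p)
      = ∑ l, (connectionForm g e p (e j p) k l - connectionForm g e p (e k p) j l) • e l p := by
  simp only [sub_smul, Finset.sum_sub_distrib, ← covDeriv_frame he hp]
  rw [covDeriv, covDeriv, christoffel_symm hg hU hp (e k p)]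
  abel

/-- Cartan's structure equation for the curvature. -/
theorem connectionForm_structure (hg : IsRiemannianMetricOn g U) (hU : IsOpen U)
    (he : IsOrientedOrthonormalFrameOn g e U) (hp : p ∈ U) (ξ η : Eucl n) (k l : Fin n) :
    fderiv ℝ (fun q => connectionForm g e q η k l) p ξ
        - fderiv ℝ (fun q => connectionForm g e q ξ k l) p η
      = g p (riemann g p ξ η (e k p)) (e l p)
        + ∑ m, (connectionForm g e p η k m * connectionForm g e p ξ l m
          - connectionForm g e p ξ k m * connectionForm g e p η l m) := by
  have hd : ∀ τ, DifferentiableAt ℝ (fun q => covDeriv g (e k) q τ) p := fun τ =>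
    (ContDiffAt.covDeriv hg hU he hp (he.contDiffAt hU hp k) τ).differentiableAt (by simp)
  have h : ∀ ζ τ, fderiv ℝ (fun q => connectionForm g e q τ k l) p ζ
      = g p (covDeriv g (fun q => covDeriv g (e k) q τ) p ζ) (e l p)
        + g p (covDeriv g (e k) p τ) (covDeriv g (e l) p ζ) := fun ζ τ =>
    fderiv_metric_covDeriv hg hU he hp (hd τ) (he.differentiableAt hU hp l) ζ
  rw [h, h, ← covDeriv_commutator hg hU he hp (he.contDiffAt hU hp k), map_sub,
    _root_.sub_apply, he.metric_eq hp (covDeriv g (e k) p η), he.metric_eq hp (covDeriv g (e k) p ξ)]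
  simp only [← connectionForm_eq, Finset.sum_sub_distrib]
  ring

theorem riemann_antisymm (p X Y Z : Eucl n) : riemann g p X Y Z = -riemann g p Y X Z := by
  simp only [riemann]; abel

theorem fderiv_christoffel_symm (hg : IsRiemannianMetricOn g U) (hU : IsOpen U) (hp : p ∈ U)
    (X Y : Eucl n) : fderiv ℝ (fun q => christoffel g q X Y) p
      = fderiv ℝ (fun q => christoffel g q Y X) p := by
  refine Filter.EventuallyEq.fderiv_eq ?_
  filter_upwards [hU.mem_nhds hp] with q hq using christoffel_symm hg hU hq X Y

/-- The first Bianchi identity. -/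
theorem riemann_bianchi (hg : IsRiemannianMetricOn g U) (hU : IsOpen U) (hp : p ∈ U)
    (X Y Z : Eucl n) : riemann g p X Y Z + riemann g p Y Z X + riemann g p Z X Y = 0 := by
  simp only [riemann]
  rw [fderiv_christoffel_symm hg hU hp Z X, fderiv_christoffel_symm hg hU hp Z Y,
    fderiv_christoffel_symm hg hU hp Y X, christoffel_symm hg hU hp Z X,
    christoffel_symm hg hU hp Z Y, christoffel_symm hg hU hp Y X]
  abel

theorem fderiv_christoffel_apply (hg : IsRiemannianMetricOn g U) (hU : IsOpen U)
    (he : IsOrientedOrthonormalFrameOn g e U) (hp : p ∈ U) (X Y ξ : Eucl n) :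
    fderiv ℝ (fun q => christoffel g q X Y) p ξ
      = fderiv ℝ (fun q => christoffelCLM g q X) p ξ Y := by
  have hC : DifferentiableAt ℝ (fun q => christoffelCLM g q X) p :=
    (contDiffAt_christoffelCLM hg hU he hp X).differentiableAt (by simp)
  have h : fderiv ℝ (fun q => christoffel g q X Y) p = _ :=
    (hC.hasFDerivAt.clm_apply (hasFDerivAt_const Y p)).fderiv
  rw [h]; simp

/-- The Riemann tensor as a linear map in its first argument. -/
theorem exists_riemann_linear_left (hg : IsRiemannianMetricOn g U) (hU : IsOpen U)
    (he : IsOrientedOrthonormalFrameOn g e U) (hp : p ∈ U) (Y Z : Eucl n) :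
    ∃ T : Eucl n →ₗ[ℝ] Eucl n, ∀ X, T X = riemann g p X Y Z := by
  have h : ∀ X, riemann g p X Y Z = fderiv ℝ (fun q => christoffelCLM g q Z) p X Y
      - fderiv ℝ (fun q => christoffelCLM g q Z) p Y X
      + christoffelCLM g p (christoffel g p Y Z) X
      - christoffelCLM g p Y (christoffelCLM g p Z X) := by
    intro X
    simp only [christoffelCLM_apply]
    rw [riemann, fderiv_christoffel_symm hg hU hp Y Z, fderiv_christoffel_symm hg hU hp X Z,
      fderiv_christoffel_apply hg hU he hp, fderiv_christoffel_apply hg hU he hp,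
      christoffel_symm hg hU hp X (christoffel g p Y Z), christoffel_symm hg hU hp X Z]
  refine ⟨{ toFun := fun X => riemann g p X Y Z, map_add' := fun X X' => ?_,
            map_smul' := fun c X => ?_ }, fun X => rfl⟩
  · simp only [h, map_add, _root_.add_apply]; abel
  · simp only [h, map_smul, _root_.smul_apply, RingHom.id_apply, smul_add, smul_sub]

/-- The Riemann tensor as a linear map in its third argument. -/
theorem exists_riemann_linear_right (hg : IsRiemannianMetricOn g U) (hU : IsOpen U)
    (he : IsOrientedOrthonormalFrameOn g e U) (hp : p ∈ U) (X Y : Eucl n) :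
    ∃ T : Eucl n →ₗ[ℝ] Eucl n, ∀ Z, T Z = riemann g p X Y Z := by
  have h : ∀ Z, riemann g p X Y Z = fderiv ℝ (fun q => christoffelCLM g q Y) p X Z
      - fderiv ℝ (fun q => christoffelCLM g q X) p Y Z
      + christoffelCLM g p X (christoffelCLM g p Y Z)
      - christoffelCLM g p Y (christoffelCLM g p X Z) := by
    intro Z
    simp only [christoffelCLM_apply]
    rw [riemann, fderiv_christoffel_apply hg hU he hp, fderiv_christoffel_apply hg hU he hp]
  refine ⟨{ toFun := fun Z => riemann g p X Y Z, map_add' := fun X X' => ?_,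
            map_smul' := fun c X => ?_ }, fun X => rfl⟩
  · simp only [h, map_add]; abel
  · simp only [h, map_smul, RingHom.id_apply, smul_add, smul_sub]

theorem ricci_eq_sum_frame (hg : IsRiemannianMetricOn g U) (hU : IsOpen U)
    (he : IsOrientedOrthonormalFrameOn g e U) (hp : p ∈ U) (Y Z : Eucl n) :
    ricci g p Y Z = ∑ i, g p (riemann g p (e i p) Y Z) (e i p) := by
  obtain ⟨T, hT⟩ := exists_riemann_linear_left hg hU he hp Y Z
  have := he.sum_apply_stdVec hp T
  simpa [hT, ricci] using this

theorem scalarCurvature_eq_sum_frame (hg : IsRiemannianMetricOn g U) (hU : IsOpen U)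
    (he : IsOrientedOrthonormalFrameOn g e U) (hp : p ∈ U) :
    scalarCurvature g p = ∑ i, ∑ j, g p (riemann g p (e i p) (e j p) (e j p)) (e i p) := by
  have h1 : ∀ j, ricci g p (stdVec j) ((g p).inverse (EuclideanSpace.proj j))
      = ∑ i, ∑ k, e k p j * g p (riemann g p (e i p) (stdVec j) (e k p)) (e i p) := by
    intro j
    rw [ricci_eq_sum_frame hg hU he hp, metric_inverse_apply hg he hp]
    refine Finset.sum_congr rfl fun i _ => ?_
    obtain ⟨T, hT⟩ := exists_riemann_linear_right hg hU he hp (e i p) (stdVec j)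
    rw [← hT, map_sum, map_sum, _root_.sum_apply]
    simp only [map_smul]
    simp only [_root_.smul_apply, hT]
    rfl
  have h2 : ∀ i k, ∑ j, e k p j * g p (riemann g p (e i p) (stdVec j) (e k p)) (e i p)
      = g p (riemann g p (e i p) (e k p) (e k p)) (e i p) := by
    intro i k
    obtain ⟨T, hT⟩ := exists_riemann_linear_left hg hU he hp (e i p) (e k p)
    have hT' : ∀ Y, riemann g p (e i p) Y (e k p) = -T Y := fun Y => by
      rw [hT, riemann_antisymm]
    rw [hT']
    conv_rhs => rw [← sum_smul_stdVec (e k p), map_sum]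
    simp [hT']
  simp only [scalarCurvature, h1]
  calc _ = ∑ i, ∑ j, ∑ k, e k p j * g p (riemann g p (e i p) (stdVec j) (e k p)) (e i p) :=
        Finset.sum_comm
    _ = ∑ i, ∑ k, ∑ j, e k p j * g p (riemann g p (e i p) (stdVec j) (e k p)) (e i p) :=
        Finset.sum_congr rfl fun _ _ => Finset.sum_comm
    _ = _ := by simp only [h2]

/-- The Riemannian volume density `1 / det e` with respect to Lebesgue measure. -/
noncomputable def frameDensity (e : Fin n → Eucl n → Eucl n) (p : Eucl n) : ℝ :=
  (Matrix.of fun k j : Fin n => e k p j).det⁻¹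

theorem frameDensity_pos (he : IsOrientedOrthonormalFrameOn g e U) (hp : p ∈ U) :
    0 < frameDensity e p :=
  inv_pos.mpr (he.oriented p hp)

theorem hasFDerivAt_frameDet (he : IsOrientedOrthonormalFrameOn g e U) (hU : IsOpen U)
    (hp : p ∈ U) : ∃ L : Eucl n →L[ℝ] ℝ,
      HasFDerivAt (fun q => (Matrix.of fun k j : Fin n => e k q j).det) L p ∧
      ∀ ξ, L ξ = (Matrix.of fun k j : Fin n => e k p j).det
        * ∑ l, g p (fderiv ℝ (e l) p ξ) (e l p) := by
  let D : ContinuousMultilinearMap ℝ (fun _ : Fin n => Fin n → ℝ) ℝ :=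
    { (Matrix.detRowAlternating (R := ℝ) (n := Fin n)).toMultilinearMap with
      cont := Continuous.matrix_det (A := fun M : Matrix (Fin n) (Fin n) ℝ => M) continuous_id }
  have hD : ∀ M : Fin n → Fin n → ℝ, D M = (Matrix.of M).det := fun M => rfl
  let ofLp : Eucl n →L[ℝ] (Fin n → ℝ) := (EuclideanSpace.equiv (Fin n) ℝ : Eucl n →L[ℝ] _)
  have hrow : HasFDerivAt (fun q => fun k : Fin n => ofLp (e k q))
      (ContinuousLinearMap.pi fun k => ofLp ∘L fderiv ℝ (e k) p) p := by
    rw [hasFDerivAt_pi]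
    intro k
    exact ofLp.hasFDerivAt.comp p (he.differentiableAt hU hp k).hasFDerivAt
  have h := (D.hasFDerivAt (fun k => ofLp (e k p))).comp p hrow
  refine ⟨_, h, fun ξ => ?_⟩
  simp only [ContinuousLinearMap.comp_apply, ContinuousMultilinearMap.linearDeriv_apply, hD]
  rw [Finset.mul_sum]
  refine Finset.sum_congr rfl fun l _ => ?_
  have hupd : (Matrix.of (Function.update (fun k => ofLp (e k p)) l
      (ofLp (fderiv ℝ (e l) p ξ)))) = (Matrix.of fun k j : Fin n => e k p j).updateRow l
        (∑ k, g p (fderiv ℝ (e l) p ξ) (e k p) • (Matrix.of fun k j : Fin n => e k p j) k) := by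
    have : ofLp (fderiv ℝ (e l) p ξ)
        = ∑ k, g p (fderiv ℝ (e l) p ξ) (e k p) • (Matrix.of fun k j : Fin n => e k p j) k := by
      conv_lhs => rw [← he.expansion hp (fderiv ℝ (e l) p ξ), map_sum]
      simp only [map_smul]
      rfl
    rw [← this]; rfl
  have := Matrix.det_updateRow_sum (Matrix.of fun k j : Fin n => e k p j) l
    (fun k => g p (fderiv ℝ (e l) p ξ) (e k p))
  rw [smul_eq_mul, mul_comm] at this
  rw [← this, ← hupd]
  rfl

theorem contDiffAt_frameDensity (he : IsOrientedOrthonormalFrameOn g e U) (hU : IsOpen U)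
    (hp : p ∈ U) : ContDiffAt ℝ ∞ (frameDensity e) p := by
  have h : ContDiffAt ℝ ∞ (fun q => (Matrix.of fun k j : Fin n => e k q j).det) p := by
    simp only [Matrix.det_apply]
    refine ContDiffAt.sum fun σ _ => ContDiffAt.const_smul _ (contDiffAt_prod fun i _ => ?_)
    exact (EuclideanSpace.proj (𝕜 := ℝ) i).contDiff.contDiffAt.comp p (he.contDiffAt hU hp (σ i))
  exact h.inv (he.oriented p hp).ne'

/-- The Riemannian divergence of a frame vector is `∑_l g(∇_{e_l} e_k, e_l)`; multiplied by the
density it is the Euclidean divergence of the weighted vector field. -/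
theorem divergence_frame (hg : IsRiemannianMetricOn g U) (hU : IsOpen U)
    (he : IsOrientedOrthonormalFrameOn g e U) (hp : p ∈ U) (k : Fin n) :
    fderiv ℝ (frameDensity e) p (e k p) + frameDensity e p * ∑ i, fderiv ℝ (e k) p (stdVec i) i
      = frameDensity e p * ∑ l, connectionForm g e p (e l p) k l := by
  obtain ⟨L, hL, hL'⟩ := hasFDerivAt_frameDet he hU hp
  have hne := (he.oriented p hp).ne'
  have h1 : fderiv ℝ (frameDensity e) p (e k p)
      = -(frameDensity e p * ∑ l, g p (fderiv ℝ (e l) p (e k p)) (e l p)) := by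
    have : HasFDerivAt (frameDensity e) _ p := (hasDerivAt_inv hne).comp_hasFDerivAt p hL
    rw [this.fderiv]
    simp only [_root_.smul_apply, hL', smul_eq_mul, frameDensity]
    field_simp
  have h2 := he.sum_apply_stdVec hp (fderiv ℝ (e k) p).toLinearMap
  simp only [ContinuousLinearMap.coe_coe] at h2
  have h3 : ∀ l, g p (fderiv ℝ (e k) p (e l p)) (e l p) - g p (fderiv ℝ (e l) p (e k p)) (e l p)
      = connectionForm g e p (e l p) k l := by
    intro l
    have h0 : connectionForm g e p (e k p) l l = 0 := by
      linarith [connectionForm_antisymm hg hU he hp (e k p) l l]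
    rw [← _root_.sub_apply, ← map_sub, frame_bracket hg hU he hp l k, map_sum, _root_.sum_apply]
    simp [he.orthonormal p hp, h0]
  rw [h1, h2]
  simp only [← h3, Finset.sum_sub_distrib]
  ring

end FrameCurvature

/-! ### The Lichnerowicz formula -/

section LichnerowiczAlgebra

variable {ι K : Type*} [Fintype ι] [DecidableEq ι] [NormedAddCommGroup K] [InnerProductSpace ℝ K]

/-- The algebra behind the Lichnerowicz formula at a point. Here `u_k`, `Z_{jk}` stand for `∇_k s`,
`∇_j (∇_k s)`, and `θ_{jkl}` for the connection coefficients: `dirac` is the derivative of the Dirac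
equation and `comm` the definition of the curvature. With the second covariant derivatives
`Z_{jk} - ∑ θ_{jkl} u_l` these hypotheses lose their first-order terms. -/
theorem IsCliffordFamily.lichnerowicz {γ : ι → K →L[ℝ] K} (h : IsCliffordFamily γ)
    {θ : ι → ι → ι → ℝ} (hθ : ∀ j k l, θ j k l = -θ j l k) {R : ι → ι → ι → ι → ℝ}
    (hanti : ∀ i j k l, R i j k l = -R j i k l)
    (hbianchi : ∀ i j k l, R i j k l + R j k i l + R k i j l = 0)
    {s : K} {u : ι → K} {Z : ι → ι → K}
    (dirac : ∀ j, ∑ k, (γ k (Z j k) + ∑ l, θ j k l • γ l (u k)) = 0)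
    (comm : ∀ j k, Z j k - Z k j = ∑ l, (θ j k l - θ k j l) • u l + spinElement γ (R j k) s) :
    ⟪s, ∑ k, Z k k + ∑ k, ∑ l, θ l k l • u k⟫_ℝ = 1 / 4 * (∑ i, ∑ j, R i j j i) * ‖s‖ ^ 2 := by
  set H : ι → ι → K := fun j k => Z j k - ∑ l, θ j k l • u l with hH
  have hHd : ∀ j, ∑ k, γ k (H j k) = 0 := by
    intro j
    rw [← dirac j]
    simp only [hH, map_sub, map_sum, map_smul, Finset.sum_sub_distrib, Finset.sum_add_distrib]
    rw [sub_eq_add_neg, Finset.sum_comm (f := fun k l => θ j k l • γ k (u l))]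
    congr 1
    simp only [← Finset.sum_neg_distrib, ← neg_smul]
    exact Finset.sum_congr rfl fun k _ => Finset.sum_congr rfl fun l _ => by rw [hθ j l k, neg_neg]
  have hHc : ∀ j k, H j k - H k j = spinElement γ (R j k) s := by
    intro j k
    have : H j k - H k j = (Z j k - Z k j) - ∑ l, (θ j k l - θ k j l) • u l := by
      simp only [hH, sub_smul, Finset.sum_sub_distrib]; abel
    rw [this, comm]; abel
  have hdiag : ∑ k, Z k k + ∑ k, ∑ l, θ l k l • u k = ∑ k, H k k := by
    simp only [hH, Finset.sum_sub_distrib]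
    rw [sub_eq_add_neg, Finset.sum_comm (f := fun k l => θ l k l • u k)]
    congr 1
    simp only [← Finset.sum_neg_distrib, ← neg_smul]
    exact Finset.sum_congr rfl fun k _ => Finset.sum_congr rfl fun l _ => by rw [hθ k l k]
  have h0 : ∑ j, ∑ k, (γ j * γ k) (H j k) = 0 := by
    refine Finset.sum_eq_zero fun j _ => ?_
    simp only [mul_apply_eq_comp, ← map_sum, hHd, map_zero]
  have h0' : ∑ j, ∑ k, (γ k * γ j) (H k j) = 0 := by rw [Finset.sum_comm]; exact h0
  have hsw : ∀ j k, (γ k * γ j) (H k j)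
      = -((γ j * γ k) (H k j)) + if j = k then (-2 : ℝ) • H k j else 0 := by
    intro j k
    have h1 := congrArg (fun T : K →L[ℝ] K => T (H k j)) (h.relations j k)
    simp only [_root_.add_apply] at h1
    rw [← sub_eq_iff_eq_add', sub_neg_eq_add, add_comm, h1]
    split_ifs <;> simp
  have hcurv : ∑ j, ∑ k, (γ j * γ k) (spinElement γ (R j k) s) = (2 : ℝ) • ∑ k, H k k := by
    have : ∑ j, ∑ k, ((γ j * γ k) (H j k) + (γ k * γ j) (H k j)) = 0 := by
      simp only [Finset.sum_add_distrib, h0, h0', add_zero]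
    have hpair : ∀ j k, (γ j * γ k) (H j k) + (γ k * γ j) (H k j)
        = (γ j * γ k) (spinElement γ (R j k) s) + if j = k then (-2 : ℝ) • H k j else 0 := by
      intro j k
      rw [hsw j k, ← hHc j k, map_sub _ (H j k) (H k j)]; abel
    simp only [hpair, Finset.sum_add_distrib, Finset.sum_ite_eq, Finset.mem_univ, if_true,
      ← Finset.smul_sum] at this
    rw [← sub_eq_zero, ← this]; module
  have hcontr : ∑ j, ∑ k, (γ j * γ k) (spinElement γ (R j k) s)
      = (1 / 4 : ℝ) • ((∑ i, ∑ j, ∑ k, ∑ l, R i j k l • (γ i * γ j * γ k * γ l)) s) := by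
    simp only [spinElement, _root_.sum_apply, _root_.smul_apply, map_smul, map_sum,
      Finset.smul_sum, mul_apply_eq_comp]
  rw [hdiag]
  have h2 : ∑ k, H k k = (1 / 2 : ℝ) • ((2 : ℝ) • ∑ k, H k k) := by rw [smul_smul]; norm_num
  rw [h2, ← hcurv, hcontr, h.relations.curvature_contraction hanti hbianchi]
  simp only [_root_.smul_apply, inner_smul_right, h.inner_ricci]
  ring

end LichnerowiczAlgebra

section SpinCalculus

variable {n : ℕ} {g : Eucl n → Eucl n →L[ℝ] Eucl n →L[ℝ] ℝ} {e : Fin n → Eucl n → Eucl n}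
  {U : Set (Eucl n)} {p : Eucl n} {K : Type*} [NormedAddCommGroup K] [InnerProductSpace ℝ K]
  {γ : Fin n → K →L[ℝ] K}

theorem spinElement_add {ι 𝒜 : Type*} [Fintype ι] [Ring 𝒜] [Algebra ℝ 𝒜]
    (γ : ι → 𝒜) (θ η : ι → ι → ℝ) :
    spinElement γ (fun k l => θ k l + η k l) = spinElement γ θ + spinElement γ η := by
  simp only [spinElement, add_smul, Finset.sum_add_distrib, smul_add]

theorem spinElement_smul {ι 𝒜 : Type*} [Fintype ι] [Ring 𝒜] [Algebra ℝ 𝒜]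
    (γ : ι → 𝒜) (c : ℝ) (θ : ι → ι → ℝ) :
    spinElement γ (fun k l => c * θ k l) = c • spinElement γ θ := by
  simp only [spinElement, mul_smul, ← Finset.smul_sum]
  rw [smul_comm]

/-- The connection form `ξ ↦ ¼ ∑_{k,l} g(∇_ξ e_k, e_l) γ_k γ_l` of the spin connection. It is
assembled from its values on the standard basis, so that it is linear at every point, also where
`g` is not a metric. -/
noncomputable def spinForm (γ : Fin n → K →L[ℝ] K) (g : Eucl n → Eucl n →L[ℝ] Eucl n →L[ℝ] ℝ)
    (e : Fin n → Eucl n → Eucl n) (p : Eucl n) : Eucl n →L[ℝ] K →L[ℝ] K :=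
  ∑ i, (EuclideanSpace.proj i : Eucl n →L[ℝ] ℝ).smulRight
    (spinElement γ (connectionForm g e p (stdVec i)))

theorem spinForm_apply (hg : IsRiemannianMetricOn g U) (hU : IsOpen U) (hp : p ∈ U)
    (γ : Fin n → K →L[ℝ] K) (ξ : Eucl n) :
    spinForm γ g e p ξ = spinElement γ (connectionForm g e p ξ) := by
  let T : Eucl n →ₗ[ℝ] K →L[ℝ] K :=
    { toFun := fun ξ => spinElement γ (connectionForm g e p ξ)
      map_add' := fun ξ η => by
        rw [← spinElement_add]; congr 1; ext k l; exact connectionForm_add hg hU hp ξ η k l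
      map_smul' := fun c ξ => by
        rw [RingHom.id_apply, ← spinElement_smul]; congr 1; ext k l
        exact connectionForm_smul hg hU hp c ξ k l }
  have h : ∀ η, T η = spinElement γ (connectionForm g e p η) := fun _ => rfl
  rw [← h]
  conv_rhs => rw [← sum_smul_stdVec ξ, map_sum]
  simp only [map_smul]
  simp [spinForm, h]

theorem contDiffAt_spinForm (hg : IsRiemannianMetricOn g U) (hU : IsOpen U)
    (he : IsOrientedOrthonormalFrameOn g e U) (hp : p ∈ U) (γ : Fin n → K →L[ℝ] K) :
    ContDiffAt ℝ ∞ (spinForm γ g e) p := by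
  have h : ∀ i k l, ContDiffAt ℝ ∞ (fun q => connectionForm g e q (stdVec i) k l) p :=
    fun i k l => contDiffAt_connectionForm hg hU he hp _ k l
  have h2 : ∀ i, ContDiffAt ℝ ∞ (fun q => spinElement γ (connectionForm g e q (stdVec i))) p := by
    intro i
    refine ContDiffAt.const_smul _ (ContDiffAt.sum fun k _ => ContDiffAt.sum fun l _ => ?_)
    exact (h i k l).smul contDiffAt_const
  refine ContDiffAt.sum fun i _ => ?_
  exact contDiffAt_const.smulRight (h2 i)

/-- The spin covariant derivative `∇_ξ s` of a section over an open set. -/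
noncomputable def spinDeriv (γ : Fin n → K →L[ℝ] K) (g : Eucl n → Eucl n →L[ℝ] Eucl n →L[ℝ] ℝ)
    (e : Fin n → Eucl n → Eucl n) (s : Eucl n → K) (p ξ : Eucl n) : K :=
  fderiv ℝ s p ξ + spinForm γ g e p ξ (s p)

theorem spinForm_skew (hγ : IsCliffordFamily γ) (hg : IsRiemannianMetricOn g U) (hU : IsOpen U)
    (he : IsOrientedOrthonormalFrameOn g e U) (hp : p ∈ U) (ξ : Eucl n) (x y : K) :
    ⟪spinForm γ g e p ξ x, y⟫_ℝ = -⟪x, spinForm γ g e p ξ y⟫_ℝ := by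
  rw [spinForm_apply hg hU hp]
  exact hγ.spinElement_skew (connectionForm_antisymm hg hU he hp ξ) x y

/-- Clifford multiplication by frame vectors is parallel. -/
theorem spinForm_commutator (hγ : IsCliffordFamily γ) (hg : IsRiemannianMetricOn g U)
    (hU : IsOpen U) (he : IsOrientedOrthonormalFrameOn g e U) (hp : p ∈ U) (ξ : Eucl n)
    (k : Fin n) (x : K) :
    spinForm γ g e p ξ (γ k x) = γ k (spinForm γ g e p ξ x)
      + ∑ l, connectionForm g e p ξ k l • γ l x := by
  have h := congrArg (fun T : K →L[ℝ] K => T x)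
    (hγ.relations.spinElement_commutator (connectionForm_antisymm hg hU he hp ξ) k)
  simp only [_root_.sub_apply, mul_apply_eq_comp, _root_.sum_apply, _root_.smul_apply] at h
  rw [spinForm_apply hg hU hp, ← h]
  abel

/-- The spin connection is metric. -/
theorem fderiv_inner_spinDeriv (hγ : IsCliffordFamily γ) (hg : IsRiemannianMetricOn g U)
    (hU : IsOpen U) (he : IsOrientedOrthonormalFrameOn g e U) (hp : p ∈ U) {s t : Eucl n → K}
    (hs : DifferentiableAt ℝ s p) (ht : DifferentiableAt ℝ t p) (ξ : Eucl n) :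
    fderiv ℝ (fun q => ⟪s q, t q⟫_ℝ) p ξ
      = ⟪spinDeriv γ g e s p ξ, t p⟫_ℝ + ⟪s p, spinDeriv γ g e t p ξ⟫_ℝ := by
  rw [fderiv_inner_apply ℝ hs ht]
  simp only [spinDeriv, inner_add_left, inner_add_right, spinForm_skew hγ hg hU he hp]
  ring

theorem spinDeriv_clifford (hγ : IsCliffordFamily γ) (hg : IsRiemannianMetricOn g U)
    (hU : IsOpen U) (he : IsOrientedOrthonormalFrameOn g e U) (hp : p ∈ U) {t : Eucl n → K}
    (ht : DifferentiableAt ℝ t p) (ξ : Eucl n) (k : Fin n) :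
    spinDeriv γ g e (fun q => γ k (t q)) p ξ
      = γ k (spinDeriv γ g e t p ξ) + ∑ l, connectionForm g e p ξ k l • γ l (t p) := by
  have h : fderiv ℝ (fun q => γ k (t q)) p = _ := ((γ k).hasFDerivAt.comp p ht.hasFDerivAt).fderiv
  rw [spinDeriv, spinDeriv, h, spinForm_commutator hγ hg hU he hp]
  simp only [ContinuousLinearMap.comp_apply, map_add]
  abel

theorem fderiv_spinForm_apply (hg : IsRiemannianMetricOn g U) (hU : IsOpen U)
    (he : IsOrientedOrthonormalFrameOn g e U) (hp : p ∈ U) (γ : Fin n → K →L[ℝ] K)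
    (ξ η : Eucl n) : fderiv ℝ (spinForm γ g e) p ξ η
      = spinElement γ fun k l => fderiv ℝ (fun q => connectionForm g e q η k l) p ξ := by
  have hd : DifferentiableAt ℝ (spinForm γ g e) p :=
    (contDiffAt_spinForm hg hU he hp γ).differentiableAt (by simp)
  have h1 : fderiv ℝ (fun q => spinForm γ g e q η) p ξ = fderiv ℝ (spinForm γ g e) p ξ η := by
    rw [(hd.hasFDerivAt.clm_apply (hasFDerivAt_const η p)).fderiv]; simp
  have h2 : (fun q => spinForm γ g e q η)
      =ᶠ[nhds p] fun q => spinElement γ (connectionForm g e q η) := by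
    filter_upwards [hU.mem_nhds hp] with q hq using spinForm_apply hg hU hq γ η
  have hθ : ∀ k l, HasFDerivAt (fun q => connectionForm g e q η k l)
      (fderiv ℝ (fun q => connectionForm g e q η k l) p) p := fun k l =>
    ((contDiffAt_connectionForm hg hU he hp η k l).differentiableAt (by simp)).hasFDerivAt
  have h3 : HasFDerivAt (fun q => spinElement γ (connectionForm g e q η)) _ p :=
    HasFDerivAt.const_smul (HasFDerivAt.fun_sum fun k _ => HasFDerivAt.fun_sum fun l _ =>
      (hθ k l).smul_const (γ k * γ l)) (1 / 4 : ℝ)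
  rw [← h1, h2.fderiv_eq, h3.fderiv]
  simp [spinElement, _root_.sum_apply]

/-- The curvature of the spin connection is the spin element of the Riemann tensor. -/
theorem spinForm_curvature (hγ : IsCliffordFamily γ) (hg : IsRiemannianMetricOn g U)
    (hU : IsOpen U) (he : IsOrientedOrthonormalFrameOn g e U) (hp : p ∈ U) (ξ η : Eucl n) :
    fderiv ℝ (spinForm γ g e) p ξ η - fderiv ℝ (spinForm γ g e) p η ξ
        + (spinForm γ g e p ξ * spinForm γ g e p η - spinForm γ g e p η * spinForm γ g e p ξ)
      = spinElement γ fun k l => g p (riemann g p ξ η (e k p)) (e l p) := by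
  have hant := fun τ => connectionForm_antisymm hg hU he hp τ
  rw [fderiv_spinForm_apply hg hU he hp, fderiv_spinForm_apply hg hU he hp,
    spinForm_apply hg hU hp, spinForm_apply hg hU hp,
    hγ.relations.spinElement_bracket (hant ξ), sub_eq_add_neg, ← neg_one_smul ℝ,
    ← spinElement_smul, ← spinElement_add, ← spinElement_add]
  congr 1
  ext k l
  have h := connectionForm_structure hg hU he hp ξ η k l
  rw [neg_one_mul, ← sub_eq_add_neg, h, add_assoc, ← Finset.sum_add_distrib]
  rw [Finset.sum_eq_zero, add_zero]
  intro m _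
  rw [hant ξ l m, hant η l m, hant ξ m k]
  ring

theorem hasFDerivAt_spinDeriv (hg : IsRiemannianMetricOn g U) (hU : IsOpen U)
    (he : IsOrientedOrthonormalFrameOn g e U) (hp : p ∈ U) (γ : Fin n → K →L[ℝ] K)
    {s : Eucl n → K} (hs : ContDiffAt ℝ ∞ s p) {X : Eucl n → Eucl n}
    (hX : DifferentiableAt ℝ X p) :
    DifferentiableAt ℝ (fun q => spinDeriv γ g e s q (X q)) p ∧ ∀ ξ,
    fderiv ℝ (fun q => spinDeriv γ g e s q (X q)) p ξ
      = fderiv ℝ (fderiv ℝ s) p ξ (X p) + fderiv ℝ (spinForm γ g e) p ξ (X p) (s p)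
        + spinForm γ g e p (X p) (fderiv ℝ s p ξ) + spinDeriv γ g e s p (fderiv ℝ X p ξ) := by
  have hds : DifferentiableAt ℝ (fderiv ℝ s) p :=
    (hs.fderiv_right (m := ∞) (by simp)).differentiableAt (by simp)
  have hd : DifferentiableAt ℝ (spinForm γ g e) p :=
    (contDiffAt_spinForm hg hU he hp γ).differentiableAt (by simp)
  have hsd : DifferentiableAt ℝ s p := hs.differentiableAt (by simp)
  have h : HasFDerivAt (fun q => spinDeriv γ g e s q (X q)) _ p :=
    (hds.hasFDerivAt.clm_apply hX.hasFDerivAt).add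
      ((hd.hasFDerivAt.clm_apply hX.hasFDerivAt).clm_apply hsd.hasFDerivAt)
  refine ⟨h.differentiableAt, fun ξ => ?_⟩
  rw [h.fderiv, spinDeriv]
  simp
  abel

/-- The commutator of covariant derivatives along frame vectors. -/
theorem spinDeriv_commutator (hγ : IsCliffordFamily γ) (hg : IsRiemannianMetricOn g U)
    (hU : IsOpen U) (he : IsOrientedOrthonormalFrameOn g e U) (hp : p ∈ U) {s : Eucl n → K}
    (hs : ContDiffAt ℝ ∞ s p) (j k : Fin n) :
    spinDeriv γ g e (fun q => spinDeriv γ g e s q (e k q)) p (e j p)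
        - spinDeriv γ g e (fun q => spinDeriv γ g e s q (e j q)) p (e k p)
      = ∑ l, (connectionForm g e p (e j p) k l - connectionForm g e p (e k p) j l) •
          spinDeriv γ g e s p (e l p)
        + spinElement γ (fun m l => g p (riemann g p (e j p) (e k p) (e m p)) (e l p)) (s p) := by
  have hsymm : IsSymmSndFDerivAt ℝ s p := hs.isSymmSndFDerivAt (by
      rw [minSmoothness_of_isRCLikeNormedField]
      exact WithTop.coe_le_coe.mpr (le_top (a := (2 : ℕ∞))))
  have hlin : ∀ c : Fin n → ℝ, ∑ l, c l • spinDeriv γ g e s p (e l p)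
      = spinDeriv γ g e s p (∑ l, c l • e l p) := by
    intro c
    simp [spinDeriv, map_sum, Finset.sum_add_distrib, _root_.sum_apply]
  have hsub : ∀ ξ η, spinDeriv γ g e s p (ξ - η)
      = spinDeriv γ g e s p ξ - spinDeriv γ g e s p η := by
    intro ξ η
    simp only [spinDeriv, map_sub, _root_.sub_apply]; abel
  have hd : ∀ ζ Y, spinDeriv γ g e Y p ζ = fderiv ℝ Y p ζ + spinForm γ g e p ζ (Y p) :=
    fun _ _ => rfl
  rw [hlin, ← frame_bracket hg hU he hp, hsub, ← spinForm_curvature hγ hg hU he hp,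
    hd (e j p) (fun q => spinDeriv γ g e s q (e k q)),
    hd (e k p) (fun q => spinDeriv γ g e s q (e j q)),
    (hasFDerivAt_spinDeriv hg hU he hp γ hs (he.differentiableAt hU hp k)).2,
    (hasFDerivAt_spinDeriv hg hU he hp γ hs (he.differentiableAt hU hp j)).2, hd (e k p) s,
    hd (e j p) s, hsymm.eq (e j p) (e k p)]
  simp only [map_add, _root_.add_apply, _root_.sub_apply, mul_apply_eq_comp]
  abel

/-- The vector field `∑_k ⟨s, ∇_k s⟩ e_k`, half the gradient of `|s|²`, weighted by the volume
density. -/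
noncomputable def bochnerField (γ : Fin n → K →L[ℝ] K)
    (g : Eucl n → Eucl n →L[ℝ] Eucl n →L[ℝ] ℝ) (e : Fin n → Eucl n → Eucl n) (s : Eucl n → K)
    (q : Eucl n) : Eucl n :=
  ∑ k, (⟪s q, spinDeriv γ g e s q (e k q)⟫_ℝ * frameDensity e q) • e k q

/-- The integrand form of the Lichnerowicz formula: for a harmonic spinor the divergence of the
Bochner field is `|∇s|² + ¼ R |s|²`. -/
theorem divergence_bochnerField (hγ : IsCliffordFamily γ) (hg : IsRiemannianMetricOn g U)
    (hU : IsOpen U) (he : IsOrientedOrthonormalFrameOn g e U) (hp : p ∈ U) {s : Eucl n → K}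
    (hs : ContDiffAt ℝ ∞ s p)
    (hD : ∀ᶠ q in nhds p, ∑ k, γ k (spinDeriv γ g e s q (e k q)) = 0) :
    ∑ i, fderiv ℝ (bochnerField γ g e s) p (stdVec i) i
      = frameDensity e p * (∑ k, ‖spinDeriv γ g e s p (e k p)‖ ^ 2
        + 1 / 4 * scalarCurvature g p * ‖s p‖ ^ 2) := by
  set t : Fin n → Eucl n → K := fun k q => spinDeriv γ g e s q (e k q) with ht
  have htd : ∀ k, DifferentiableAt ℝ (t k) p := fun k =>
    (hasFDerivAt_spinDeriv hg hU he hp γ hs (he.differentiableAt hU hp k)).1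
  have hsd : DifferentiableAt ℝ s p := hs.differentiableAt (by simp)
  have hμ : DifferentiableAt ℝ (frameDensity e) p :=
    (contDiffAt_frameDensity he hU hp).differentiableAt (by simp)
  have hf : ∀ k, DifferentiableAt ℝ (fun q => ⟪s q, t k q⟫_ℝ) p := fun k => hsd.inner ℝ (htd k)
  -- The Euclidean divergence of each summand of the field.
  have hk : ∀ k, ∑ i, fderiv ℝ (fun q => (⟪s q, t k q⟫_ℝ * frameDensity e q) • e k q) p
      (stdVec i) i = frameDensity e p * (fderiv ℝ (fun q => ⟪s q, t k q⟫_ℝ) p (e k p)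
        + ⟪s p, t k p⟫_ℝ * ∑ l, connectionForm g e p (e l p) k l) := by
    intro k
    have h1 : HasFDerivAt (fun q => (⟪s q, t k q⟫_ℝ * frameDensity e q) • e k q) _ p :=
      ((hf k).hasFDerivAt.mul hμ.hasFDerivAt).smul (he.differentiableAt hU hp k).hasFDerivAt
    have htr : ∀ φ : Eucl n →L[ℝ] ℝ, ∑ i, φ (stdVec i) * e k p i = φ (e k p) := by
      intro φ
      conv_rhs => rw [← sum_smul_stdVec (e k p), map_sum]
      simp [mul_comm]
    have hdiv := divergence_frame hg hU he hp k
    rw [h1.fderiv]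
    simp only [_root_.add_apply, _root_.smul_apply, ContinuousLinearMap.smulRight_apply,
      Pi.mul_apply, PiLp.add_apply, PiLp.smul_apply, smul_eq_mul, Finset.sum_add_distrib, ← Finset.mul_sum]
    have h2 := htr (⟪s p, t k p⟫_ℝ • fderiv ℝ (frameDensity e) p
      + frameDensity e p • fderiv ℝ (fun q => ⟪s q, t k q⟫_ℝ) p)
    simp only [_root_.add_apply, _root_.smul_apply, smul_eq_mul] at h2
    rw [h2]
    linear_combination ⟪s p, t k p⟫_ℝ * hdiv
  have hsum : ∑ i, fderiv ℝ (bochnerField γ g e s) p (stdVec i) i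
      = ∑ k, ∑ i, fderiv ℝ (fun q => (⟪s q, t k q⟫_ℝ * frameDensity e q) • e k q) p
        (stdVec i) i := by
    have h1 : HasFDerivAt (bochnerField γ g e s) _ p := HasFDerivAt.fun_sum fun k _ =>
      (((hf k).mul hμ).smul (he.differentiableAt hU hp k)).hasFDerivAt
    rw [h1.fderiv, Finset.sum_comm]
    refine Finset.sum_congr rfl fun i _ => ?_
    rw [_root_.sum_apply, WithLp.ofLp_sum, Finset.sum_apply]
    rfl
  have hlich := hγ.lichnerowicz (s := s p)
    (θ := fun j k l => connectionForm g e p (e j p) k l)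
    (fun j k l => connectionForm_antisymm hg hU he hp (e j p) k l)
    (R := fun i j k l => g p (riemann g p (e i p) (e j p) (e k p)) (e l p))
    (fun i j k l => by rw [riemann_antisymm]; simp)
    (fun i j k l => by
      rw [← _root_.add_apply, ← _root_.add_apply, ← map_add, ← map_add,
        riemann_bianchi hg hU hp]; simp)
    (u := fun k => t k p) (Z := fun j k => spinDeriv γ g e (t k) p (e j p))
    (fun j => by
      have h1 : ∀ k, γ k (spinDeriv γ g e (t k) p (e j p))
          + ∑ l, connectionForm g e p (e j p) k l • γ l (t k p)
          = spinDeriv γ g e (fun q => γ k (t k q)) p (e j p) := fun k =>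
        (spinDeriv_clifford hγ hg hU he hp (htd k) (e j p) k).symm
      have h2 : ∀ k, DifferentiableAt ℝ (fun q => γ k (t k q)) p := fun k =>
        (γ k).differentiableAt.comp p (htd k)
      have h3 : fderiv ℝ (fun q => ∑ k, γ k (t k q)) p = 0 := by
        have : (fun q => ∑ k, γ k (t k q)) =ᶠ[nhds p] fun _ => (0 : K) := hD
        rw [this.fderiv_eq, fderiv_const_apply]
      rw [fderiv_fun_sum fun k _ => h2 k] at h3
      simp only [h1]
      simp only [spinDeriv, Finset.sum_add_distrib, ← map_sum]
      have h4 := congrArg (fun T => T (e j p)) h3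
      simp only [_root_.sum_apply, _root_.zero_apply] at h4
      have h5 : ∑ k, γ k (t k p) = 0 := hD.self_of_nhds
      rw [h4, h5, map_zero, add_zero])
    (fun j k => spinDeriv_commutator hγ hg hU he hp hs j k)
  rw [hsum]
  simp only [hk, fderiv_inner_spinDeriv hγ hg hU he hp hsd (htd _), ← Finset.mul_sum]
  congr 1
  rw [scalarCurvature_eq_sum_frame hg hU he hp, ← hlich]
  simp only [inner_add_right, inner_sum, inner_smul_right, Finset.sum_add_distrib,
    Finset.mul_sum]
  have : ∀ k, ⟪spinDeriv γ g e s p (e k p), t k p⟫_ℝ = ‖t k p‖ ^ 2 := fun k =>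
    real_inner_self_eq_norm_sq _
  simp only [this]
  rw [add_assoc]
  congr 2
  exact Finset.sum_congr rfl fun k _ => Finset.sum_congr rfl fun l _ => by ring

end SpinCalculus

/-! ### Domains with smooth boundary -/

section Domain

open Filter Topology

variable {n : ℕ} {Ω V : Set (Eucl n)} {p q : Eucl n} {f : Eucl n → ℝ}

/-- A function whose directional derivative in the direction `v` is negative decreases along `v`. -/
theorem eventually_lt_of_fderiv_neg (hf : DifferentiableAt ℝ f p) {v : Eucl n}
    (hv : fderiv ℝ f p v < 0) : ∀ᶠ t : ℝ in 𝓝[>] 0, f (p + t • v) < f p := by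
  have h1 : HasDerivAt (fun t : ℝ => f (p + t • v)) (fderiv ℝ f p v) 0 := by
    have h2 : HasDerivAt (fun t : ℝ => p + t • v) v 0 := by
      simpa using ((hasDerivAt_id (0 : ℝ)).smul_const v).const_add p
    have h3 : HasFDerivAt f (fderiv ℝ f p) (p + (0 : ℝ) • v) := by simpa using hf.hasFDerivAt
    exact h3.comp_hasDerivAt 0 h2
  have h4 := h1.tendsto_slope_zero_right.eventually (gt_mem_nhds hv)
  filter_upwards [h4, self_mem_nhdsWithin] with t ht ht0
  have ht0 : (0 : ℝ) < t := ht0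
  simp only [zero_add, zero_smul, add_zero, smul_eq_mul] at ht
  have := (mul_neg_iff.mp ht).resolve_right (fun h => by
    have := inv_pos.mpr ht0; linarith [h.1])
  linarith [this.2]

theorem tendsto_add_smul_nhdsGT (p v : Eucl n) :
    Tendsto (fun t : ℝ => p + t • v) (𝓝[>] 0) (𝓝 p) := by
  have : ContinuousAt (fun t : ℝ => p + t • v) 0 := by fun_prop
  have h : Tendsto (fun t : ℝ => p + t • v) (𝓝 0) (𝓝 p) := by
    simpa [ContinuousAt] using this
  exact h.mono_left nhdsWithin_le_nhds

namespace IsLocalDefiningFunction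

theorem contDiffAt (h : IsLocalDefiningFunction Ω p f V) (hq : q ∈ V) : ContDiffAt ℝ ∞ f q :=
  h.smooth.contDiffAt (h.isOpen.mem_nhds hq)

theorem differentiableAt (h : IsLocalDefiningFunction Ω p f V) (hq : q ∈ V) :
    DifferentiableAt ℝ f q :=
  (h.contDiffAt hq).differentiableAt (by simp)

theorem congr_point (h : IsLocalDefiningFunction Ω p f V) (hq : q ∈ V) (h0 : f q = 0)
    (hd : fderiv ℝ f q ≠ 0) : IsLocalDefiningFunction Ω q f V :=
  ⟨h.isOpen, hq, h.smooth, h0, hd, h.mem_iff⟩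

theorem mem_interior (h : IsLocalDefiningFunction Ω p f V) (hq : q ∈ V) (h0 : f q < 0) :
    q ∈ interior Ω := by
  rw [mem_interior_iff_mem_nhds]
  filter_upwards [h.isOpen.mem_nhds hq,
    (h.contDiffAt hq).continuousAt.eventually (gt_mem_nhds h0)] with x hx hx0
  exact (h.mem_iff x hx).mpr (le_of_lt hx0)

theorem eq_zero_of_mem_frontier (h : IsLocalDefiningFunction Ω p f V) (hΩ : IsClosed Ω)
    (hq : q ∈ V) (hqf : q ∈ frontier Ω) : f q = 0 := by
  have h1 := (h.mem_iff q hq).mp (hΩ.frontier_subset hqf)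
  by_contra h2
  exact hqf.2 (h.mem_interior hq (lt_of_le_of_ne h1 h2))

theorem exists_fderiv_eq_one (h : IsLocalDefiningFunction Ω p f V) :
    ∃ w, fderiv ℝ f p w = 1 := by
  obtain ⟨v, hv⟩ : ∃ v, fderiv ℝ f p v ≠ 0 := by
    by_contra hc
    push Not at hc
    exact h.regular (ContinuousLinearMap.ext hc)
  exact ⟨(fderiv ℝ f p v)⁻¹ • v, by simp [hv]⟩

theorem mem_frontier_of_eq_zero (h : IsLocalDefiningFunction Ω p f V) (hq : q ∈ V) (h0 : f q = 0)
    (hd : fderiv ℝ f q ≠ 0) : q ∈ frontier Ω := by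
  have hq' := h.congr_point hq h0 hd
  obtain ⟨w, hw⟩ := hq'.exists_fderiv_eq_one
  have hqΩ : q ∈ Ω := (h.mem_iff q hq).mpr h0.le
  refine ⟨subset_closure hqΩ, fun hint => ?_⟩
  have h1 := eventually_lt_of_fderiv_neg (f := fun x => -f x) (v := w)
    (h.differentiableAt hq).neg (by rw [fderiv_fun_neg]; simp [hw])
  have h2 := (tendsto_add_smul_nhdsGT q w).eventually
    ((h.isOpen.inter isOpen_interior).mem_nhds ⟨hq, hint⟩)
  obtain ⟨t, ht1, ht2⟩ := (h1.and h2).exists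
  have := (h.mem_iff _ ht2.1).mp (interior_subset ht2.2)
  simp only [h0] at ht1
  linarith

theorem eventually_mem_interior (h : IsLocalDefiningFunction Ω p f V) {v : Eucl n}
    (hv : fderiv ℝ f p v < 0) : ∀ᶠ t : ℝ in 𝓝[>] 0, p + t • v ∈ interior Ω := by
  filter_upwards [eventually_lt_of_fderiv_neg (h.differentiableAt h.mem) hv,
    (tendsto_add_smul_nhdsGT p v).eventually (h.isOpen.mem_nhds h.mem)] with t ht1 ht2
  exact h.mem_interior ht2 (by rwa [h.zero] at ht1)

/-- Two local defining functions have positively proportional differentials. -/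
theorem fderiv_eq_smul {f' : Eucl n → ℝ} {V' : Set (Eucl n)}
    (h : IsLocalDefiningFunction Ω p f V) (h' : IsLocalDefiningFunction Ω p f' V') :
    ∃ c : ℝ, 0 < c ∧ fderiv ℝ f' p = c • fderiv ℝ f p := by
  -- A direction into the interior for `f` does not leave the domain for `f'`.
  have key : ∀ v, fderiv ℝ f p v < 0 → fderiv ℝ f' p v ≤ 0 := by
    intro v hv
    by_contra hc
    push Not at hc
    have h1 := eventually_lt_of_fderiv_neg (f := fun x => -f' x) (v := v)
      (h'.differentiableAt h'.mem).neg (by rw [fderiv_fun_neg]; simp [hc])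
    have h2 := h.eventually_mem_interior hv
    have h3 := (tendsto_add_smul_nhdsGT p v).eventually (h'.isOpen.mem_nhds h'.mem)
    obtain ⟨t, ⟨ht1, ht2⟩, ht3⟩ := ((h1.and h2).and h3).exists
    have := (h'.mem_iff _ ht3).mp (interior_subset ht2)
    rw [h'.zero] at ht1
    linarith
  obtain ⟨w, hw⟩ := h.exists_fderiv_eq_one
  -- On the kernel of `df` the functional `df'` is bounded, hence zero.
  have hker : ∀ v, fderiv ℝ f p v = 0 → fderiv ℝ f' p v ≤ 0 := by
    intro v hv
    by_contra hc
    push Not at hc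
    set a := fderiv ℝ f' p v with ha
    set b := fderiv ℝ f' p w with hb
    have h1 := key (((|b| + 1) / a) • v - w) (by simp [hv, hw])
    have h2 : (|b| + 1) / a * a = |b| + 1 := by field_simp
    simp only [map_sub, map_smul, smul_eq_mul, ← ha, ← hb, h2] at h1
    linarith [le_abs_self b]
  have hker' : ∀ v, fderiv ℝ f p v = 0 → fderiv ℝ f' p v = 0 := by
    intro v hv
    have h1 := hker (-v) (by simp [hv])
    rw [map_neg] at h1
    exact le_antisymm (hker v hv) (by linarith)
  have heq : fderiv ℝ f' p = fderiv ℝ f' p w • fderiv ℝ f p := by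
    ext v
    have := hker' (v - fderiv ℝ f p v • w) (by simp [hw])
    simp only [map_sub, map_smul, smul_eq_mul] at this
    simp only [_root_.smul_apply, smul_eq_mul]
    linarith
  refine ⟨fderiv ℝ f' p w, lt_of_le_of_ne ?_ ?_, heq⟩
  · have := key (-w) (by simp [hw])
    rw [map_neg] at this
    linarith
  · intro h0
    rw [← h0, zero_smul] at heq
    exact h'.regular heq

theorem mem_closure_interior (h : IsLocalDefiningFunction Ω p f V) : p ∈ closure (interior Ω) := by
  obtain ⟨w, hw⟩ := h.exists_fderiv_eq_one
  have h1 := h.eventually_mem_interior (v := -w) (by simp [hw])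
  exact mem_closure_of_tendsto (tendsto_add_smul_nhdsGT p (-w)) h1

theorem uniqueDiffWithinAt (h : IsLocalDefiningFunction Ω p f V) :
    UniqueDiffWithinAt ℝ Ω p := by
  obtain ⟨w, hw⟩ := h.exists_fderiv_eq_one
  have hsub : {v | fderiv ℝ f p v < 0} ⊆ tangentConeAt ℝ Ω p := by
    intro v hv
    refine mem_tangentConeAt_of_seq (𝓝[>] (0 : ℝ)) (fun t => t⁻¹) (fun t => t • v) ?_ ?_ ?_
    · have := (tendsto_add_smul_nhdsGT 0 v)
      simpa using this
    · filter_upwards [h.eventually_mem_interior hv] with t ht using interior_subset ht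
    · refine tendsto_const_nhds.congr' ?_
      filter_upwards [self_mem_nhdsWithin] with t ht
      have ht : (0 : ℝ) < t := ht
      rw [smul_smul, inv_mul_cancel₀ ht.ne', one_smul]
  refine ⟨?_, subset_closure ((h.mem_iff p h.mem).mpr h.zero.le)⟩
  have hopen : IsOpen {v : Eucl n | fderiv ℝ f p v < 0} :=
    isOpen_lt (fderiv ℝ f p).continuous continuous_const
  have hspan : Submodule.span ℝ {v : Eucl n | fderiv ℝ f p v < 0} = ⊤ := by
    refine Submodule.eq_top_of_nonempty_interior' _ ⟨-w, ?_⟩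
    refine interior_mono Submodule.subset_span ?_
    rw [hopen.interior_eq]
    simp [hw]
  have htop : Submodule.span ℝ (tangentConeAt ℝ Ω p) = ⊤ :=
    top_le_iff.mp (hspan ▸ Submodule.span_mono hsub)
  rw [htop]
  exact dense_univ

/-- Every vector in the kernel of the differential of a defining function is tangent to the
boundary. -/
theorem mem_tangentConeAt_frontier (h : IsLocalDefiningFunction Ω p f V) {v : Eucl n}
    (hv : fderiv ℝ f p v = 0) : v ∈ tangentConeAt ℝ (frontier Ω) p := by
  obtain ⟨w, hw⟩ := h.exists_fderiv_eq_one
  -- Near `p` the zero set of `f` is the boundary.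
  have hreg : ∀ᶠ x in 𝓝 p, x ∈ V ∧ 0 < fderiv ℝ f x w := by
    have hc : ContinuousAt (fun x => fderiv ℝ f x w) p :=
      (((h.contDiffAt h.mem).fderiv_right (m := ∞) (by simp)).clm_apply
        contDiffAt_const).continuousAt
    exact (h.isOpen.eventually_mem h.mem).and (hc.eventually (lt_mem_nhds (by simp only [hw]; norm_num)))
  obtain ⟨r, hr, hball⟩ := Metric.eventually_nhds_iff.mp hreg
  have hV : ∀ x, dist x p < r → x ∈ V := fun x hx => (hball hx).1
  have key : ∀ k : ℕ, ∃ t τ : ℝ, 0 < t ∧ t < 1 / (k + 1) ∧ |τ| ≤ t * (1 / (k + 1)) ∧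
      p + (t • v + τ • w) ∈ frontier Ω := by
    intro k
    set δ : ℝ := 1 / ((k : ℝ) + 1) with hδ
    have hδ0 : 0 < δ := by positivity
    have h1 := eventually_lt_of_fderiv_neg (f := fun x => -f x) (v := v + δ • w)
      (h.differentiableAt h.mem).neg (by rw [fderiv_fun_neg]; simp [hv, hw, hδ0])
    have h2 := eventually_lt_of_fderiv_neg (v := v + (-δ) • w) (h.differentiableAt h.mem)
      (by simp [hv, hw, hδ0])
    set M := ‖v‖ + ‖w‖ + 1 with hM
    have hM0 : 0 < M := by positivity
    have h3 : ∀ᶠ t : ℝ in 𝓝[>] 0, t < min δ (r / M) :=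
      nhdsWithin_le_nhds (gt_mem_nhds (lt_min hδ0 (div_pos hr hM0)))
    obtain ⟨t, ⟨⟨ht1, ht2⟩, ht3⟩, ht0⟩ :=
      (((h1.and h2).and h3).and self_mem_nhdsWithin).exists
    have ht0 : 0 < t := ht0
    have htr : t * M < r := by
      rw [← lt_div_iff₀ hM0]; exact lt_of_lt_of_le ht3 (min_le_right _ _)
    have hδ1 : δ ≤ 1 := by
      rw [hδ, div_le_one (by positivity)]; linarith [Nat.cast_nonneg (α := ℝ) k]
    have hnear : ∀ τ : ℝ, |τ| ≤ t * δ → dist (p + (t • v + τ • w)) p < r := by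
      intro τ hτ
      rw [dist_eq_norm, add_sub_cancel_left]
      calc ‖t • v + τ • w‖ ≤ t * ‖v‖ + |τ| * ‖w‖ := by
            refine (norm_add_le _ _).trans ?_
            rw [norm_smul, norm_smul, Real.norm_eq_abs, Real.norm_eq_abs, abs_of_pos ht0]
        _ ≤ t * ‖v‖ + (t * 1) * ‖w‖ := by gcongr; exact hτ.trans (by gcongr)
        _ ≤ t * M := by rw [hM]; nlinarith
        _ < r := htr
    have hcont : ContinuousOn (fun τ : ℝ => f (p + (t • v + τ • w))) (Set.Icc (-(t * δ)) (t * δ)) := by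
      intro τ hτ
      have hx := hV _ (hnear τ (abs_le.mpr hτ))
      have hc : ContinuousAt (fun τ : ℝ => p + (t • v + τ • w)) τ := by fun_prop
      exact (ContinuousAt.comp (f := fun τ : ℝ => p + (t • v + τ • w))
        (h.contDiffAt hx).continuousAt hc).continuousWithinAt
    have htδ : 0 < t * δ := mul_pos ht0 hδ0
    have e1 : p + t • (v + δ • w) = p + (t • v + (t * δ) • w) := by module
    have e2 : p + t • (v + (-δ) • w) = p + (t • v + (-(t * δ)) • w) := by module
    rw [e1, h.zero] at ht1
    rw [e2, h.zero] at ht2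
    obtain ⟨τ, hτ, hτ0⟩ := intermediate_value_Icc (by linarith) hcont
      (show (0 : ℝ) ∈ Set.Icc _ _ from ⟨ht2.le, by linarith⟩)
    have hτ' := abs_le.mpr hτ
    refine ⟨t, τ, ht0, lt_of_lt_of_le ht3 (min_le_left _ _), hτ', ?_⟩
    refine h.mem_frontier_of_eq_zero (hV _ (hnear τ hτ')) hτ0 fun h0 => ?_
    have := (hball (hnear τ hτ')).2
    rw [h0] at this
    exact lt_irrefl _ this
  choose t τ ht0 htk hτ hmem using key
  have hlim : Tendsto (fun k : ℕ => (1 : ℝ) / (k + 1)) atTop (𝓝 0) :=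
    tendsto_one_div_add_atTop_nhds_zero_nat
  have hquot : Tendsto (fun k => (t k)⁻¹ * τ k) atTop (𝓝 0) := by
    refine squeeze_zero_norm (fun k => ?_) hlim
    rw [Real.norm_eq_abs, abs_mul, abs_of_pos (inv_pos.mpr (ht0 k)), inv_mul_le_iff₀ (ht0 k)]
    exact hτ k
  have ht : Tendsto t atTop (𝓝 0) :=
    squeeze_zero (fun k => (ht0 k).le) (fun k => (htk k).le) hlim
  have hcd : Tendsto (fun k => v + ((t k)⁻¹ * τ k) • w) atTop (𝓝 v) := by
    simpa using tendsto_const_nhds.add (hquot.smul_const w)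
  refine mem_tangentConeAt_of_seq atTop (fun k => (t k)⁻¹) (fun k => t k • v + τ k • w) ?_
    (Eventually.of_forall hmem) ?_
  · have h1 : Tendsto (fun k => t k • (v + ((t k)⁻¹ * τ k) • w)) atTop (𝓝 0) := by
      simpa using ht.smul hcd
    refine h1.congr fun k => ?_
    rw [smul_add, smul_smul, mul_inv_cancel_left₀ (ht0 k).ne']
  · refine hcd.congr fun k => ?_
    rw [smul_add, smul_smul, smul_smul, inv_mul_cancel₀ (ht0 k).ne', one_smul]

end IsLocalDefiningFunction

theorem HasSmoothBoundary.uniqueDiffOn (hbd : HasSmoothBoundary Ω) :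
    UniqueDiffOn ℝ Ω := by
  intro p hp
  by_cases hpi : p ∈ interior Ω
  · exact uniqueDiffWithinAt_of_mem_nhds (mem_interior_iff_mem_nhds.mp hpi)
  · obtain ⟨f, V, h⟩ := hbd p ⟨subset_closure hp, hpi⟩
    exact h.uniqueDiffWithinAt

theorem HasSmoothBoundary.subset_closure_interior (hbd : HasSmoothBoundary Ω) :
    Ω ⊆ closure (interior Ω) := by
  intro p hp
  by_cases hpi : p ∈ interior Ω
  · exact subset_closure hpi
  · obtain ⟨f, V, h⟩ := hbd p ⟨subset_closure hp, hpi⟩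
    exact h.mem_closure_interior

end Domain

/-! ### A divergence inequality -/

section Divergence

open Filter Topology MeasureTheory

variable {n : ℕ} {Ω V : Set (Eucl n)} {f : Eucl n → ℝ}

/-- The Euclidean divergence of a vector field which is differentiable within `Ω`. -/
noncomputable def divergenceWithin (Ω : Set (Eucl n)) (Y : Eucl n → Eucl n) (p : Eucl n) : ℝ :=
  ∑ i, fderivWithin ℝ Y Ω p (stdVec i) i

theorem divergenceWithin_eq_of_mem_interior {Y : Eucl n → Eucl n} {p : Eucl n}
    (hp : p ∈ interior Ω) : divergenceWithin Ω Y p = ∑ i, fderiv ℝ Y p (stdVec i) i := by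
  rw [divergenceWithin, fderivWithin_of_mem_nhds (mem_interior_iff_mem_nhds.mp hp)]

theorem continuousOn_divergenceWithin (hu : UniqueDiffOn ℝ Ω) {Y : Eucl n → Eucl n}
    (hY : ContDiffOn ℝ 1 Y Ω) : ContinuousOn (divergenceWithin Ω Y) Ω := by
  have h1 := hY.continuousOn_fderivWithin hu le_rfl
  refine continuousOn_finsetSum _ fun i _ => ?_
  have h2 : ContinuousOn (fun p => fderivWithin ℝ Y Ω p (stdVec i)) Ω :=
    h1.clm_apply continuousOn_const
  exact (EuclideanSpace.proj (𝕜 := ℝ) i).continuous.comp_continuousOn h2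

theorem integrableOn_divergenceWithin (hΩ : IsCompact Ω) (hu : UniqueDiffOn ℝ Ω)
    {Y : Eucl n → Eucl n} (hY : ContDiffOn ℝ 1 Y Ω) :
    IntegrableOn (divergenceWithin Ω Y) (interior Ω) :=
  ((continuousOn_divergenceWithin hu hY).integrableOn_compact hΩ).mono_set interior_subset

/-- The divergence of a compactly supported field has integral zero. -/
theorem integral_divergence_eq_zero {G : Eucl n → Eucl n} (hG : ContDiff ℝ 1 G)
    (hc : HasCompactSupport G) :
    Integrable (fun x => ∑ i, fderiv ℝ G x (stdVec i) i) ∧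
      ∫ x, ∑ i, fderiv ℝ G x (stdVec i) i = 0 := by
  let π : Fin n → Eucl n →L[ℝ] ℝ := fun i => EuclideanSpace.proj i
  have hGi : ∀ i, ContDiff ℝ 1 (fun x => π i (G x)) := fun i => (π i).contDiff.comp hG
  have hci : ∀ i, HasCompactSupport (fun x => π i (G x)) := fun i =>
    hc.comp_left (g := π i) (map_zero _)
  have hfd : ∀ i x, fderiv ℝ (fun x => π i (G x)) x (stdVec i) = fderiv ℝ G x (stdVec i) i := by
    intro i x
    have h : fderiv ℝ (fun x => π i (G x)) x = _ :=
      ((π i).hasFDerivAt.comp x (hG.differentiable one_ne_zero x).hasFDerivAt).fderiv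
    rw [h]; rfl
  have hint : ∀ i, Integrable (fun x => fderiv ℝ (fun x => π i (G x)) x (stdVec i)) := by
    intro i
    refine Continuous.integrable_of_hasCompactSupport ?_ ?_
    · exact ((hGi i).continuous_fderiv one_ne_zero).clm_apply continuous_const
    · exact (hci i).fderiv_apply ℝ (stdVec i)
  have hz : ∀ i, ∫ x, fderiv ℝ (fun x => π i (G x)) x (stdVec i) = 0 := by
    intro i
    have := integral_mul_fderiv_eq_neg_fderiv_mul_of_integrable (μ := volume)
      (f := fun _ : Eucl n => (1 : ℝ)) (g := fun x => π i (G x)) (v := stdVec i)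
      (by simp) (by simpa using hint i)
      (by simpa using (hGi i).continuous.integrable_of_hasCompactSupport (hci i))
      (fun x _ => differentiableAt_const _) (fun x _ => (hGi i).differentiable one_ne_zero x)
    simpa using this
  simp only [hfd] at hint hz
  refine ⟨integrable_finsetSum _ fun i _ => hint i, ?_⟩
  rw [integral_finsetSum _ fun i _ => hint i]
  exact Finset.sum_eq_zero fun i _ => hz i

/-- The smooth cutoff functions `T(-c f - 1)`, `c → ∞`, which vanish where `f ≥ -1/c` and are equal
to `1` where `f ≤ -2/c`. -/
noncomputable def boundaryCutoff (f : Eucl n → ℝ) (c : ℝ) (x : Eucl n) : ℝ :=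
  Real.smoothTransition (-c * f x - 1)

theorem contDiffAt_boundaryCutoff {x : Eucl n} (hf : ContDiffAt ℝ ∞ f x) (c : ℝ) :
    ContDiffAt ℝ ∞ (boundaryCutoff f c) x :=
  Real.smoothTransition.contDiffAt.comp x ((contDiffAt_const.mul hf).sub contDiffAt_const)

/-- The cutoff decreases along directions in which `f` does not increase. Where `f ≤ -2/c` the cutoff
is constant to first order, so that nothing has to be assumed there. -/
theorem fderiv_boundaryCutoff_nonneg {x v : Eucl n} (hf : DifferentiableAt ℝ f x) {c : ℝ}
    (hc : 0 < c) (h : -2 < c * f x → fderiv ℝ f x v ≤ 0) :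
    0 ≤ fderiv ℝ (boundaryCutoff f c) x v := by
  set a := -c * f x - 1 with ha
  have hT : DifferentiableAt ℝ Real.smoothTransition a :=
    Real.smoothTransition.contDiffAt.differentiableAt (n := 1) one_ne_zero
  have h1 : HasFDerivAt (boundaryCutoff f c)
      (deriv Real.smoothTransition a • ((-c) • fderiv ℝ f x)) x := by
    have h2 : HasFDerivAt (fun y => -c * f y - 1) ((-c) • fderiv ℝ f x) x :=
      (hf.hasFDerivAt.const_mul (-c)).sub_const 1
    exact hT.hasDerivAt.comp_hasFDerivAt x h2
  rw [h1.fderiv]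
  simp only [_root_.smul_apply, smul_eq_mul]
  by_cases h3 : -2 < c * f x
  · refine mul_nonneg Real.smoothTransition.monotone.deriv_nonneg ?_
    nlinarith [h h3]
  · push Not at h3
    have h4 : deriv Real.smoothTransition a = 0 := by
      refine IsLocalMax.deriv_eq_zero (Eventually.of_forall fun y => ?_)
      rw [Real.smoothTransition.one_of_one_le (x := a) (by linarith)]
      exact Real.smoothTransition.le_one y
    rw [h4, zero_mul]

/-- If a field supported in `V` does not point outwards near the boundary of `{f ≤ 0}`, then cutting
it off along the level sets of `f` shows that the integral of its divergence is not positive. -/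
theorem integral_divergenceWithin_nonpos_of_cutoff (hΩ : IsCompact Ω) (hu : UniqueDiffOn ℝ Ω)
    (hV : IsOpen V) (hf : ContDiffOn ℝ ∞ f V) (hfΩ : ∀ x ∈ V, f x < 0 → x ∈ interior Ω)
    (hfi : ∀ x ∈ V, x ∈ interior Ω → f x < 0) {Y : Eucl n → Eucl n} (hY : ContDiffOn ℝ 1 Y Ω)
    (hYV : tsupport Y ⊆ V) {ε : ℝ} (hε : 0 < ε)
    (hin : ∀ x ∈ V, x ∈ interior Ω → -ε < f x → fderiv ℝ f x (Y x) ≤ 0) :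
    ∫ x in interior Ω, divergenceWithin Ω Y x ≤ 0 := by
  have hfx : ∀ x ∈ V, ContDiffAt ℝ ∞ f x := fun x hx => hf.contDiffAt (hV.mem_nhds hx)
  have hYx : ∀ x ∈ interior Ω, ContDiffAt ℝ 1 Y x := fun x hx =>
    hY.contDiffAt (mem_interior_iff_mem_nhds.mp hx)
  have hYt : ∀ x, x ∉ tsupport Y → Y =ᶠ[𝓝 x] 0 := fun x hx =>
    notMem_tsupport_iff_eventuallyEq.mp hx
  have hint := integrableOn_divergenceWithin hΩ hu hY
  have hdiv0 : ∀ x ∈ interior Ω, x ∉ V → divergenceWithin Ω Y x = 0 := by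
    intro x hx hxV
    rw [divergenceWithin_eq_of_mem_interior hx,
      (hYt x fun h => hxV (hYV h)).fderiv_eq]
    simp
  have hmeas : ∀ c, AEStronglyMeasurable
      (fun x => boundaryCutoff f c x * divergenceWithin Ω Y x) (volume.restrict (interior Ω)) := by
    intro c
    refine ContinuousOn.aestronglyMeasurable ?_ isOpen_interior.measurableSet
    intro x hx
    refine ContinuousAt.continuousWithinAt ?_
    have hdc : ContinuousAt (divergenceWithin Ω Y) x :=
      (continuousOn_divergenceWithin hu hY).continuousAt (mem_interior_iff_mem_nhds.mp hx)
    by_cases hxV : x ∈ V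
    · exact (contDiffAt_boundaryCutoff (hfx x hxV) c).continuousAt.mul hdc
    · have h0 : (fun x => boundaryCutoff f c x * divergenceWithin Ω Y x) =ᶠ[𝓝 x] fun _ => 0 := by
        have h1 := (hYt x fun h => hxV (hYV h)).eventuallyEq_nhds
        filter_upwards [h1, isOpen_interior.mem_nhds hx] with y hy hyΩ
        rw [divergenceWithin_eq_of_mem_interior hyΩ, hy.fderiv_eq]
        simp
      exact continuousAt_const.congr h0.symm
  have hbound : ∀ c x, ‖boundaryCutoff f c x * divergenceWithin Ω Y x‖
      ≤ ‖divergenceWithin Ω Y x‖ := by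
    intro c x
    rw [norm_mul, Real.norm_eq_abs, boundaryCutoff, abs_of_nonneg (Real.smoothTransition.nonneg _)]
    exact mul_le_of_le_one_left (norm_nonneg _) (Real.smoothTransition.le_one _)
  -- The weighted divergences, for large `c`.
  have hneg : ∀ c : ℝ, 2 / ε ≤ c →
      ∫ x in interior Ω, boundaryCutoff f c x * divergenceWithin Ω Y x ≤ 0 := by
    intro c hc
    have hc0 : 0 < c := lt_of_lt_of_le (by positivity) hc
    classical
    set G : Eucl n → Eucl n := (interior Ω).indicator fun x => boundaryCutoff f c x • Y x with hG
    have hGin : ∀ x ∈ interior Ω, G =ᶠ[𝓝 x] fun x => boundaryCutoff f c x • Y x := fun x hx => by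
      filter_upwards [isOpen_interior.mem_nhds hx] with y hy using Set.indicator_of_mem hy _
    have hG1 : ∀ x, x ∉ tsupport Y → G =ᶠ[𝓝 x] 0 := fun x hx => by
      filter_upwards [hYt x hx] with y hy
      simp [hG, Set.indicator, hy]
    have hG2 : ∀ x ∈ V, -1 < c * f x → G =ᶠ[𝓝 x] 0 := fun x hx hx1 => by
      have : ∀ᶠ y in 𝓝 x, -1 < c * f y :=
        ((hfx x hx).continuousAt.const_mul c).eventually (lt_mem_nhds hx1)
      filter_upwards [this] with y hy
      have : boundaryCutoff f c y = 0 := Real.smoothTransition.zero_of_nonpos (by linarith)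
      simp [hG, Set.indicator, this]
    have hG3 : ∀ x, x ∉ interior Ω → G =ᶠ[𝓝 x] 0 := fun x hx => by
      by_cases hxV : x ∈ V
      · refine hG2 x hxV ?_
        have : 0 ≤ f x := le_of_not_gt fun h => hx (hfΩ x hxV h)
        nlinarith
      · exact hG1 x fun h => hxV (hYV h)
    have hGC : ContDiff ℝ 1 G := by
      rw [contDiff_iff_contDiffAt]
      intro x
      by_cases hx : x ∈ interior Ω
      · by_cases hxV : x ∈ V
        · refine ContDiffAt.congr_of_eventuallyEq ?_ (hGin x hx)
          exact ((contDiffAt_boundaryCutoff (hfx x hxV) c).of_le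
            (WithTop.coe_le_coe.mpr le_top)).smul (hYx x hx)
        · exact contDiffAt_const.congr_of_eventuallyEq (hG1 x fun h => hxV (hYV h))
      · exact contDiffAt_const.congr_of_eventuallyEq (hG3 x hx)
    have hGs : HasCompactSupport G := by
      refine HasCompactSupport.intro hΩ fun x hx => ?_
      exact Set.indicator_of_notMem (fun h => hx (interior_subset h)) _
    obtain ⟨hGi, hGz⟩ := integral_divergence_eq_zero hGC hGs
    have hGz' : ∫ x in interior Ω, ∑ i, fderiv ℝ G x (stdVec i) i = 0 := by
      rw [setIntegral_eq_integral_of_forall_compl_eq_zero, hGz]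
      intro x hx
      rw [(hG3 x hx).fderiv_eq]
      simp
    rw [← hGz']
    have hle : ∀ x ∈ interior Ω, boundaryCutoff f c x * divergenceWithin Ω Y x
        ≤ ∑ i, fderiv ℝ G x (stdVec i) i := by
      intro x hx
      by_cases hxV : x ∈ V
      · have hYd := (hYx x hx).differentiableAt one_ne_zero
        have hcd : DifferentiableAt ℝ (boundaryCutoff f c) x :=
          (contDiffAt_boundaryCutoff (hfx x hxV) c).differentiableAt (by simp)
        have h1 : HasFDerivAt (fun x => boundaryCutoff f c x • Y x) _ x :=
          hcd.hasFDerivAt.smul hYd.hasFDerivAt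
        have h2 : ∑ i, fderiv ℝ (boundaryCutoff f c) x (stdVec i) * Y x i
            = fderiv ℝ (boundaryCutoff f c) x (Y x) := by
          conv_rhs => rw [← sum_smul_stdVec (Y x), map_sum]
          simp [mul_comm]
        rw [(hGin x hx).fderiv_eq, h1.fderiv, divergenceWithin_eq_of_mem_interior hx]
        simp only [_root_.add_apply, _root_.smul_apply, ContinuousLinearMap.smulRight_apply,
          PiLp.add_apply, PiLp.smul_apply, smul_eq_mul, Finset.sum_add_distrib, ← Finset.mul_sum,
          h2]
        have h3 := fderiv_boundaryCutoff_nonneg (v := Y x)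
          ((hfx x hxV).differentiableAt (by simp)) hc0 (fun h4 => hin x hxV hx (by
            have : 2 ≤ c * ε := by rwa [div_le_iff₀ hε] at hc
            by_contra h5
            push Not at h5
            nlinarith))
        linarith
      · rw [hdiv0 x hx hxV, (hG1 x fun h => hxV (hYV h)).fderiv_eq]
        simp
    refine setIntegral_mono_on ?_ hGi.integrableOn isOpen_interior.measurableSet hle
    refine Integrable.mono' hint.norm ?_ ?_
    · exact hmeas c
    · exact Eventually.of_forall (hbound c)
  have hlim : Tendsto (fun k : ℕ => ∫ x in interior Ω, boundaryCutoff f k x * divergenceWithin Ω Y x)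
      atTop (𝓝 (∫ x in interior Ω, divergenceWithin Ω Y x)) := by
    refine tendsto_integral_of_dominated_convergence _ (fun k => hmeas k) hint.norm
      (fun k => Eventually.of_forall (hbound k)) ?_
    filter_upwards [ae_restrict_mem isOpen_interior.measurableSet] with x hx
    by_cases hxV : x ∈ V
    · have h0 := hfi x hxV hx
      refine tendsto_const_nhds.congr' ?_
      filter_upwards [(tendsto_natCast_atTop_atTop (R := ℝ)).eventually_ge_atTop (2 / (-f x))]
        with k hk
      rw [div_le_iff₀ (by linarith)] at hk
      rw [boundaryCutoff, Real.smoothTransition.one_of_one_le (by linarith), one_mul]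
    · simp [hdiv0 x hx hxV]
  refine le_of_tendsto hlim ?_
  filter_upwards [(tendsto_natCast_atTop_atTop (R := ℝ)).eventually_ge_atTop (2 / ε)] with k hk
    using hneg k hk

/-- The field `Y` does not point out of `Ω` at boundary points. -/
def IsInwardField (Ω : Set (Eucl n)) (Y : Eucl n → Eucl n) : Prop :=
  ∀ q ∈ frontier Ω, ∀ f V, IsLocalDefiningFunction Ω q f V → fderiv ℝ f q (Y q) ≤ 0

theorem IsInwardField.smul {Y : Eucl n → Eucl n} (h : IsInwardField Ω Y) {φ : Eucl n → ℝ}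
    (hφ : ∀ x, 0 ≤ φ x) : IsInwardField Ω fun x => φ x • Y x := by
  intro q hq f V hf
  rw [map_smul, smul_eq_mul]
  exact mul_nonpos_of_nonneg_of_nonpos (hφ q) (h q hq f V hf)

/-- The differential of a local defining function is bounded below in a fixed direction near the
boundary point. -/
theorem IsLocalDefiningFunction.exists_ball {p : Eucl n} (h : IsLocalDefiningFunction Ω p f V) :
    ∃ w, ∃ r > 0, ∀ x ∈ Metric.ball p r, x ∈ V ∧ 0 < fderiv ℝ f x w := by
  obtain ⟨w, hw⟩ := h.exists_fderiv_eq_one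
  have hc : ContinuousAt (fun x => fderiv ℝ f x w) p :=
    (((h.contDiffAt h.mem).fderiv_right (m := ∞) (by simp)).clm_apply
      contDiffAt_const).continuousAt
  obtain ⟨r, hr, hball⟩ := Metric.eventually_nhds_iff.mp ((h.isOpen.eventually_mem h.mem).and
    (hc.eventually (lt_mem_nhds (by simp only [hw]; norm_num : (0 : ℝ) < _))))
  exact ⟨w, r, hr, fun x hx => hball hx⟩

/-- The divergence inequality for fields supported near a boundary point. The field is perturbed
by a small multiple of a field pointing strictly inwards, so that it points inwards not only along
the boundary but in a neighbourhood of it. -/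
theorem IsLocalDefiningFunction.exists_divergence_nhds (hΩ : IsCompact Ω)
    (hu : UniqueDiffOn ℝ Ω) {p : Eucl n} (h : IsLocalDefiningFunction Ω p f V) :
    ∃ r > 0, ∀ Y : Eucl n → Eucl n, ContDiffOn ℝ 1 Y Ω → tsupport Y ⊆ Metric.ball p r →
      IsInwardField Ω Y → ∫ x in interior Ω, divergenceWithin Ω Y x ≤ 0 := by
  obtain ⟨w, r, hr, hball⟩ := h.exists_ball
  let φ : ContDiffBump p := ⟨r / 3, r / 2, by positivity, by linarith⟩
  have hφs : tsupport φ ⊆ Metric.ball p r := by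
    rw [φ.tsupport_eq]; exact Metric.closedBall_subset_ball (by change r / 2 < r; linarith)
  have hφ1 : ∀ x ∈ Metric.ball p (r / 3), φ x = 1 := fun x hx =>
    φ.one_of_mem_closedBall (Metric.ball_subset_closedBall hx)
  refine ⟨r / 3, by positivity, fun Y hY hYs hin => ?_⟩
  have hW : ContDiff ℝ 1 (fun x => φ x • w) := φ.contDiff.smul contDiff_const
  have hsub : Metric.ball p (r / 3) ⊆ Metric.ball p r := Metric.ball_subset_ball (by linarith)
  -- In the ball, the boundary is the zero set of `f`.
  have hlt : ∀ x ∈ Metric.ball p r, x ∈ interior Ω → f x < 0 := by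
    intro x hx hxi
    have hle := (h.mem_iff x (hball x hx).1).mp (interior_subset hxi)
    refine lt_of_le_of_ne hle fun h0 => ?_
    refine (h.mem_frontier_of_eq_zero (hball x hx).1 h0 fun hd => ?_).2 hxi
    have := (hball x hx).2
    rw [hd] at this
    exact lt_irrefl _ this
  have hpert : ∀ δ : ℝ, 0 < δ → ∫ x in interior Ω, divergenceWithin Ω Y x
      ≤ δ * ∫ x in interior Ω, divergenceWithin Ω (fun x => φ x • w) x := by
    intro δ hδ
    set Z : Eucl n → Eucl n := fun x => Y x - δ • (φ x • w) with hZ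
    have hZC : ContDiffOn ℝ 1 Z Ω := hY.sub (hW.const_smul δ).contDiffOn
    have hZs : tsupport Z ⊆ Metric.ball p r := by
      refine (tsupport_sub _ _).trans (Set.union_subset (hYs.trans hsub) ?_)
      refine (closure_mono ?_).trans hφs
      intro x hx hφ0
      simp [hφ0] at hx
    -- The set where `Z` fails to point strictly inwards is compact and away from the boundary.
    obtain ⟨ε, hε, hεZ⟩ : ∃ ε > 0, ∀ x ∈ tsupport Y, x ∈ Ω → -ε < f x →
        fderiv ℝ f x (Z x) ≤ 0 := by
      set A : Set (Eucl n) := tsupport Y ∩ Ω with hA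
      have hAc : IsCompact A := hΩ.inter_left (isClosed_tsupport Y)
      have hAb : ∀ x ∈ A, x ∈ Metric.ball p (r / 3) := fun x hx => hYs hx.1
      have hAV : ∀ x ∈ A, x ∈ V := fun x hx => (hball x (hsub (hAb x hx))).1
      have hcont : ContinuousOn (fun x => fderiv ℝ f x (Z x)) A := by
        refine ContinuousOn.clm_apply ?_ (hZC.continuousOn.mono Set.inter_subset_right)
        intro x hx
        exact ((h.contDiffAt (hAV x hx)).fderiv_right
          (m := ∞) (by simp)).continuousAt.continuousWithinAt
      have hfc : ContinuousOn f A := fun x hx =>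
        (h.contDiffAt (hAV x hx)).continuousAt.continuousWithinAt
      set Q := A ∩ (fun x => fderiv ℝ f x (Z x)) ⁻¹' Set.Ici 0 with hQ
      have hQc : IsCompact Q :=
        hAc.of_isClosed_subset (hcont.preimage_isClosed_of_isClosed hAc.isClosed isClosed_Ici)
          Set.inter_subset_left
      have hQf : ∀ x ∈ Q, f x < 0 := by
        intro x hx
        have hxV := hAV x hx.1
        refine lt_of_le_of_ne ((h.mem_iff x hxV).mp hx.1.2) fun h0 => ?_
        have hpos := (hball x (hsub (hAb x hx.1))).2
        have hne : fderiv ℝ f x ≠ 0 := fun hd => by rw [hd] at hpos; exact lt_irrefl _ hpos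
        have h1 := hin x (h.mem_frontier_of_eq_zero hxV h0 hne) f V (h.congr_point hxV h0 hne)
        have h2 : 0 ≤ fderiv ℝ f x (Z x) := hx.2
        simp only [hZ, hφ1 x (hAb x hx.1), one_smul, map_sub, map_smul, smul_eq_mul] at h2
        nlinarith
      rcases Q.eq_empty_or_nonempty with hQe | hQn
      · refine ⟨1, one_pos, fun x hxY hxΩ _ => ?_⟩
        by_contra hc
        have : x ∈ Q := ⟨⟨hxY, hxΩ⟩, (not_le.mp hc).le⟩
        rw [hQe] at this
        exact this
      · obtain ⟨x0, hx0, hmax⟩ := hQc.exists_isMaxOn hQn (hfc.mono Set.inter_subset_left)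
        refine ⟨-f x0, by linarith [hQf x0 hx0], fun x hxY hxΩ hxf => ?_⟩
        by_contra hc
        have hxQ : x ∈ Q := ⟨⟨hxY, hxΩ⟩, (not_le.mp hc).le⟩
        have : f x ≤ f x0 := hmax hxQ
        linarith
    have hZint := integral_divergenceWithin_nonpos_of_cutoff hΩ hu Metric.isOpen_ball
      (h.smooth.mono fun x hx => (hball x hx).1)
      (fun x hx h0 => h.mem_interior (hball x hx).1 h0) hlt hZC hZs hε (fun x hx hxi hxf => by
        by_cases hxY : x ∈ tsupport Y
        · exact hεZ x hxY (interior_subset hxi) hxf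
        · have h0 : Y x = 0 := image_eq_zero_of_notMem_tsupport hxY
          simp only [hZ, h0, zero_sub, map_neg, map_smul, smul_eq_mul]
          have := mul_nonneg hδ.le (mul_nonneg (φ.nonneg (x := x)) (hball x hx).2.le)
          linarith)
    have hdivZ : ∀ x ∈ interior Ω, divergenceWithin Ω Z x
        = divergenceWithin Ω Y x - δ * divergenceWithin Ω (fun x => φ x • w) x := by
      intro x hx
      have h1 : DifferentiableAt ℝ Y x :=
        (hY.contDiffAt (mem_interior_iff_mem_nhds.mp hx)).differentiableAt one_ne_zero
      have h2 : DifferentiableAt ℝ (fun x => φ x • w) x := hW.differentiable one_ne_zero x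
      have h3 : HasFDerivAt Z _ x := h1.hasFDerivAt.sub (h2.hasFDerivAt.const_smul δ)
      simp only [divergenceWithin_eq_of_mem_interior hx]
      rw [h3.fderiv]
      simp [Finset.sum_sub_distrib, Finset.mul_sum]
    rw [setIntegral_congr_fun isOpen_interior.measurableSet hdivZ,
      integral_sub (integrableOn_divergenceWithin hΩ hu hY)
        ((integrableOn_divergenceWithin hΩ hu hW.contDiffOn).const_mul δ),
      integral_const_mul] at hZint
    linarith
  -- Let the size of the perturbation tend to zero.
  by_contra hc
  push Not at hc
  set I := ∫ x in interior Ω, divergenceWithin Ω Y x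
  set J := ∫ x in interior Ω, divergenceWithin Ω (fun x => φ x • w) x
  have hJ : 0 < J := by have := hpert 1 one_pos; linarith
  have := hpert (I / (2 * J)) (by positivity)
  have h2 : I / (2 * J) * J = I / 2 := by field_simp
  linarith

/-- The divergence inequality: if a field which is continuously differentiable up to the boundary
does not point outwards, the integral of its divergence is not positive. -/
theorem integral_divergenceWithin_nonpos (hΩ : IsCompact Ω) (hbd : HasSmoothBoundary Ω)
    {Y : Eucl n → Eucl n} (hY : ContDiffOn ℝ 1 Y Ω) (hin : IsInwardField Ω Y) :
    ∫ x in interior Ω, divergenceWithin Ω Y x ≤ 0 := by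
  have hu := hbd.uniqueDiffOn
  have hloc : ∀ p ∈ Ω, ∃ W : Set (Eucl n), IsOpen W ∧ p ∈ W ∧ ∀ Y : Eucl n → Eucl n,
      ContDiffOn ℝ 1 Y Ω → tsupport Y ⊆ W → IsInwardField Ω Y →
        ∫ x in interior Ω, divergenceWithin Ω Y x ≤ 0 := by
    intro p hp
    by_cases hpi : p ∈ interior Ω
    · refine ⟨interior Ω, isOpen_interior, hpi, fun Y hY hYs _ => ?_⟩
      exact integral_divergenceWithin_nonpos_of_cutoff (f := fun _ => -1) (ε := 1) hΩ hu
        isOpen_interior contDiffOn_const (fun x hx _ => hx) (fun _ _ _ => by norm_num) hY hYs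
        one_pos (fun x _ _ hx => by simp at hx)
    · obtain ⟨f, V, h⟩ := hbd p ⟨subset_closure hp, hpi⟩
      obtain ⟨r, hr, hW⟩ := h.exists_divergence_nhds hΩ hu
      exact ⟨Metric.ball p r, Metric.isOpen_ball, Metric.mem_ball_self hr, hW⟩
  choose! W hWo hpW hW using hloc
  obtain ⟨t, htΩ, hcov⟩ := hΩ.elim_nhds_subcover W fun p hp => (hWo p hp).mem_nhds (hpW p hp)
  obtain ⟨ρ, hρ⟩ := SmoothPartitionOfUnity.exists_isSubordinate (modelWithCornersSelf ℝ (Eucl n))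
    hΩ.isClosed (fun i : t => W i) (fun i => hWo i (htΩ i i.2)) (fun x hx => by
      obtain ⟨i, hi, hxi⟩ := Set.mem_iUnion₂.mp (hcov hx)
      exact Set.mem_iUnion.mpr ⟨⟨i, hi⟩, hxi⟩)
  have hρC : ∀ i, ContDiff ℝ 1 (ρ i) := fun i =>
    ((ρ i).contMDiff.contDiff).of_le (WithTop.coe_le_coe.mpr le_top)
  have hYC : ∀ i, ContDiffOn ℝ 1 (fun x => ρ i x • Y x) Ω := fun i =>
    (hρC i).contDiffOn.smul hY
  have hsum : ∀ x ∈ Ω, ∑ i, ρ i x = 1 := fun x hx => by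
    rw [← finsum_eq_sum_of_fintype]; exact ρ.sum_eq_one hx
  have hdiv : ∀ x ∈ interior Ω, divergenceWithin Ω Y x
      = ∑ i, divergenceWithin Ω (fun x => ρ i x • Y x) x := by
    intro x hx
    have h1 : Y =ᶠ[𝓝 x] fun y => ∑ i, ρ i y • Y y := by
      filter_upwards [mem_interior_iff_mem_nhds.mp hx] with y hy
      rw [← Finset.sum_smul, hsum y hy, one_smul]
    simp only [divergenceWithin_eq_of_mem_interior hx]
    rw [h1.fderiv_eq, fderiv_fun_sum fun i _ =>
      ((hYC i).contDiffAt (mem_interior_iff_mem_nhds.mp hx)).differentiableAt one_ne_zero,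
      Finset.sum_comm]
    refine Finset.sum_congr rfl fun i _ => ?_
    rw [_root_.sum_apply, WithLp.ofLp_sum, Finset.sum_apply]
  rw [setIntegral_congr_fun isOpen_interior.measurableSet hdiv,
    integral_finsetSum _ fun i _ => integrableOn_divergenceWithin hΩ hu (hYC i)]
  refine Finset.sum_nonpos fun i _ => ?_
  refine hW i (htΩ i i.2) _ (hYC i) ?_ (hin.smul fun x => ρ.nonneg i x)
  exact (tsupport_smul_subset_left (ρ i) Y).trans (hρ i)

end Divergence

/-! ### Geometry of the boundary -/

section BoundaryGeometry

open Filter Topology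

variable {n : ℕ} {g : Eucl n → Eucl n →L[ℝ] Eucl n →L[ℝ] ℝ} {e : Fin n → Eucl n → Eucl n}
  {Ω U : Set (Eucl n)} {p : Eucl n} {ν : Eucl n → Eucl n}

/-- An extension of the outward unit normal `ν` along `∂Ω` to a smooth unit field near the boundary
point `p`, with the properties of its covariant derivative that hold at `p`: the derivative is
tangential, and symmetric on tangent vectors (the second fundamental form). -/
structure IsNormalExtension (g : Eucl n → Eucl n →L[ℝ] Eucl n →L[ℝ] ℝ) (Ω : Set (Eucl n))
    (ν : Eucl n → Eucl n) (p : Eucl n) (η : Eucl n → Eucl n) : Prop where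
  smooth : ContDiffAt ℝ ∞ η p
  eq_normal : ∀ᶠ q in 𝓝[frontier Ω] p, ν q = η q
  unit : g p (η p) (η p) = 1
  tangent : ∀ τ, g p (η p) τ = 0 → τ ∈ tangentConeAt ℝ (frontier Ω) p
  covDeriv_tangential : ∀ ξ, g p (covDeriv g η p ξ) (η p) = 0
  symm : ∀ τ τ', g p (η p) τ = 0 → g p (η p) τ' = 0 →
    g p (covDeriv g η p τ) τ' = g p (covDeriv g η p τ') τ

theorem exists_isNormalExtension (hΩ : IsClosed Ω) (hbd : HasSmoothBoundary Ω) (hU : IsOpen U)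
    (hΩU : Ω ⊆ U) (hg : IsRiemannianMetricOn g U) (he : IsOrientedOrthonormalFrameOn g e U)
    (hν : ∀ p ∈ frontier Ω, IsOutwardUnitNormal g Ω p (ν p)) (hp : p ∈ frontier Ω) :
    ∃ η, IsNormalExtension g Ω ν p η := by
  obtain ⟨f, V, h⟩ := hbd p hp
  have hpU : p ∈ U := hΩU (hΩ.frontier_subset hp)
  have hfd : ContDiffAt ℝ ∞ (fderiv ℝ f) p := (h.contDiffAt h.mem).fderiv_right (by simp)
  -- The gradient of `f` and its squared length.
  set grad : Eucl n → Eucl n := fun q => ∑ k, fderiv ℝ f q (e k q) • e k q with hgrad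
  set L : Eucl n → ℝ := fun q => ∑ k, fderiv ℝ f q (e k q) ^ 2 with hL
  have hgξ : ∀ q ∈ U, ∀ ξ, g q (grad q) ξ = fderiv ℝ f q ξ := by
    intro q hq ξ
    conv_rhs => rw [← he.expansion hq ξ]
    simp only [hgrad, map_sum, map_smul, _root_.sum_apply, _root_.smul_apply, smul_eq_mul]
    exact Finset.sum_congr rfl fun k _ => by rw [mul_comm, hg.symm q hq]
  have hgg : ∀ q ∈ U, g q (grad q) (grad q) = L q := by
    intro q hq
    rw [hgξ q hq]
    simp only [hgrad, hL, map_sum, map_smul, smul_eq_mul, pow_two]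
  have hLpos : ∀ q ∈ U, fderiv ℝ f q ≠ 0 → 0 < L q := by
    intro q hq hne
    rw [← hgg q hq]
    refine hg.pos q hq _ fun h0 => hne ?_
    ext ξ
    rw [← hgξ q hq, h0]; simp
  have hLs : ContDiffAt ℝ ∞ L p := by
    refine ContDiffAt.sum fun k _ => ContDiffAt.pow ?_ 2
    exact hfd.clm_apply (he.contDiffAt hU hpU k)
  have hgs : ContDiffAt ℝ ∞ grad p := by
    refine ContDiffAt.sum fun k _ => ContDiffAt.fun_smul ?_ (he.contDiffAt hU hpU k)
    exact hfd.clm_apply (he.contDiffAt hU hpU k)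
  have hLp : 0 < L p := hLpos p hpU h.regular
  set c : Eucl n → ℝ := fun q => (√(L q))⁻¹ with hc
  have hcs : ContDiffAt ℝ ∞ c p :=
    (hLs.sqrt hLp.ne').inv (Real.sqrt_pos.mpr hLp).ne'
  have hcL : ∀ q, 0 < L q → c q * c q * L q = 1 := by
    intro q hq
    have h1 := Real.mul_self_sqrt hq.le
    have h2 := (Real.sqrt_pos.mpr hq).ne'
    simp only [hc]
    field_simp
    rw [pow_two, h1]
  have hLev : ∀ᶠ q in 𝓝 p, q ∈ U ∧ q ∈ V ∧ 0 < L q :=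
    (hU.eventually_mem hpU).and ((h.isOpen.eventually_mem h.mem).and
      (hLs.continuousAt.eventually (lt_mem_nhds hLp)))
  set η : Eucl n → Eucl n := fun q => c q • grad q with hη
  have hηs : ContDiffAt ℝ ∞ η p := hcs.smul hgs
  have hηξ : ∀ q ∈ U, ∀ ξ, g q (η q) ξ = c q * fderiv ℝ f q ξ := by
    intro q hq ξ
    simp only [hη, map_smul, _root_.smul_apply, smul_eq_mul, hgξ q hq]
  have hηη : ∀ q ∈ U, 0 < L q → g q (η q) (η q) = 1 := by
    intro q hq hLq
    rw [hηξ q hq, hη]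
    simp only [map_smul, smul_eq_mul]
    rw [← hgξ q hq, hgg q hq, ← mul_assoc, hcL q hLq]
  have hcp : 0 < c p := inv_pos.mpr (Real.sqrt_pos.mpr hLp)
  have hker : ∀ τ, g p (η p) τ = 0 → fderiv ℝ f p τ = 0 := by
    intro τ hτ
    rw [hηξ p hpU] at hτ
    exact (mul_eq_zero.mp hτ).resolve_left hcp.ne'
  have hηd : DifferentiableAt ℝ η p := hηs.differentiableAt (by simp)
  refine ⟨η, hηs, ?_, hηη p hpU hLp, fun τ hτ => h.mem_tangentConeAt_frontier (hker τ hτ), ?_, ?_⟩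
  · filter_upwards [nhdsWithin_le_nhds hLev, self_mem_nhdsWithin] with q hq hqf
    obtain ⟨hqU, hqV, hLq⟩ := hq
    have hne : fderiv ℝ f q ≠ 0 := by
      intro h0
      simp [hL, h0] at hLq
    have hq0 := h.congr_point hqV (h.eq_zero_of_mem_frontier hΩ hqV hqf) hne
    obtain ⟨h1, f', V', hf', c', hc', hνξ⟩ := hν q hqf
    obtain ⟨a, ha, hfa⟩ := hq0.fderiv_eq_smul hf'
    have hνg : ν q = (c' * a) • grad q := by
      refine he.ext hqU fun k => ?_
      rw [hνξ, hfa]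
      simp only [map_smul, _root_.smul_apply, smul_eq_mul]
      rw [hgξ q hqU]; ring
    have h2 : (c' * a) * (c' * a) * L q = 1 := by
      rw [hνg] at h1
      simp only [map_smul, _root_.smul_apply, smul_eq_mul, hgg q hqU] at h1
      linarith
    have h3 : c' * a = c q := by
      have hcq : 0 < c q := inv_pos.mpr (Real.sqrt_pos.mpr hLq)
      have h4 : (c' * a) * (c' * a) = c q * c q :=
        mul_right_cancel₀ hLq.ne' (h2.trans (hcL q hLq).symm)
      exact (mul_self_inj (mul_pos hc' ha).le hcq.le).mp h4
    rw [hνg, h3]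
  · intro ξ
    have h1 := fderiv_metric_covDeriv hg hU he hpU hηd hηd ξ
    have h2 : (fun q => g q (η q) (η q)) =ᶠ[𝓝 p] fun _ => (1 : ℝ) := by
      filter_upwards [hLev] with q hq using hηη q hq.1 hq.2.2
    rw [h2.fderiv_eq, fderiv_const_apply, hg.symm p hpU (η p)] at h1
    simp only [_root_.zero_apply] at h1
    linarith
  -- On tangent vectors, `g(∇_τ η, τ')` is a multiple of the covariant Hessian of `f`.
  · have key : ∀ τ τ', g p (η p) τ' = 0 → g p (covDeriv g η p τ) τ'
        = c p * fderiv ℝ (fderiv ℝ f) p τ τ' - g p (η p) (christoffel g p τ τ') := by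
      intro τ τ' hτ'
      have h1 := fderiv_metric_covDeriv hg hU he hpU hηd (differentiableAt_const τ') τ
      have h2 : (fun q => g q (η q) τ') =ᶠ[𝓝 p] fun q => c q * fderiv ℝ f q τ' := by
        filter_upwards [hLev] with q hq using hηξ q hq.1 τ'
      have h3 : HasFDerivAt (fun q => c q * fderiv ℝ f q τ') _ p :=
        (hcs.differentiableAt (by simp)).hasFDerivAt.mul
          ((hfd.differentiableAt (by simp)).hasFDerivAt.clm_apply (hasFDerivAt_const τ' p))
      rw [h2.fderiv_eq, h3.fderiv] at h1
      simp only [_root_.add_apply, _root_.smul_apply, smul_eq_mul, hker τ' hτ'] at h1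
      have h4 : covDeriv g (fun _ => τ') p τ = christoffel g p τ τ' := by simp [covDeriv]
      rw [h4] at h1
      simp at h1
      linarith
    intro τ τ' hτ hτ'
    have hsymm : IsSymmSndFDerivAt ℝ f p := (h.contDiffAt h.mem).isSymmSndFDerivAt (by
      rw [minSmoothness_of_isRCLikeNormedField]
      exact WithTop.coe_le_coe.mpr (le_top (a := (2 : ℕ∞))))
    rw [key τ τ' hτ', key τ' τ hτ, hsymm.eq τ τ', christoffel_symm hg hU hpU τ τ']

namespace IsNormalExtension

variable {η : Eucl n → Eucl n}

theorem eq_at (h : IsNormalExtension g Ω ν p η) (hp : p ∈ frontier Ω) : ν p = η p :=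
  h.eq_normal.self_of_nhdsWithin hp

theorem hasFDerivWithinAt (h : IsNormalExtension g Ω ν p η) (hp : p ∈ frontier Ω) :
    HasFDerivWithinAt ν (fderiv ℝ η p) (frontier Ω) p :=
  (h.smooth.differentiableAt (by simp)).hasFDerivAt.hasFDerivWithinAt.congr_of_eventuallyEq
    h.eq_normal (h.eq_at hp)

theorem fderivWithin_apply (h : IsNormalExtension g Ω ν p η) (hp : p ∈ frontier Ω) {τ : Eucl n}
    (hτ : g p (η p) τ = 0) : fderivWithin ℝ ν (frontier Ω) p τ = fderiv ℝ η p τ :=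
  (h.hasFDerivWithinAt hp).differentiableWithinAt.hasFDerivWithinAt.unique_on
    (h.hasFDerivWithinAt hp) (h.tangent τ hτ)

theorem metric_tangentialPart (h : IsNormalExtension g Ω ν p η) (hp : p ∈ frontier Ω)
    (ξ : Eucl n) : g p (η p) (tangentialPart g ν p ξ) = 0 := by
  simp [tangentialPart, h.eq_at hp, h.unit]

theorem meanCurvature_eq (h : IsNormalExtension g Ω ν p η) (hU : IsOpen U)
    (hg : IsRiemannianMetricOn g U) (he : IsOrientedOrthonormalFrameOn g e U) (hpU : p ∈ U)
    (hp : p ∈ frontier Ω) : meanCurvature g Ω ν p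
      = ∑ k, g p (covDeriv g η p (tangentialPart g ν p (e k p))) (e k p) := by
  let T : Eucl n →ₗ[ℝ] Eucl n :=
    { toFun := fun ξ => covDeriv g η p (tangentialPart g ν p ξ)
      map_add' := fun ξ ζ => by
        rw [← covDeriv_add_right hg hU hpU]; congr 1
        simp only [tangentialPart, map_add, add_smul]; abel
      map_smul' := fun c ξ => by
        rw [RingHom.id_apply, ← covDeriv_smul_right hg hU hpU]; congr 1
        simp only [tangentialPart, map_smul, smul_sub, smul_smul, smul_eq_mul] }
  have hT : ∀ ξ, T ξ = covDeriv g η p (tangentialPart g ν p ξ) := fun _ => rfl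
  have h1 := he.sum_apply_stdVec hpU T
  simp only [hT] at h1
  rw [← h1, meanCurvature]
  refine Finset.sum_congr rfl fun i _ => ?_
  rw [h.fderivWithin_apply hp (h.metric_tangentialPart hp _), h.eq_at hp]
  rfl

/-- The second fundamental form, extended by zero in the normal direction, is symmetric. -/
theorem secondFundamentalForm_symm (h : IsNormalExtension g Ω ν p η) (hp : p ∈ frontier Ω)
    (ξ ζ : Eucl n) : g p (covDeriv g η p (tangentialPart g ν p ξ)) ζ
      = g p (covDeriv g η p (tangentialPart g ν p ζ)) ξ := by
  have key : ∀ ξ ζ, g p (covDeriv g η p (tangentialPart g ν p ξ)) ζ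
      = g p (covDeriv g η p (tangentialPart g ν p ξ)) (tangentialPart g ν p ζ) := by
    intro ξ ζ
    conv_rhs => rw [tangentialPart.eq_def g ν p ζ, map_sub, map_smul, h.eq_at hp,
      h.covDeriv_tangential, smul_zero, sub_zero]
  rw [key ξ ζ, key ζ ξ]
  exact h.symm _ _ (h.metric_tangentialPart hp _) (h.metric_tangentialPart hp _)

end IsNormalExtension

end BoundaryGeometry

/-! ### The trace norm -/

section TraceNorm

/-- Singular value decomposition of a linear map between Euclidean spaces of equal dimension. -/
theorem exists_orthonormalBasis_singularValues {V W : Type*} [NormedAddCommGroup V]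
    [InnerProductSpace ℝ V] [FiniteDimensional ℝ V] [NormedAddCommGroup W] [InnerProductSpace ℝ W]
    [FiniteDimensional ℝ W] {d : ℕ} (hV : Module.finrank ℝ V = d) (hW : Module.finrank ℝ W = d)
    (L : V →ₗ[ℝ] W) : ∃ (v : OrthonormalBasis (Fin d) ℝ V) (w : OrthonormalBasis (Fin d) ℝ W)
      (σ : Fin d → ℝ), (∀ j, 0 ≤ σ j) ∧ ∀ j, L (v j) = σ j • w j := by
  have hsymm : (L.adjoint ∘ₗ L).IsSymmetric := L.isSymmetric_adjoint_comp_self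
  set v := hsymm.eigenvectorBasis hV with hv
  have horth : ∀ i j, i ≠ j → ⟪L (v i), L (v j)⟫_ℝ = 0 := by
    intro i j hij
    rw [← LinearMap.adjoint_inner_left]
    have : L.adjoint (L (v i)) = hsymm.eigenvalues hV i • v i :=
      hsymm.apply_eigenvectorBasis hV i
    rw [this, inner_smul_left, v.inner_eq_zero hij, mul_zero]
  set u : Fin d → W := fun j => ‖L (v j)‖⁻¹ • L (v j) with hu
  have hon : Orthonormal ℝ (Set.domRestrict {j | L (v j) ≠ 0} u) := by
    constructor
    · rintro ⟨j, hj⟩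
      have : ‖L (v j)‖ ≠ 0 := norm_ne_zero_iff.mpr hj
      change ‖u j‖ = 1
      simp [hu, norm_smul, this]
    · rintro ⟨i, hi⟩ ⟨j, hj⟩ hij
      have : i ≠ j := fun h => hij (Subtype.ext h)
      change ⟪u i, u j⟫_ℝ = 0
      simp [hu, inner_smul_left, inner_smul_right, horth i j this]
  obtain ⟨w, hw⟩ := hon.exists_orthonormalBasis_extension_of_card_eq (by simpa using hW)
  refine ⟨v, w, fun j => ‖L (v j)‖, fun j => norm_nonneg _, fun j => ?_⟩
  by_cases hj : L (v j) = 0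
  · simp [hj]
  · rw [hw j hj, hu]
    simp [smul_smul, norm_ne_zero_iff.mpr hj]

/-- The trace norm is at least the sum of the singular values. The inner product of `T` is given as
a bilinear form `b`, which the isomorphism `φ` identifies with the one of a Euclidean space. -/
theorem sum_singularValues_le_traceNorm {T V W : Type*} [AddCommGroup T] [Module ℝ T]
    [NormedAddCommGroup V] [InnerProductSpace ℝ V] [FiniteDimensional ℝ V]
    [NormedAddCommGroup W] [InnerProductSpace ℝ W] [FiniteDimensional ℝ W]
    {d : ℕ} {b : T → T → ℝ} {bW : W → W → ℝ} (hbW : ∀ w w', bW w w' = ⟪w, w'⟫_ℝ)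
    (φ : V ≃ₗ[ℝ] T) (hφ : ∀ x y, b (φ x) (φ y) = ⟪x, y⟫_ℝ)
    (L : T →ₗ[ℝ] W) {v : OrthonormalBasis (Fin d) ℝ V} {w : OrthonormalBasis (Fin d) ℝ W}
    {σ : Fin d → ℝ} (hσ : ∀ j, 0 ≤ σ j) (hL : ∀ j, L (φ (v j)) = σ j • w j) :
    ∑ j, σ j ≤ traceNorm b bW L := by
  have htr : ∀ Q : W →ₗ[ℝ] T, LinearMap.trace ℝ T (Q ∘ₗ L)
      = ∑ j, σ j * ⟪v j, φ.symm (Q (w j))⟫_ℝ := by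
    intro Q
    rw [← LinearMap.trace_conj' (Q ∘ₗ L) φ.symm, LinearMap.trace_eq_sum_inner _ v]
    refine Finset.sum_congr rfl fun j _ => ?_
    simp [LinearEquiv.conj_apply, hL, inner_smul_right]
  -- The supremum is a genuine one: by Cauchy-Schwarz the set is bounded by `∑ σ_j`, a value that
  -- it takes at the isometry `w_j ↦ φ v_j`.
  refine le_csSup ⟨∑ j, σ j, ?_⟩ ?_
  · rintro t ⟨Q, hQ, rfl⟩
    rw [htr]
    refine Finset.sum_le_sum fun j _ => ?_
    have h1 : ‖φ.symm (Q (w j))‖ = 1 := by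
      have h2 : ⟪φ.symm (Q (w j)), φ.symm (Q (w j))⟫_ℝ = 1 := by
        rw [← hφ]
        simp [hQ, hbW]
      rw [real_inner_self_eq_norm_sq] at h2
      exact (pow_eq_one_iff_of_nonneg (norm_nonneg _) two_ne_zero).mp h2
    have h3 := real_inner_le_norm (v j) (φ.symm (Q (w j)))
    rw [h1, v.norm_eq_one, one_mul] at h3
    exact mul_le_of_le_one_right (hσ j) h3
  · refine ⟨φ.toLinearMap ∘ₗ (w.equiv v (Equiv.refl _)).toLinearEquiv.toLinearMap, ?_, ?_⟩
    · intro x y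
      simp [hφ, hbW]
    · rw [htr]
      simp

end TraceNorm

/-! ### The boundary term -/

section BoundaryAlgebra

variable {ι κ K : Type*} [Fintype ι] [Fintype κ]

theorem commute_sum_smul {𝒜 : Type*} [Ring 𝒜] [Algebra ℝ 𝒜] {γ : ι → 𝒜} {W : κ → 𝒜}
    (h : ∀ a k, Commute (W a) (γ k)) (y : κ → ℝ) (x : ι → ℝ) :
    Commute (∑ a, y a • W a) (∑ k, x k • γ k) :=
  Commute.sum_right _ _ _ fun k _ => Commute.sum_left _ _ _ fun a _ =>
    ((h a k).smul_left (y a)).smul_right (x k)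

variable [DecidableEq ι] [DecidableEq κ] [NormedAddCommGroup K] [InnerProductSpace ℝ K]

/-- The algebra behind the boundary term at a point. Here `n`, `N` are the components of the normal
and of the map to the sphere, `h` is the second fundamental form, `M_k` and `v_k` are the
derivatives of `N` and the covariant derivatives of the spinor along the tangential parts of the
frame vectors, and `a = ∇_ν s`. The operator `χ = -w c` anticommutes with the tangential operator
`∑_k c γ_k ∇_{e_k}`, up to the terms coming from the derivatives of `ν` and `N`. -/
theorem IsCliffordFamily.boundary_identity {γ : ι → K →L[ℝ] K} {W : κ → K →L[ℝ] K}
    (hγ : IsCliffordFamily γ) (hW : IsCliffordFamily W) (hcomm : ∀ a k, Commute (W a) (γ k))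
    {n : ι → ℝ} (hn : ∑ k, n k ^ 2 = 1) {N : κ → ℝ} {M : ι → κ → ℝ}
    (hM : ∀ a, ∑ k, n k * M k a = 0) {h : ι → ι → ℝ} (hsymm : ∀ k l, h k l = h l k)
    {s a : K} {v : ι → K} (hs : -(∑ a, N a • W a) ((∑ k, n k • γ k) s) = s)
    (hv : ∀ k, v k = -(∑ a, M k a • W a) ((∑ l, n l • γ l) s)
      - (∑ a, N a • W a) ((∑ l, h k l • γ l) s) - (∑ a, N a • W a) ((∑ l, n l • γ l) (v k)))
    (hnv : ∑ k, n k • v k = 0) (ha : ∑ k, (∑ l, n l • γ l) (γ k (v k)) = a) :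
    2 * ⟪s, a⟫_ℝ = -(∑ k, h k k) * ‖s‖ ^ 2 - ∑ k, ⟪s, (∑ a, M k a • W a) (γ k s)⟫_ℝ := by
  set c := ∑ k, n k • γ k with hc
  set w := ∑ a, N a • W a with hw
  have hcc : ∀ x, c (c x) = -x := fun x => by rw [hc, hγ.sq_sum, hn, neg_one_smul]
  have hwc : ∀ x, w (c x) = c (w x) := fun x =>
    congrArg (fun T : K →L[ℝ] K => T x) (commute_sum_smul hcomm N n).eq
  have hWγ : ∀ (y : κ → ℝ) k x, (∑ a, y a • W a) (γ k x) = γ k ((∑ a, y a • W a) x) := by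
    intro y k x
    have := commute_sum_smul hcomm y (Pi.single k 1)
    simp only [Pi.single_apply, ite_smul, one_smul, zero_smul, Finset.sum_ite_eq',
      Finset.mem_univ, if_true] at this
    exact congrArg (fun T : K →L[ℝ] K => T x) this.eq
  have hWc : ∀ (y : κ → ℝ) x, (∑ a, y a • W a) (c x) = c ((∑ a, y a • W a) x) := fun y x =>
    congrArg (fun T : K →L[ℝ] K => T x) (commute_sum_smul hcomm y n).eq
  have hγc : ∀ k x, γ k (c x) = -c (γ k x) - (2 * n k) • x := by
    intro k x
    have h1 := congrArg (fun T : K →L[ℝ] K => T x)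
      (hγ.relations.mul_sum_smul n (Pi.single k 1))
    simp only [Pi.single_apply, ite_smul, one_smul, zero_smul, Finset.sum_ite_eq', mul_ite,
      mul_one, mul_zero, Finset.mem_univ, if_true, _root_.add_apply, mul_apply_eq_comp,
      _root_.smul_apply, one_apply_eq_self, ← hc] at h1
    have h2 : γ k (c x) = (-2 * n k) • x - c (γ k x) := by rw [← h1]; abel
    rw [h2]; module
  have hcγc : ∀ k x, c (γ k (c x)) = γ k x - (2 * n k) • c x := by
    intro k x
    rw [hγc, map_sub, map_neg, hcc, map_smul, neg_neg]
  have hH : ∑ k, γ k ((∑ l, h k l • γ l) s) = -(∑ k, h k k) • s := by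
    have h1 : ∑ k, γ k ((∑ l, h k l • γ l) s) = ∑ k, ∑ l, h k l • (γ k * γ l) s := by
      simp only [_root_.sum_apply, _root_.smul_apply, map_sum, map_smul, mul_apply_eq_comp]
    have h2 : ∑ k, ∑ l, h k l • (γ k * γ l) s = ∑ k, ∑ l, h k l • (γ l * γ k) s := by
      rw [Finset.sum_comm]
      exact Finset.sum_congr rfl fun k _ => Finset.sum_congr rfl fun l _ => by rw [hsymm]
    have h3 : (2 : ℝ) • ∑ k, γ k ((∑ l, h k l • γ l) s) = (2 : ℝ) • (-(∑ k, h k k) • s) := by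
      rw [two_smul]
      conv_lhs => rw [h1]
      conv_lhs => arg 2; rw [h2]
      simp only [← Finset.sum_add_distrib, ← smul_add, ← _root_.add_apply, hγ.relations _ _]
      have : ∀ k l, h k l • (if k = l then (-2 : ℝ) • (1 : K →L[ℝ] K) else 0) s
          = if k = l then (-2 * h k l) • s else 0 := by
        intro k l
        split_ifs
        · simp only [_root_.smul_apply, one_apply_eq_self, smul_smul]; congr 1; ring
        · simp
      simp only [this, Finset.sum_ite_eq, Finset.mem_univ, if_true, ← Finset.sum_smul, smul_smul,
        ← Finset.mul_sum]
      congr 1; ring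
    exact smul_right_injective K (by norm_num : (2 : ℝ) ≠ 0) h3
  have hca : ∑ k, γ k (v k) = -c a := by
    rw [← ha, map_sum]
    simp only [hcc, Finset.sum_neg_distrib, neg_neg]
  have hMW : ∑ k, n k • (∑ a, M k a • W a) (c s) = 0 := by
    have : ∑ k, n k • (∑ a, M k a • W a) (c s) = ∑ a, (∑ k, n k * M k a) • W a (c s) := by
      simp only [_root_.sum_apply, _root_.smul_apply, Finset.smul_sum, Finset.sum_smul, smul_smul]
      exact Finset.sum_comm
    rw [this]
    simp [hM]
  -- The three terms of `∑ c γ_k v_k`: from `dN`, from the second fundamental form, and from the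
  -- derivative of `s`.
  have t1 : ∑ k, c (γ k ((∑ a, M k a • W a) (c s))) = ∑ k, (∑ a, M k a • W a) (γ k s) := by
    have : ∀ k, c (γ k ((∑ a, M k a • W a) (c s)))
        = (∑ a, M k a • W a) (γ k s) - (2 : ℝ) • (n k • (∑ a, M k a • W a) (c s)) := by
      intro k
      rw [← hWγ, ← hWc, hcγc, map_sub, map_smul, smul_smul]
    simp only [this, Finset.sum_sub_distrib, ← Finset.smul_sum, hMW, smul_zero, sub_zero]
  have t2 : ∑ k, c (γ k (w ((∑ l, h k l • γ l) s))) = (∑ k, h k k) • s := by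
    have : ∀ k, c (γ k (w ((∑ l, h k l • γ l) s))) = w (c (γ k ((∑ l, h k l • γ l) s))) := by
      intro k
      rw [hwc, hw, hWγ]
    simp only [this, ← map_sum, hH, map_smul]
    rw [neg_smul, ← smul_neg, hs]
  have t3 : ∑ k, c (γ k (w (c (v k)))) = -w (c a) := by
    have : ∀ k, c (γ k (w (c (v k)))) = w (γ k (v k)) - w (c ((2 : ℝ) • (n k • v k))) := by
      intro k
      rw [hw, ← hWγ, ← hWc, hcγc, map_sub, ← hw, smul_smul, map_smul c]
    simp only [this, Finset.sum_sub_distrib, ← map_sum, hca, ← Finset.smul_sum, hnv, smul_zero,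
      map_zero, sub_zero, map_neg]
  have heq : a = -∑ k, (∑ a, M k a • W a) (γ k s) - (∑ k, h k k) • s + w (c a) := by
    have : ∀ k, c (γ k (v k)) = -c (γ k ((∑ a, M k a • W a) (c s)))
        - c (γ k (w ((∑ l, h k l • γ l) s))) - c (γ k (w (c (v k)))) := by
      intro k
      conv_lhs => rw [hv k]
      simp only [map_sub, map_neg]
    conv_lhs => rw [← ha]
    simp only [this, Finset.sum_sub_distrib, Finset.sum_neg_distrib]
    rw [t1, t2, t3, sub_neg_eq_add]
  -- `-w c` is symmetric and fixes `s`, so pairing with `s` turns the last term into `-⟪s, a⟫`.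
  have hχ : ⟪s, w (c a)⟫_ℝ = -⟪s, a⟫_ℝ := by
    have h1 : ⟪w s, c a⟫_ℝ = -⟪s, w (c a)⟫_ℝ := hW.skew_sum N s (c a)
    have h2 : ⟪c (w s), a⟫_ℝ = -⟪w s, c a⟫_ℝ := hγ.skew_sum n (w s) a
    have h3 : c (w s) = -s := by rw [← hwc]; exact neg_eq_iff_eq_neg.mp hs
    rw [h3, inner_neg_left] at h2
    linarith
  have h4 := congrArg (fun x => ⟪s, x⟫_ℝ) heq
  simp only [inner_add_right, inner_sub_right, inner_neg_right, inner_smul_right, inner_sum, hχ,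
    real_inner_self_eq_norm_sq] at h4
  linarith

end BoundaryAlgebra

section BoundaryTerm

open Filter Topology

variable {n : ℕ} {g : Eucl n → Eucl n →L[ℝ] Eucl n →L[ℝ] ℝ} {e : Fin n → Eucl n → Eucl n}
  {Ω U : Set (Eucl n)} {p : Eucl n} {ν N η : Eucl n → Eucl n} {ι K : Type*}
  [NormedAddCommGroup K] [InnerProductSpace ℝ K] {γ : Fin n → K →L[ℝ] K} {W : Fin n → K →L[ℝ] K}
  {s : Eucl n → K}

theorem commute_spinElement {ι 𝒜 : Type*} [Fintype ι] [Ring 𝒜] [Algebra ℝ 𝒜] {γ : ι → 𝒜} {w : 𝒜}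
    (h : ∀ k, Commute w (γ k)) (θ : ι → ι → ℝ) : Commute w (spinElement γ θ) :=
  (Commute.sum_right _ _ _ fun k _ => Commute.sum_right _ _ _ fun l _ =>
    ((h k).mul_right (h l)).smul_right _).smul_right _

/-- The spin covariant derivative `∇_ξ s` of a section over `Ω`, up to the boundary. -/
noncomputable def spinDerivWithin (γ : Fin n → K →L[ℝ] K)
    (g : Eucl n → Eucl n →L[ℝ] Eucl n →L[ℝ] ℝ) (e : Fin n → Eucl n → Eucl n) (Ω : Set (Eucl n))
    (s : Eucl n → K) (p ξ : Eucl n) : K :=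
  fderivWithin ℝ s Ω p ξ + spinForm γ g e p ξ (s p)

/-- The Leibniz rule for the components of the normal with respect to the frame. -/
theorem fderiv_normal_component (hU : IsOpen U) (hg : IsRiemannianMetricOn g U)
    (he : IsOrientedOrthonormalFrameOn g e U) (hpU : p ∈ U) (hη : DifferentiableAt ℝ η p)
    (k : Fin n) (τ : Eucl n) : fderiv ℝ (fun q => g q (η q) (e k q)) p τ
      = g p (covDeriv g η p τ) (e k p)
        + ∑ l, connectionForm g e p τ k l * g p (η p) (e l p) := by
  rw [fderiv_metric_covDeriv hg hU he hpU hη (he.differentiableAt hU hpU k) τ,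
    covDeriv_frame he hpU τ k]
  simp

/-- The tangential covariant derivative of the boundary condition `-w c s = s`. -/
theorem IsNormalExtension.spinDerivWithin_eq (h : IsNormalExtension g Ω ν p η)
    (hΩ : IsClosed Ω) (hU : IsOpen U)
    (hg : IsRiemannianMetricOn g U) (he : IsOrientedOrthonormalFrameOn g e U) (hpU : p ∈ U)
    (hp : p ∈ frontier Ω) (hγ : IsCliffordFamily γ) (hcomm : ∀ a k, Commute (W a) (γ k))
    (hN : DifferentiableWithinAt ℝ N (frontier Ω) p) (hs : DifferentiableWithinAt ℝ s Ω p)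
    (hχ : ∀ q ∈ frontier Ω, -(∑ a, N q a • W a) ((∑ k, g q (ν q) (e k q) • γ k) (s q)) = s q)
    {τ : Eucl n} (hτ : g p (η p) τ = 0) :
    spinDerivWithin γ g e Ω s p τ
      = -(∑ a, fderivWithin ℝ N (frontier Ω) p τ a • W a) ((∑ k, g p (η p) (e k p) • γ k) (s p))
        - (∑ a, N p a • W a) ((∑ l, g p (covDeriv g η p τ) (e l p) • γ l) (s p))
        - (∑ a, N p a • W a) ((∑ k, g p (η p) (e k p) • γ k) (spinDerivWithin γ g e Ω s p τ)) := by
  have hηd : DifferentiableAt ℝ η p := h.smooth.differentiableAt (by simp)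
  set S := frontier Ω with hS
  set w := ∑ a, N p a • W a with hw
  set c := ∑ k, g p (η p) (e k p) • γ k with hc
  set θ := connectionForm g e p τ with hθ
  have hs1 : HasFDerivWithinAt s (fderivWithin ℝ s Ω p) S p :=
    hs.hasFDerivWithinAt.mono hΩ.frontier_subset
  have hφ : ∀ k, DifferentiableAt ℝ (fun q => g q (η q) (e k q)) p := fun k =>
    ((hg.differentiableAt hU hpU).clm_apply hηd).clm_apply (he.differentiableAt hU hpU k)
  have hNa : ∀ a, HasFDerivWithinAt (fun q => N q a)
      ((EuclideanSpace.proj a : Eucl n →L[ℝ] ℝ) ∘L fderivWithin ℝ N S p) S p := fun a =>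
    (EuclideanSpace.proj a : Eucl n →L[ℝ] ℝ).hasFDerivAt.comp_hasFDerivWithinAt p
      hN.hasFDerivWithinAt
  have hwd : HasFDerivWithinAt (fun q => ∑ a, N q a • W a) _ S p :=
    HasFDerivWithinAt.fun_sum fun a _ => (hNa a).smul_const (W a)
  have hcd : HasFDerivWithinAt (fun q => ∑ k, g q (η q) (e k q) • γ k) _ S p :=
    HasFDerivWithinAt.fun_sum fun k _ => (hφ k).hasFDerivAt.hasFDerivWithinAt.smul_const (γ k)
  have hF := (hwd.clm_apply (hcd.clm_apply hs1)).neg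
  have hev : s =ᶠ[𝓝[S] p] fun q =>
      -(∑ a, N q a • W a) ((∑ k, g q (η q) (e k q) • γ k) (s q)) := by
    filter_upwards [h.eq_normal, self_mem_nhdsWithin] with q hq hqS
    rw [← hq, hχ q hqS]
  have hsp : -w (c (s p)) = s p := by
    have := hχ p hp
    rwa [h.eq_at hp] at this
  have hF2 := hF.congr_of_eventuallyEq hev hsp.symm
  have h1 := hs1.unique_on hF2 (h.tangent τ hτ)
  have h2 : fderivWithin ℝ s Ω p τ
      = -(∑ a, fderivWithin ℝ N S p τ a • W a) (c (s p))
        - w ((∑ l, g p (covDeriv g η p τ) (e l p) • γ l) (s p))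
        - w ((∑ k, (∑ l, θ k l * g p (η p) (e l p)) • γ k) (s p))
        - w (c (fderivWithin ℝ s Ω p τ)) := by
    conv_lhs => rw [h1]
    simp only [_root_.neg_apply, _root_.add_apply, _root_.sum_apply, _root_.smul_apply,
      ContinuousLinearMap.comp_apply, ContinuousLinearMap.flip_apply,
      ContinuousLinearMap.smulRight_apply, PiLp.proj_apply,
      fderiv_normal_component hU hg he hpU hηd, ← hw, ← hc, ← hθ, add_smul,
      Finset.sum_add_distrib, map_add]
    abel
  -- The spin connection commutes with `w`; its commutator with `c` cancels the frame terms.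
  set A := spinForm γ g e p τ with hA
  have hAw : ∀ x, A (w x) = w (A x) := by
    intro x
    have h3 : Commute (spinForm γ g e p τ) w := by
      rw [spinForm_apply hg hU hpU]
      exact Commute.sum_right _ _ _ fun a _ =>
        (commute_spinElement (hcomm a) θ).symm.smul_right _
    exact congrArg (fun T : K →L[ℝ] K => T x) h3.eq
  have hAc : ∀ x, A (c x) = c (A x)
      - (∑ k, (∑ l, θ k l * g p (η p) (e l p)) • γ k) x := by
    intro x
    have h4 : (∑ k, (∑ l, θ k l * g p (η p) (e l p)) • γ k) x
        = -∑ k, g p (η p) (e k p) • ∑ l, θ k l • γ l x := by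
      simp only [_root_.sum_apply, _root_.smul_apply, Finset.sum_smul, Finset.smul_sum, smul_smul]
      rw [Finset.sum_comm, ← Finset.sum_neg_distrib]
      refine Finset.sum_congr rfl fun k _ => ?_
      rw [← Finset.sum_neg_distrib]
      refine Finset.sum_congr rfl fun l _ => ?_
      rw [hθ, connectionForm_antisymm hg hU he hpU τ l k, ← neg_smul]
      congr 1; ring
    rw [h4]
    simp only [hc, _root_.sum_apply, _root_.smul_apply, map_sum, map_smul, hA,
      spinForm_commutator hγ hg hU he hpU, smul_add, Finset.sum_add_distrib, sub_neg_eq_add]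
    rfl
  have h5 : A (s p) = -w (c (A (s p)))
      + w ((∑ k, (∑ l, θ k l * g p (η p) (e l p)) • γ k) (s p)) := by
    conv_lhs => rw [← hsp, map_neg, hAw, hAc, map_sub]
    abel
  have h6 : spinDerivWithin γ g e Ω s p τ = fderivWithin ℝ s Ω p τ + A (s p) := rfl
  rw [h6, map_add, map_add]
  conv_lhs => rw [h2, h5]
  abel

/-- An orthonormal frame at a point, as an isomorphism from Euclidean space. -/
noncomputable def frameEquiv (he : IsOrientedOrthonormalFrameOn g e U) (hpU : p ∈ U) :
    Eucl n ≃ₗ[ℝ] Eucl n :=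
  (EuclideanSpace.basisFun (Fin n) ℝ).toBasis.equiv (he.basis hpU) (Equiv.refl _)

theorem frameEquiv_apply (he : IsOrientedOrthonormalFrameOn g e U) (hpU : p ∈ U) (x : Eucl n) :
    frameEquiv he hpU x = ∑ k, x k • e k p := by
  conv_lhs => rw [← sum_smul_stdVec x, map_sum]
  refine Finset.sum_congr rfl fun k _ => ?_
  rw [map_smul]
  congr 1
  have h := (EuclideanSpace.basisFun (Fin n) ℝ).toBasis.equiv_apply k (he.basis hpU)
    (Equiv.refl (Fin n))
  simpa [stdVec, he.basis_apply, frameEquiv] using h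

theorem metric_frameEquiv (he : IsOrientedOrthonormalFrameOn g e U) (hpU : p ∈ U)
    (x : Eucl n) (k : Fin n) : g p (frameEquiv he hpU x) (e k p) = x k := by
  simp [frameEquiv_apply, he.orthonormal p hpU]

theorem metric_frameEquiv_frameEquiv (he : IsOrientedOrthonormalFrameOn g e U) (hpU : p ∈ U)
    (x y : Eucl n) : g p (frameEquiv he hpU x) (frameEquiv he hpU y) = ⟪x, y⟫_ℝ := by
  rw [he.metric_eq hpU]
  simp [metric_frameEquiv, PiLp.inner_apply, mul_comm]

theorem finrank_bdryTangent (h1 : g p (ν p) (ν p) = 1) :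
    Module.finrank ℝ (bdryTangent g ν p) = n - 1 := by
  have hne : (g p (ν p)).toLinearMap ≠ 0 := by
    intro h0
    have := congrArg (fun T : Eucl n →ₗ[ℝ] ℝ => T (ν p)) h0
    simp [h1] at this
  have := Module.Dual.finrank_ker_add_one_of_ne_zero hne
  rw [bdryTangent]
  simp at this
  omega

theorem finrank_orthogonal_of_norm_eq_one {x : Eucl n} (h1 : ‖x‖ = 1) :
    Module.finrank ℝ ((ℝ ∙ x)ᗮ : Submodule ℝ (Eucl n)) = n - 1 := by
  have h := Submodule.finrank_add_finrank_orthogonal (ℝ ∙ x)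
  rw [finrank_span_singleton (by rintro rfl; simp at h1)] at h
  simp at h
  omega

/-- The differential of a map to the sphere takes values in the tangent space of the sphere. -/
theorem IsNormalExtension.inner_fderivWithin_eq_zero (h : IsNormalExtension g Ω ν p η)
    (hp : p ∈ frontier Ω) (hN : DifferentiableWithinAt ℝ N (frontier Ω) p)
    (hN1 : ∀ q ∈ frontier Ω, ‖N q‖ = 1) {τ : Eucl n} (hτ : g p (η p) τ = 0) :
    ⟪N p, fderivWithin ℝ N (frontier Ω) p τ⟫_ℝ = 0 := by
  have h1 := hN.hasFDerivWithinAt.inner ℝ hN.hasFDerivWithinAt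
  have h2 : HasFDerivWithinAt (fun q => ⟪N q, N q⟫_ℝ) (0 : Eucl n →L[ℝ] ℝ) (frontier Ω) p := by
    refine (hasFDerivWithinAt_const (1 : ℝ) p _).congr (fun q hq => ?_) ?_
    · rw [real_inner_self_eq_norm_sq, hN1 q hq, one_pow]
    · rw [real_inner_self_eq_norm_sq, hN1 p hp, one_pow]
  have h3 := h1.unique_on h2 (h.tangent τ hτ)
  simp [real_inner_comm] at h3
  exact h3

/-- The trace norm of `dN` bounds the Clifford contraction of `dN`. -/
theorem IsNormalExtension.neg_sum_inner_le (h : IsNormalExtension g Ω ν p η)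
    (hg : IsRiemannianMetricOn g U)
    (he : IsOrientedOrthonormalFrameOn g e U) (hpU : p ∈ U)
    (hp : p ∈ frontier Ω) (hγ : IsCliffordFamily γ) (hW : IsCliffordFamily W)
    (hN : DifferentiableWithinAt ℝ N (frontier Ω) p)
    (hN1 : ∀ q ∈ frontier Ω, ‖N q‖ = 1) (x : K) :
    -∑ k, ⟪x, (∑ a, fderivWithin ℝ N (frontier Ω) p (tangentialPart g ν p (e k p)) a • W a)
        (γ k x)⟫_ℝ ≤ traceNormDifferential g Ω ν N p * ‖x‖ ^ 2 := by
  have hν1 : g p (ν p) (ν p) = 1 := by rw [h.eq_at hp, h.unit]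
  set T := bdryTangent g ν p with hT
  set φ₀ := frameEquiv he hpU with hφ₀
  set V := T.comap φ₀.toLinearMap with hV
  let φ : V ≃ₗ[ℝ] T := φ₀.ofSubmodule' T
  have hφv : ∀ x : V, (φ x : Eucl n) = φ₀ x := fun _ => rfl
  have hfV : Module.finrank ℝ V = n - 1 := by
    rw [φ.finrank_eq, hT, finrank_bdryTangent hν1]
  obtain ⟨v, w, σ, hσ, hL⟩ := exists_orthonormalBasis_singularValues hfV
    (finrank_orthogonal_of_norm_eq_one (hN1 p hp)) (sphereDifferential g Ω ν N p ∘ₗ φ.toLinearMap)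
  have hsum : ∑ j, σ j ≤ traceNormDifferential g Ω ν N p :=
    sum_singularValues_le_traceNorm (fun _ _ => rfl) φ
      (fun x y => metric_frameEquiv_frameEquiv he hpU x y) _ hσ hL
  have hdN : ∀ j, fderivWithin ℝ N (frontier Ω) p (φ (v j)) = σ j • (w j : Eucl n) := by
    intro j
    have h1 := congrArg (fun y : ((ℝ ∙ N p)ᗮ : Submodule ℝ (Eucl n)) => (y : Eucl n)) (hL j)
    have hmem : fderivWithin ℝ N (frontier Ω) p (φ (v j)) ∈ (ℝ ∙ N p)ᗮ := by
      rw [Submodule.mem_orthogonal_singleton_iff_inner_right]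
      refine h.inner_fderivWithin_eq_zero hp hN hN1 ?_
      rw [← h.eq_at hp]
      exact (φ (v j)).2
    have h2 : ((sphereDifferential g Ω ν N p (φ (v j)) : ((ℝ ∙ N p)ᗮ : Submodule ℝ (Eucl n))) :
        Eucl n) = fderivWithin ℝ N (frontier Ω) p (φ (v j)) := by
      change (((ℝ ∙ N p)ᗮ.orthogonalProjectionOnto (fderivWithin ℝ N (frontier Ω) p (φ (v j))) :
        ((ℝ ∙ N p)ᗮ : Submodule ℝ (Eucl n))) : Eucl n) = _
      rw [← Submodule.starProjection_apply, Submodule.starProjection_eq_self_iff.mpr hmem]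
    rw [← h2]
    exact h1
  have htan : ∀ k, tangentialPart g ν p (e k p) = ∑ j, (v j : Eucl n) k • (φ (v j) : Eucl n) := by
    intro k
    have hmem : tangentialPart g ν p (e k p) ∈ T := by
      rw [hT, bdryTangent, LinearMap.mem_ker]
      simp [tangentialPart, hν1]
    set t : T := ⟨_, hmem⟩ with ht
    have h1 := congrArg (fun y => ((φ y : T) : Eucl n)) (v.sum_repr (φ.symm t))
    simp only [map_sum, map_smul, LinearEquiv.apply_symm_apply] at h1
    have h2 : ∀ j, ⟪v j, φ.symm t⟫_ℝ = (v j : Eucl n) k := by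
      intro j
      have h3 : g p (φ (v j)) (ν p) = 0 := by
        rw [hg.symm p hpU]
        exact (φ (v j)).2
      calc ⟪v j, φ.symm t⟫_ℝ = g p (φ (v j)) (φ (φ.symm t)) :=
            (metric_frameEquiv_frameEquiv he hpU _ _).symm
        _ = g p (φ (v j)) (tangentialPart g ν p (e k p)) := by rw [LinearEquiv.apply_symm_apply]
        _ = g p (φ (v j)) (e k p) := by simp [tangentialPart, h3]
        _ = _ := metric_frameEquiv he hpU _ k
    simp only [v.repr_apply_apply, h2] at h1
    simpa using h1.symm
  have hsq : ∀ y : Eucl n, ‖y‖ = 1 → ∑ k, y k ^ 2 = 1 := by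
    intro y hy
    rw [← EuclideanSpace.real_norm_sq_eq, hy, one_pow]
  have hterm : ∀ j, -‖x‖ ^ 2 ≤ ⟪x, (∑ a, (w j : Eucl n) a • W a)
      ((∑ k, (v j : Eucl n) k • γ k) x)⟫_ℝ := by
    intro j
    have h1 := hW.norm_sum_apply (fun a => (w j : Eucl n) a) ((∑ k, (v j : Eucl n) k • γ k) x)
    rw [hγ.norm_sum_apply (fun k => (v j : Eucl n) k), hsq (w j : Eucl n) (w.norm_eq_one j),
      hsq (v j : Eucl n) (v.norm_eq_one j), one_mul, one_mul, sq_eq_sq₀ (norm_nonneg _) (norm_nonneg _)] at h1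
    have h2 := neg_le_of_abs_le (abs_real_inner_le_norm x
      ((∑ a, (w j : Eucl n) a • W a) ((∑ k, (v j : Eucl n) k • γ k) x)))
    rw [h1] at h2
    rwa [pow_two]
  have hrw : ∑ k, ⟪x, (∑ a, fderivWithin ℝ N (frontier Ω) p (tangentialPart g ν p (e k p)) a • W a)
        (γ k x)⟫_ℝ = ∑ j, σ j * ⟪x, (∑ a, (w j : Eucl n) a • W a)
      ((∑ k, (v j : Eucl n) k • γ k) x)⟫_ℝ := by
    simp only [htan, map_sum, map_smul, hdN, _root_.sum_apply, _root_.smul_apply, inner_sum,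
      inner_smul_right, PiLp.smul_apply, WithLp.ofLp_sum, Finset.sum_apply, smul_eq_mul,
      Finset.mul_sum, Finset.sum_mul]
    rw [Finset.sum_congr rfl fun k _ => Finset.sum_comm, Finset.sum_comm]
    refine Finset.sum_congr rfl fun j _ => ?_
    refine Finset.sum_congr rfl fun a _ => Finset.sum_congr rfl fun k _ => ?_
    ring
  rw [hrw, ← Finset.sum_neg_distrib]
  calc ∑ j, -(σ j * ⟪x, (∑ a, (w j : Eucl n) a • W a) ((∑ k, (v j : Eucl n) k • γ k) x)⟫_ℝ)
      ≤ ∑ j, σ j * ‖x‖ ^ 2 := Finset.sum_le_sum fun j _ => by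
        have := mul_le_mul_of_nonneg_left (hterm j) (hσ j)
        linarith
    _ ≤ _ := by
        rw [← Finset.sum_mul]
        exact mul_le_mul_of_nonneg_right hsum (sq_nonneg _)

/-- The boundary term has a sign: if the mean curvature dominates the trace norm of `dN`, then
`⟨s, ∇_ν s⟩ ≤ 0` for a harmonic spinor with the boundary condition `-w c s = s`. -/
theorem inner_spinDerivWithin_normal_nonpos (hΩ : IsClosed Ω) (hbd : HasSmoothBoundary Ω)
    (hU : IsOpen U) (hΩU : Ω ⊆ U) (hg : IsRiemannianMetricOn g U)
    (he : IsOrientedOrthonormalFrameOn g e U)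
    (hν : ∀ q ∈ frontier Ω, IsOutwardUnitNormal g Ω q (ν q)) (hp : p ∈ frontier Ω)
    (hγ : IsCliffordFamily γ) (hW : IsCliffordFamily W) (hcomm : ∀ a k, Commute (W a) (γ k))
    (hN : DifferentiableWithinAt ℝ N (frontier Ω) p)
    (hN1 : ∀ q ∈ frontier Ω, ‖N q‖ = 1)
    (hH : traceNormDifferential g Ω ν N p ≤ meanCurvature g Ω ν p)
    (hs : DifferentiableWithinAt ℝ s Ω p)
    (hD : ∑ k, γ k (spinDerivWithin γ g e Ω s p (e k p)) = 0)
    (hχ : ∀ q ∈ frontier Ω, -(∑ a, N q a • W a) ((∑ k, g q (ν q) (e k q) • γ k) (s q)) = s q) :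
    ⟪s p, spinDerivWithin γ g e Ω s p (ν p)⟫_ℝ ≤ 0 := by
  obtain ⟨η, h⟩ := exists_isNormalExtension hΩ hbd hU hΩU hg he hν hp
  have hpU : p ∈ U := hΩU (hΩ.frontier_subset hp)
  set u : Eucl n →L[ℝ] K := fderivWithin ℝ s Ω p + (spinForm γ g e p).flip (s p) with hu
  have hus : ∀ ξ, spinDerivWithin γ g e Ω s p ξ = u ξ := fun _ => rfl
  set x : Fin n → ℝ := fun k => g p (η p) (e k p) with hx
  have hx1 : ∑ k, x k ^ 2 = 1 := by
    rw [← h.unit, he.metric_eq hpU]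
    simp [hx, pow_two]
  have hxe : ∑ k, x k • e k p = η p := he.expansion hpU _
  have hxt : ∑ k, x k • tangentialPart g ν p (e k p) = 0 := by
    simp only [tangentialPart, h.eq_at hp, smul_sub, Finset.sum_sub_distrib, smul_smul, hxe,
      ← Finset.sum_smul]
    simp only [hx] at hx1 ⊢
    simp only [← pow_two, hx1, one_smul, sub_self]
  have hut : ∀ k, u (tangentialPart g ν p (e k p)) = u (e k p) - x k • u (η p) := by
    intro k
    simp only [tangentialPart, map_sub, map_smul, h.eq_at hp, hx]
  have key := hγ.boundary_identity hW hcomm (n := x) hx1 (N := fun a => N p a)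
    (M := fun k a => fderivWithin ℝ N (frontier Ω) p (tangentialPart g ν p (e k p)) a) ?_
    (h := fun k l => g p (covDeriv g η p (tangentialPart g ν p (e k p))) (e l p)) ?_
    (s := s p) (a := u (η p)) (v := fun k => u (tangentialPart g ν p (e k p))) ?_ ?_ ?_ ?_
  · have h1 := h.neg_sum_inner_le hg he hpU hp hγ hW hN hN1 (s p)
    have h2 := mul_le_mul_of_nonneg_right hH (sq_nonneg ‖s p‖)
    rw [h.meanCurvature_eq hU hg he hpU hp] at h2
    rw [hus, h.eq_at hp]
    linarith
  · intro a
    have h1 := congrArg (fun y => fderivWithin ℝ N (frontier Ω) p y a) hxt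
    simpa using h1
  · exact fun k l => h.secondFundamentalForm_symm hp _ _
  · have := hχ p hp
    rwa [h.eq_at hp] at this
  · exact fun k => h.spinDerivWithin_eq hΩ hU hg he hpU hp hγ hcomm hN hs hχ
      (h.metric_tangentialPart hp _)
  · have h1 := congrArg u hxt
    simpa using h1
  · have h1 : ∑ k, γ k (u (e k p)) = 0 := hD
    have h2 : ∑ k, x k • γ k (u (η p)) = (∑ k, x k • γ k) (u (η p)) := by
      simp only [_root_.sum_apply, _root_.smul_apply]
    simp only [hut, map_sub, map_smul, Finset.sum_sub_distrib]
    simp only [← map_smul, ← map_sum]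
    rw [h1, map_zero, zero_sub]
    simp only [map_smul]
    rw [h2, hγ.sq_sum, hx1]
    simp

end BoundaryTerm

/-! ### Rigidity for real Clifford modules -/

section Rigidity

open Filter Topology MeasureTheory

variable {n : ℕ} {g : Eucl n → Eucl n →L[ℝ] Eucl n →L[ℝ] ℝ} {e : Fin n → Eucl n → Eucl n}
  {Ω U : Set (Eucl n)} {ν N : Eucl n → Eucl n} {K : Type*}
  [NormedAddCommGroup K] [InnerProductSpace ℝ K] {γ : Fin n → K →L[ℝ] K} {W : Fin n → K →L[ℝ] K}
  {s : Eucl n → K}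

theorem contDiffOn_spinDerivWithin (hu : UniqueDiffOn ℝ Ω) (hU : IsOpen U) (hΩU : Ω ⊆ U)
    (hg : IsRiemannianMetricOn g U) (he : IsOrientedOrthonormalFrameOn g e U)
    (hs : ContDiffOn ℝ ∞ s Ω) (k : Fin n) :
    ContDiffOn ℝ 1 (fun q => spinDerivWithin γ g e Ω s q (e k q)) Ω := by
  have h1 : ContDiffOn ℝ 1 (fderivWithin ℝ s Ω) Ω :=
    hs.fderivWithin hu (WithTop.coe_le_coe.mpr (le_top (a := (2 : ℕ∞))))
  have h2 : ContDiffOn ℝ 1 (spinForm γ g e) Ω := fun q hq =>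
    ((contDiffAt_spinForm hg hU he (hΩU hq) γ).of_le (by simp)).contDiffWithinAt
  have h3 : ContDiffOn ℝ 1 (e k) Ω := ((he.smooth k).mono hΩU).of_le (by simp)
  exact (h1.clm_apply h3).add ((h2.clm_apply h3).clm_apply (hs.of_le (by simp)))

/-- Integrating the Lichnerowicz formula: a harmonic spinor satisfying the boundary condition
`-w c s = s` is parallel, if the scalar curvature is nonnegative and the mean curvature dominates
the trace norm of `dN`. -/
theorem spinDerivWithin_eq_zero (hΩ : IsCompact Ω) (hbd : HasSmoothBoundary Ω)
    (hU : IsOpen U) (hΩU : Ω ⊆ U) (hg : IsRiemannianMetricOn g U)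
    (he : IsOrientedOrthonormalFrameOn g e U)
    (hν : ∀ q ∈ frontier Ω, IsOutwardUnitNormal g Ω q (ν q))
    (hγ : IsCliffordFamily γ) (hW : IsCliffordFamily W) (hcomm : ∀ a k, Commute (W a) (γ k))
    (hN : DifferentiableOn ℝ N (frontier Ω)) (hN1 : ∀ q ∈ frontier Ω, ‖N q‖ = 1)
    (hR : ∀ p ∈ Ω, 0 ≤ scalarCurvature g p)
    (hH : ∀ p ∈ frontier Ω, traceNormDifferential g Ω ν N p ≤ meanCurvature g Ω ν p)
    (hs : ContDiffOn ℝ ∞ s Ω)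
    (hD : ∀ p ∈ Ω, ∑ k, γ k (spinDerivWithin γ g e Ω s p (e k p)) = 0)
    (hχ : ∀ q ∈ frontier Ω, -(∑ a, N q a • W a) ((∑ k, g q (ν q) (e k q) • γ k) (s q)) = s q)
    {p : Eucl n} (hp : p ∈ Ω) (ξ : Eucl n) : spinDerivWithin γ g e Ω s p ξ = 0 := by
  have hu := hbd.uniqueDiffOn
  have hfr := hΩ.isClosed.frontier_subset
  set Y : Eucl n → Eucl n := fun q =>
    ∑ k, (⟪s q, spinDerivWithin γ g e Ω s q (e k q)⟫_ℝ * frameDensity e q) • e k q with hYdef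
  have hY : ContDiffOn ℝ 1 Y Ω := by
    refine ContDiffOn.sum fun k _ => ContDiffOn.fun_smul (ContDiffOn.mul ?_ fun q hq => ?_) ?_
    · exact (hs.of_le (by simp)).inner ℝ (contDiffOn_spinDerivWithin hu hU hΩU hg he hs k)
    · exact ((contDiffAt_frameDensity he hU (hΩU hq)).of_le (by simp)).contDiffWithinAt
    · exact ((he.smooth k).mono hΩU).of_le (by simp)
  have hin : IsInwardField Ω Y := by
    intro q hq f V hf
    have hqU := hΩU (hfr hq)
    obtain ⟨_, f', V', hf', c, hc, hνξ⟩ := hν q hq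
    obtain ⟨a, ha, hfa⟩ := hf'.fderiv_eq_smul hf
    have h1 : g q (ν q) (Y q)
        = frameDensity e q * ⟪s q, spinDerivWithin γ g e Ω s q (ν q)⟫_ℝ := by
      have h2 : spinDerivWithin γ g e Ω s q (ν q)
          = ∑ k, g q (ν q) (e k q) • spinDerivWithin γ g e Ω s q (e k q) := by
        conv_lhs => rw [← he.expansion hqU (ν q)]
        simp only [spinDerivWithin, map_sum, map_smul, _root_.sum_apply, _root_.smul_apply,
          smul_add, Finset.sum_add_distrib]
      rw [h2, hYdef]
      simp only [map_sum, map_smul, smul_eq_mul, inner_sum, inner_smul_right, Finset.mul_sum]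
      exact Finset.sum_congr rfl fun k _ => by ring
    have h3 := inner_spinDerivWithin_normal_nonpos hΩ.isClosed hbd hU hΩU hg he hν hq hγ hW hcomm
      (hN q hq) hN1 (hH q hq) ((hs.differentiableOn (by simp)) q (hfr hq)) (hD q (hfr hq)) hχ
    have h4 : c * fderiv ℝ f' q (Y q) ≤ 0 := by
      rw [← hνξ, h1]
      exact mul_nonpos_of_nonneg_of_nonpos (frameDensity_pos he hqU).le h3
    rw [hfa, _root_.smul_apply, smul_eq_mul]
    exact mul_nonpos_of_nonneg_of_nonpos ha.le (nonpos_of_mul_nonpos_right h4 hc)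
  have hint := integral_divergenceWithin_nonpos hΩ hbd hY hin
  have hsd : ∀ q ∈ interior Ω, spinDerivWithin γ g e Ω s q = spinDeriv γ g e s q := by
    intro q hq
    ext ζ
    rw [spinDerivWithin, spinDeriv, fderivWithin_of_mem_nhds (mem_interior_iff_mem_nhds.mp hq)]
  have hdiv : ∀ q ∈ interior Ω, divergenceWithin Ω Y q
      = frameDensity e q * (∑ k, ‖spinDerivWithin γ g e Ω s q (e k q)‖ ^ 2
        + 1 / 4 * scalarCurvature g q * ‖s q‖ ^ 2) := by
    intro q hq
    have hqΩ := interior_subset hq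
    have hev : Y =ᶠ[𝓝 q] bochnerField γ g e s := by
      filter_upwards [isOpen_interior.mem_nhds hq] with x hx
      simp only [hYdef, bochnerField, hsd x hx]
    rw [divergenceWithin_eq_of_mem_interior hq, hev.fderiv_eq, hsd q hq]
    refine divergence_bochnerField hγ hg hU he (hΩU hqΩ)
      (hs.contDiffAt (mem_interior_iff_mem_nhds.mp hq)) ?_
    filter_upwards [isOpen_interior.mem_nhds hq] with x hx
    rw [← hsd x hx]
    exact hD x (interior_subset hx)
  have hterm : ∀ q ∈ interior Ω, 0 ≤ 1 / 4 * scalarCurvature g q * ‖s q‖ ^ 2 := fun q hq => by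
    have := hR q (interior_subset hq)
    positivity
  have hsum : ∀ q, 0 ≤ ∑ k, ‖spinDerivWithin γ g e Ω s q (e k q)‖ ^ 2 := fun q =>
    Finset.sum_nonneg fun k _ => sq_nonneg _
  have hnonneg : ∀ q ∈ interior Ω, 0 ≤ divergenceWithin Ω Y q := by
    intro q hq
    rw [hdiv q hq]
    exact mul_nonneg (frameDensity_pos he (hΩU (interior_subset hq))).le
      (add_nonneg (hsum q) (hterm q hq))
  have hae : 0 ≤ᵐ[volume.restrict (interior Ω)] divergenceWithin Ω Y :=
    (ae_restrict_iff' isOpen_interior.measurableSet).mpr (Eventually.of_forall hnonneg)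
  have hzero : divergenceWithin Ω Y =ᵐ[volume.restrict (interior Ω)] 0 :=
    (setIntegral_eq_zero_iff_of_nonneg_ae hae (integrableOn_divergenceWithin hΩ hu hY)).mp
      (le_antisymm hint (integral_nonneg_of_ae hae))
  have hEq := Measure.eqOn_open_of_ae_eq hzero isOpen_interior
    ((continuousOn_divergenceWithin hu hY).mono interior_subset) continuousOn_const
  have hframe : ∀ q ∈ interior Ω, ∀ k, spinDerivWithin γ g e Ω s q (e k q) = 0 := by
    intro q hq k
    have h1 : divergenceWithin Ω Y q = 0 := hEq hq
    rw [hdiv q hq] at h1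
    have h2 := (mul_eq_zero.mp h1).resolve_left
      (frameDensity_pos he (hΩU (interior_subset hq))).ne'
    have h3 : ∑ k, ‖spinDerivWithin γ g e Ω s q (e k q)‖ ^ 2 = 0 := by
      linarith [hsum q, hterm q hq]
    have h4 := (Finset.sum_eq_zero_iff_of_nonneg fun k _ => sq_nonneg _).mp h3 k (Finset.mem_univ k)
    simpa using h4
  have hframe' : ∀ k, spinDerivWithin γ g e Ω s p (e k p) = 0 := by
    intro k
    have hc := (contDiffOn_spinDerivWithin (γ := γ) hu hU hΩU hg he hs k).continuousOn
    have h5 : Set.EqOn (fun q => spinDerivWithin γ g e Ω s q (e k q)) (fun _ => 0)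
        (interior Ω) := fun q hq => hframe q hq k
    exact h5.of_subset_closure hc continuousOn_const interior_subset
      hbd.subset_closure_interior hp
  have h6 : spinDerivWithin γ g e Ω s p ξ
      = ∑ k, g p ξ (e k p) • spinDerivWithin γ g e Ω s p (e k p) := by
    conv_lhs => rw [← he.expansion (hΩU hp) ξ]
    simp only [spinDerivWithin, map_sum, map_smul, _root_.sum_apply, _root_.smul_apply,
      smul_add, Finset.sum_add_distrib]
  rw [h6]
  simp [hframe']

end Rigidity

/-! ### Tuples of spinors as a real Clifford module -/

section SpinRepresentation

variable {n m : ℕ} {Δ : Type*} [NormedAddCommGroup Δ] [InnerProductSpace ℂ Δ]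

theorem cliffordForm_polar_single (a c : Fin n) :
    QuadraticMap.polar (cliffordForm n) (Pi.single a (1 : ℂ)) (Pi.single c (1 : ℂ))
      = if a = c then -2 else 0 := by
  have h : ∀ x y : Fin n → ℂ, QuadraticMap.polar (cliffordForm n) x y = -2 * ∑ i, x i * y i := by
    intro x y
    simp only [QuadraticMap.polar, cliffordForm, QuadraticMap.weightedSumSquares_apply,
      Finset.mul_sum, ← Finset.sum_sub_distrib, Pi.add_apply, smul_eq_mul]
    exact Finset.sum_congr rfl fun i _ => by ring
  rw [h]
  simp [Pi.single_apply, eq_comm]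

theorem SpinRep.gamma_mul_add (ρ : SpinRep n Δ) (a c : Fin n) :
    ρ.gamma a * ρ.gamma c + ρ.gamma c * ρ.gamma a
      = if a = c then (-2 : ℂ) • (1 : Module.End ℂ Δ) else 0 := by
  simp only [SpinRep.gamma, cliffordGen, ← map_mul, ← map_add,
    CliffordAlgebra.ι_mul_ι_add_swap, cliffordForm_polar_single]
  split_ifs
  · rw [AlgHom.commutes, Algebra.algebraMap_eq_smul_one]
  · simp

theorem SpinRep.gamma_skew (ρ : SpinRep n Δ) (a : Fin n) (x y : Δ) :
    ⟪ρ.gamma a x, y⟫_ℂ = -⟪x, ρ.gamma a y⟫_ℂ := ρ.skew a x y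

/-- The matrix `(ω_{aαβ})_{αβ}`, the transpose of the matrix of `E_a` in the basis `b`. -/
noncomputable def omegaMatrix (ρ : SpinRep n Δ) (b : OrthonormalBasis (Fin m) ℂ Δ) (a : Fin n) :
    Matrix (Fin m) (Fin m) ℂ := Matrix.of (omegaCoeff ρ b a)

theorem omegaMatrix_mul (ρ : SpinRep n Δ) (b : OrthonormalBasis (Fin m) ℂ Δ) (a c : Fin n)
    (α δ : Fin m) : (omegaMatrix ρ b c * omegaMatrix ρ b a) α δ
      = ⟪b δ, (ρ.gamma a * ρ.gamma c) (b α)⟫_ℂ := by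
  have h := b.sum_inner_mul_inner (ρ.gamma a (b δ)) (ρ.gamma c (b α))
  rw [Matrix.mul_apply, Module.End.mul_apply, ← neg_eq_iff_eq_neg.mpr (ρ.gamma_skew a _ _), ← h,
    ← Finset.sum_neg_distrib]
  refine Finset.sum_congr rfl fun β _ => ?_
  rw [ρ.gamma_skew, omegaMatrix, omegaMatrix]
  simp only [Matrix.of_apply, omegaCoeff]
  ring

theorem omegaMatrix_mul_add (ρ : SpinRep n Δ) (b : OrthonormalBasis (Fin m) ℂ Δ) (a c : Fin n) :
    omegaMatrix ρ b a * omegaMatrix ρ b c + omegaMatrix ρ b c * omegaMatrix ρ b a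
      = if a = c then (-2 : ℂ) • (1 : Matrix (Fin m) (Fin m) ℂ) else 0 := by
  ext α δ
  rw [Matrix.add_apply, omegaMatrix_mul, omegaMatrix_mul, ← inner_add_right,
    ← LinearMap.add_apply, ρ.gamma_mul_add]
  simp only [eq_comm (a := c)]
  split_ifs
  · simp only [LinearMap.smul_apply, Module.End.one_apply, inner_smul_right, b.inner_eq_ite,
      Matrix.smul_apply, Matrix.one_apply, smul_eq_mul, eq_comm (a := δ)]
  · simp

theorem omegaMatrix_conj (ρ : SpinRep n Δ) (b : OrthonormalBasis (Fin m) ℂ Δ) (a : Fin n)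
    (α β : Fin m) : (starRingEnd ℂ) (omegaMatrix ρ b a α β) = -omegaMatrix ρ b a β α := by
  simp only [omegaMatrix, Matrix.of_apply, omegaCoeff, inner_conj_symm]
  exact ρ.gamma_skew a _ _

-- `PiLp` spaces, too, carry the real part of their Hermitian product as real inner product here.
attribute [local instance] InnerProductSpace.complexToReal

theorem real_inner_eq_re (x y : Δ) : ⟪x, y⟫_ℝ = (⟪x, y⟫_ℂ).re := rfl

variable [FiniteDimensional ℂ Δ]

/-- An endomorphism of `Δ`, acting on each entry of an `m`-tuple, as a real operator. -/
noncomputable def entrywise (m : ℕ) (T : Module.End ℂ Δ) :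
    PiLp 2 (fun _ : Fin m => Δ) →L[ℝ] PiLp 2 (fun _ : Fin m => Δ) :=
  LinearMap.toContinuousLinearMap
    { toFun := fun x => WithLp.toLp 2 fun α => T (x α)
      map_add' := fun x y => by ext α; simp
      map_smul' := fun c x => by ext α; simp [← Complex.coe_smul] }

/-- A complex matrix, acting on `m`-tuples, as a real operator. -/
noncomputable def matrixAction (A : Matrix (Fin m) (Fin m) ℂ) :
    PiLp 2 (fun _ : Fin m => Δ) →L[ℝ] PiLp 2 (fun _ : Fin m => Δ) :=
  LinearMap.toContinuousLinearMap
    { toFun := fun x => WithLp.toLp 2 fun α => ∑ β, A α β • x β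
      map_add' := fun x y => by ext α; simp [Finset.sum_add_distrib]
      map_smul' := fun c x => by
        ext α; simp [← Complex.coe_smul, Finset.smul_sum, smul_smul, mul_comm] }

theorem entrywise_apply (T : Module.End ℂ Δ) (x : PiLp 2 (fun _ : Fin m => Δ)) (α : Fin m) :
    entrywise m T x α = T (x α) := rfl

theorem matrixAction_apply (A : Matrix (Fin m) (Fin m) ℂ) (x : PiLp 2 (fun _ : Fin m => Δ))
    (α : Fin m) : matrixAction A x α = ∑ β, A α β • x β := rfl

theorem isCliffordFamily_entrywise (ρ : SpinRep n Δ) :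
    IsCliffordFamily fun k => entrywise m (ρ.gamma k) := by
  constructor
  · intro i j
    ext x α
    have h := congrArg (fun T : Module.End ℂ Δ => T (x α)) (ρ.gamma_mul_add i j)
    simp only [LinearMap.add_apply, Module.End.mul_apply] at h
    simp only [_root_.add_apply, mul_apply_eq_comp, PiLp.add_apply, entrywise_apply, h]
    split_ifs
    · simp [← Complex.coe_smul]
    · simp
  · intro i x y
    simp only [PiLp.inner_apply, entrywise_apply, real_inner_eq_re, ρ.gamma_skew,
      Finset.sum_neg_distrib, Complex.neg_re]

theorem isCliffordFamily_matrixAction (ρ : SpinRep n Δ) (b : OrthonormalBasis (Fin m) ℂ Δ) :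
    IsCliffordFamily fun a => matrixAction (Δ := Δ) (omegaMatrix ρ b a) := by
  have hmul : ∀ A B : Matrix (Fin m) (Fin m) ℂ, matrixAction (Δ := Δ) A * matrixAction B
      = matrixAction (A * B) := by
    intro A B
    ext x α
    simp only [mul_apply_eq_comp, matrixAction_apply, Matrix.mul_apply, Finset.sum_smul,
      Finset.smul_sum, smul_smul]
    exact Finset.sum_comm
  have hadd : ∀ A B : Matrix (Fin m) (Fin m) ℂ, matrixAction (Δ := Δ) A + matrixAction B
      = matrixAction (A + B) := by
    intro A B
    ext x α
    simp only [_root_.add_apply, PiLp.add_apply, matrixAction_apply, Matrix.add_apply, add_smul,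
      Finset.sum_add_distrib]
  constructor
  · intro i j
    rw [hmul, hmul, hadd, omegaMatrix_mul_add]
    ext x α
    split_ifs
    · simp [matrixAction_apply, Matrix.one_apply, ← Complex.coe_smul, ite_smul]
    · simp [matrixAction_apply]
  · intro a x y
    simp only [PiLp.inner_apply, matrixAction_apply, real_inner_eq_re, ← Complex.neg_re]
    congr 1
    simp only [sum_inner, inner_sum, inner_smul_left, inner_smul_right, omegaMatrix_conj]
    rw [Finset.sum_comm, ← Finset.sum_neg_distrib]
    refine Finset.sum_congr rfl fun β _ => ?_
    rw [← Finset.sum_neg_distrib]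
    exact Finset.sum_congr rfl fun α _ => by ring

theorem commute_matrixAction_entrywise (A : Matrix (Fin m) (Fin m) ℂ) (T : Module.End ℂ Δ) :
    Commute (matrixAction A) (entrywise m T) := by
  refine ContinuousLinearMap.ext fun x => ?_
  ext α
  simp only [mul_apply_eq_comp, matrixAction_apply, entrywise_apply, map_sum, map_smul]

theorem IsCliffordFamily.neg {ι K : Type*} [DecidableEq ι] [NormedAddCommGroup K]
    [InnerProductSpace ℝ K] {γ : ι → K →L[ℝ] K} (h : IsCliffordFamily γ) :
    IsCliffordFamily fun i => -γ i where
  relations := fun i j => by rw [neg_mul_neg, neg_mul_neg, h.relations]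
  skew := fun i x y => by simp [inner_neg_left, inner_neg_right, h.skew]

end SpinRepresentation

/-! ### Spinors in the trivialization -/

section SpinorTuples

variable {n m : ℕ} {Δ : Type*} [NormedAddCommGroup Δ] [InnerProductSpace ℂ Δ]
  {g : Eucl n → Eucl n →L[ℝ] Eucl n →L[ℝ] ℝ} {e : Fin n → Eucl n → Eucl n}
  {Ω U : Set (Eucl n)} {ν N : Eucl n → Eucl n} {p : Eucl n}

theorem cliffordMul_frame (ρ : SpinRep n Δ) (he : IsOrientedOrthonormalFrameOn g e U)
    (hp : p ∈ U) (k : Fin n) : cliffordMul ρ g e p (e k p) = ρ.gamma k := by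
  simp [cliffordMul, he.orthonormal p hp]

attribute [local instance] InnerProductSpace.complexToReal

variable [FiniteDimensional ℂ Δ]

/-- An `m`-tuple of spinors as one function. -/
noncomputable def spinorTuple (s : Fin m → Eucl n → Δ) (q : Eucl n) : PiLp 2 (fun _ : Fin m => Δ) :=
  WithLp.toLp 2 fun α => s α q

theorem spinDerivWithin_spinorTuple (hu : UniqueDiffOn ℝ Ω) (hU : IsOpen U) (hΩU : Ω ⊆ U)
    (hg : IsRiemannianMetricOn g U) (he : IsOrientedOrthonormalFrameOn g e U) (ρ : SpinRep n Δ)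
    {s : Fin m → Eucl n → Δ} (hs : ∀ α, DifferentiableOn ℝ (s α) Ω) (hp : p ∈ Ω) (ξ : Eucl n)
    (α : Fin m) : spinDerivWithin (fun k => entrywise m (ρ.gamma k)) g e Ω (spinorTuple s) p ξ α
      = spinConnection ρ g e Ω (s α) p ξ := by
  have hS : DifferentiableWithinAt ℝ (spinorTuple s) Ω p :=
    (differentiableWithinAt_piLp 2).mpr fun α => hs α p hp
  have h1 := (PiLp.proj (𝕜 := ℝ) 2 (fun _ : Fin m => Δ) α).hasFDerivAt.comp_hasFDerivWithinAt p
    hS.hasFDerivWithinAt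
  have h2 : fderivWithin ℝ (s α) Ω p = _ := h1.fderivWithin (hu p hp)
  rw [spinConnection, h2, spinDerivWithin, spinForm_apply hg hU (hΩU hp)]
  simp only [cliffordMul_frame ρ he (hΩU hp)]
  rw [PiLp.add_apply]
  congr 1
  simp only [spinElement, _root_.smul_apply, _root_.sum_apply, PiLp.smul_apply, WithLp.ofLp_sum,
    Finset.sum_apply, mul_apply_eq_comp, entrywise_apply, ← Complex.coe_smul]
  simp [spinorTuple]

theorem chi_spinorTuple (ρ : SpinRep n Δ) (b : OrthonormalBasis (Fin m) ℂ Δ)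
    (s : Fin m → Eucl n → Δ) (q : Eucl n) :
    -(∑ a, N q a • matrixAction (omegaMatrix ρ b a))
        ((∑ k, g q (ν q) (e k q) • entrywise m (ρ.gamma k)) (spinorTuple s q))
      = WithLp.toLp 2 (chi ρ b g e ν N q fun α => s α q) := by
  have hc : ∀ β, ((∑ k, g q (ν q) (e k q) • entrywise m (ρ.gamma k)) (spinorTuple s q)) β
      = cliffordMul ρ g e q (ν q) (s β q) := by
    intro β
    simp only [cliffordMul, _root_.smul_apply, _root_.sum_apply, PiLp.smul_apply, WithLp.ofLp_sum,
      Finset.sum_apply, entrywise_apply, ← Complex.coe_smul, LinearMap.sum_apply,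
      LinearMap.smul_apply]
    rfl
  generalize (∑ k, g q (ν q) (e k q) • entrywise m (ρ.gamma k)) (spinorTuple s q) = y at hc ⊢
  ext α
  simp only [chi, ← hc, PiLp.neg_apply, _root_.smul_apply, _root_.sum_apply, PiLp.smul_apply,
    WithLp.ofLp_sum, Finset.sum_apply, matrixAction_apply, ← Complex.coe_smul, Finset.smul_sum,
    smul_smul]
  congr 1
  refine Finset.sum_congr rfl fun a _ => Finset.sum_congr rfl fun β _ => ?_
  simp [stdVec, omegaMatrix, EuclideanSpace.inner_single_right]

end SpinorTuples

section Parallel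

variable {n m : ℕ} {Δ : Type*} [NormedAddCommGroup Δ] [InnerProductSpace ℂ Δ]
  {g : Eucl n → Eucl n →L[ℝ] Eucl n →L[ℝ] ℝ} {e : Fin n → Eucl n → Eucl n}
  {Ω U : Set (Eucl n)} {ν N : Eucl n → Eucl n}

attribute [local instance] InnerProductSpace.complexToReal

/-- Rigidity for tuples of harmonic spinors with `χ s = σ s`, where `σ` is a sign. The sign is
absorbed into the matrices `ω_a`. -/
theorem isParallelSpinor_of_chi_eq_smul (ρ : SpinRep n Δ) (b : OrthonormalBasis (Fin m) ℂ Δ)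
    (hΩ : IsCompact Ω) (hbd : HasSmoothBoundary Ω)
    (hU : IsOpen U) (hΩU : Ω ⊆ U) (hg : IsRiemannianMetricOn g U)
    (he : IsOrientedOrthonormalFrameOn g e U)
    (hν : ∀ p ∈ frontier Ω, IsOutwardUnitNormal g Ω p (ν p))
    (hN : DifferentiableOn ℝ N (frontier Ω)) (hN1 : ∀ p ∈ frontier Ω, ‖N p‖ = 1)
    (hR : ∀ p ∈ Ω, 0 ≤ scalarCurvature g p)
    (hH : ∀ p ∈ frontier Ω, traceNormDifferential g Ω ν N p ≤ meanCurvature g Ω ν p)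
    {σ : ℝ} (hσ : σ = 1 ∨ σ = -1) {s : Fin m → Eucl n → Δ}
    (hs : ∀ α, IsHarmonicSpinor ρ g e Ω (s α))
    (hχ : ∀ p ∈ frontier Ω, chi ρ b g e ν N p (fun α => s α p) = fun α => σ • s α p) (α : Fin m) :
    IsParallelSpinor ρ g e Ω (s α) := by
  have : FiniteDimensional ℂ Δ := b.toBasis.finiteDimensional_of_finite
  intro p hp ξ
  have hu := hbd.uniqueDiffOn
  have hsd : ∀ α, DifferentiableOn ℝ (s α) Ω := fun α => (hs α).1.differentiableOn (by simp)
  have hW : IsCliffordFamily fun a => σ • matrixAction (Δ := Δ) (omegaMatrix ρ b a) := by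
    rcases hσ with rfl | rfl
    · simpa using isCliffordFamily_matrixAction ρ b
    · simpa using (isCliffordFamily_matrixAction ρ b).neg
  have hσσ : σ * σ = 1 := by rcases hσ with rfl | rfl <;> norm_num
  have h := spinDerivWithin_eq_zero (γ := fun k => entrywise m (ρ.gamma k)) (s := spinorTuple s)
    hΩ hbd hU hΩU hg he hν
    (isCliffordFamily_entrywise ρ) hW
    (fun a k => (commute_matrixAction_entrywise _ _).smul_left σ) hN hN1 hR hH
    ((contDiffOn_piLp 2).mpr fun α => (hs α).1) ?_ ?_ hp ξ
  · rw [← spinDerivWithin_spinorTuple hu hU hΩU hg he ρ hsd hp ξ α, h]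
    rfl
  · intro q hq
    ext β
    have h1 := (hs β).2 q hq
    simp only [dirac, cliffordMul_frame ρ he (hΩU hq)] at h1
    simpa [entrywise_apply, spinDerivWithin_spinorTuple hu hU hΩU hg he ρ hsd hq] using h1
  · intro q hq
    have h1 := chi_spinorTuple (g := g) (e := e) (ν := ν) (N := N) ρ b s q
    rw [hχ q hq] at h1
    have h2 : ∑ a, N q a • σ • matrixAction (Δ := Δ) (omegaMatrix ρ b a)
        = σ • ∑ a, N q a • matrixAction (omegaMatrix ρ b a) := by
      rw [Finset.smul_sum]
      exact Finset.sum_congr rfl fun a _ => smul_comm _ _ _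
    rw [h2, _root_.smul_apply, ← smul_neg, h1]
    ext β
    simp [spinorTuple, smul_smul, hσσ]

end Parallel

end SpinBVP

theorem corollary2 (n : ℕ) (hn : 3 ≤ n) (hodd : Odd n)
    {Δ : Type*} [NormedAddCommGroup Δ] [InnerProductSpace ℂ Δ]
    (ρ : SpinRep n Δ) (b : OrthonormalBasis (Fin (2 ^ (n / 2))) ℂ Δ)
    (Ω U : Set (Eucl n)) (hΩ : IsCompact Ω) (hbd : HasSmoothBoundary Ω)
    (hU : IsOpen U) (hΩU : Ω ⊆ U)
    (g : Eucl n → Eucl n →L[ℝ] Eucl n →L[ℝ] ℝ) (hg : IsRiemannianMetricOn g U)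
    (e : Fin n → Eucl n → Eucl n) (he : IsOrientedOrthonormalFrameOn g e U)
    (ν : Eucl n → Eucl n) (hν : ∀ p ∈ frontier Ω, IsOutwardUnitNormal g Ω p (ν p))
    (N : Eucl n → Eucl n) (hN : ContDiffOn ℝ ∞ N (frontier Ω))
    (hN1 : ∀ p ∈ frontier Ω, ‖N p‖ = 1)
    (hR : ∀ p ∈ Ω, 0 ≤ scalarCurvature g p)
    (hH : ∀ p ∈ frontier Ω, traceNormDifferential g Ω ν N p ≤ meanCurvature g Ω ν p) :
    (∀ s : Fin (2 ^ (n / 2)) → Eucl n → Δ,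
      (∀ α, IsHarmonicSpinor ρ g e Ω (s α)) →
      (∀ p ∈ frontier Ω, chi ρ b g e ν N p (fun α => s α p) = fun α => s α p) →
      ∀ α, IsParallelSpinor ρ g e Ω (s α)) ∧
    (∀ s : Fin (2 ^ (n / 2)) → Eucl n → Δ,
      (∀ α, IsHarmonicSpinor ρ g e Ω (s α)) →
      (∀ p ∈ frontier Ω, chi ρ b g e ν N p (fun α => s α p) = fun α => -s α p) →
      ∀ α, IsParallelSpinor ρ g e Ω (s α)) := by
  have hNd : DifferentiableOn ℝ N (frontier Ω) := hN.differentiableOn (by simp)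
  refine ⟨fun s hs hχ => ?_, fun s hs hχ => ?_⟩
  · exact isParallelSpinor_of_chi_eq_smul ρ b hΩ hbd hU hΩU hg he hν hNd hN1 hR hH
      (Or.inl rfl) hs fun p hp => by simpa using hχ p hp
  · exact isParallelSpinor_of_chi_eq_smul ρ b hΩ hbd hU hΩU hg he hν hNd hN1 hR hH
      (Or.inr rfl) hs fun p hp => by simpa using hχ p hp
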